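/- Let $k$ be a field and let $\pi\colon E\to B$ be a Serre fibration. Let $C=C_*(E;k)$ be the singular chain complex with boundary $\partial$, the Alexander--Whitney diagonal $\triangle(\sigma)=\sum_{i=0}^n(\sigma\circ[0,\dots,i])\otimes(\sigma\circ[i,\dots,n])$ and the augmentation $\epsilon\colon C\to k$. Filter $C$ by the Serre filtration: $F^p\subset C$ is spanned by the singular simplices $\sigma\colon\Delta^n\to E$ such that $\pi\circ\sigma=\tau\circ s$ for some singular simplex $\tau\colon\Delta^m\to B$ with $m\le p$ and some surjective order-preserving map $s\colon[n]\to[m]$. The homological Serre spectral sequence of $\pi$ is the spectral sequence $(E^r,d^r)_{r\ge 0}$ of this filtered complex, $E^r_{p,q}=(Z^r_{p,q}+F^{p-1}_{p+q})/(B^{r-1}_{p,q}+F^{p-1}_{p+q})$ with $Z^r_{p,q}=F^p_{p+q}\cap\partial^{-1}(F^{p-r}_{p+q-1})$ and $B^r_{p,q}=F^p_{p+q}\cap\partial(F^{p+r}_{p+q+1})$. Then: (1) $(C,\triangle,\epsilon)$ is a filtered differential graded coalgebra: $\triangle$ and $\epsilon$ are chain maps, they make $C$ a coassociative counital graded coalgebra,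 and $\triangle(F^p)\subset\sum_{a+b=p}F^a\otimes F^b$ for all $p$. (2) The Serre spectral sequence is a spectral sequence of coalgebras: there are bigraded (coassociative, counital) coalgebra structures $(\triangle^r,\epsilon^r)$ on all pages $E^r_{*,*}$, $r\ge0$, such that $(\triangle^0,\epsilon^0)$ is induced on $E^0_{p,q}=F^p_{p+q}/F^{p-1}_{p+q}$ by $(\triangle,\epsilon)$, the co-Leibniz rule $\triangle^r d^r=(d^r\otimes 1\pm 1\otimes d^r)\triangle^r$ holds with the Koszul sign $(-1)^{p+q}$ on $E^r_{p,q}\otimes E^r_{*,*}$, and $(\triangle^{r+1},\epsilon^{r+1})$ is the structure induced by $(\triangle^r,\epsilon^r)$ on $E^{r+1}\cong H(E^r,d^r)$ by means of the Künneth isomorphism $H(E^r\otimes E^r)\cong H(E^r)\otimes H(E^r)$. (3) It converges to $H_*(E;k)$ as a coalgebra: give $H_*(E;k)$ the graded coalgebra structure induced by $\triangle$, $\epsilon$ and the Künneth isomorphism $H(C\otimes C)\cong H(C)\otimes H(C)$, and the filtration in which $F^pH_*(E;k)$ is the image of $H_*(F^p)$. This is a first quadrant filtration ($F^pH_n=0$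 for $p<0$ and $F^pH_n=H_n$ for $p\ge n$), and the comultiplication maps $F^pH_*$ to $\sum_{a+b=p}F^aH_*\otimes F^bH_*$, so that $\mathrm{Gr}(H_*(E;k))$ is a bigraded coalgebra. The spectral sequence lies in the first quadrant, so that $E^\infty_{p,q}=E^r_{p,q}$ for $r\ge\max(p+1,q+2)$ is a bigraded coalgebra, and there are isomorphisms $E^\infty_{p,q}\cong F^pH_{p+q}(E;k)/F^{p-1}H_{p+q}(E;k)$ which together form an isomorphism of bigraded coalgebras $E^\infty\cong\mathrm{Gr}(H_*(E;k))$. -/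

import Mathlib

open CategoryTheory
open scoped TensorProduct DirectSum

universe u v w

noncomputable section

namespace SerreSS

/-! ### Graded, filtered and differential modules -/

section Algebra

variable {k : Type v} [CommRing k] {M : Type w} [AddCommGroup M] [Module k M]

/-- For a family of submodules `A i ⊆ M`, the family
`n ↦ ∑_{i + j = n} A i ⊗ A j` of submodules of `M ⊗ M`. For a grading this is the grading of the
tensor product, for a filtration `F` it is the induced filtration `G` of the tensor product. -/
def tensorFamily {ι : Type*} [Add ι] (A : ι → Submodule k M) (n : ι) : Submodule k (M ⊗[k] M) :=
  ⨆ (i : ι) (j : ι) (_ : i + j = n), Submodule.map₂ (TensorProduct.mk k M M) (A i) (A j)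

/-- A (coassociative, counital) graded coalgebra: a coalgebra structure on `M` whose
comultiplication and counit preserve the degrees given by the family `A`. -/
structure GradedCoalgebra {ι : Type*} [AddMonoid ι] (k : Type v) [CommRing k] (M : Type w)
    [AddCommGroup M] [Module k M] (A : ι → Submodule k M) extends Coalgebra k M where
  comul_mem : ∀ i, ∀ x ∈ A i, comul x ∈ tensorFamily A i
  counit_eq_zero : ∀ i, i ≠ 0 → ∀ x ∈ A i, counit x = 0

/-- The Koszul differential `d ⊗ 1 + s ⊗ d` of `M ⊗ M`, where `s` is the sign involution
`x ↦ (-1)^{|x|} x`. -/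
def tensorD (s d : M →ₗ[k] M) : M ⊗[k] M →ₗ[k] M ⊗[k] M :=
  TensorProduct.map d LinearMap.id + TensorProduct.map s d

/-- Let `T` be a complex with differential `D` on `T ⊗ T`, let `inc : Z → T` be the inclusion of
the cycles and `cls : Z → H` the projection to homology. The map `δ : H → H ⊗ H` is the map
`H(T) → H(T ⊗ T) ≅ H(T) ⊗ H(T)` induced by `Δ : T → T ⊗ T` and the Künneth isomorphism:
for a cycle `z`, the chain `Δ z` is homologous to some `w ∈ Z ⊗ Z`, and `δ [z]` is the image of
every such `w`. -/
def InducesOnHomology {T Z H : Type*} [AddCommGroup T] [Module k T] [AddCommGroup Z] [Module k Z]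
    [AddCommGroup H] [Module k H] (D : T ⊗[k] T →ₗ[k] T ⊗[k] T) (inc : Z →ₗ[k] T)
    (cls : Z →ₗ[k] H) (Δ : T →ₗ[k] T ⊗[k] T) (δ : H →ₗ[k] H ⊗[k] H) : Prop :=
  ∀ z : Z,
    (∃ w : Z ⊗[k] Z, Δ (inc z) - TensorProduct.map inc inc w ∈ LinearMap.range D) ∧
    ∀ w : Z ⊗[k] Z, Δ (inc z) - TensorProduct.map inc inc w ∈ LinearMap.range D →
      δ (cls z) = TensorProduct.map cls cls w

/-- The homogeneous components `V i ⊆ ⨁ i, V i`. -/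
def component {ι : Type*} [DecidableEq ι] {V : ι → Type*} [∀ i, AddCommGroup (V i)]
    [∀ i, Module k (V i)] (i : ι) : Submodule k (⨁ i, V i) :=
  LinearMap.range (DirectSum.lof k ι V i)

/-- `F^p_{p+q} = F^p ∩ M_{p+q}`. -/
abbrev filPiece (deg fil : ℤ → Submodule k M) (pq : ℤ × ℤ) : Submodule k M :=
  fil pq.1 ⊓ deg (pq.1 + pq.2)

/-- The associated bigraded module, `Gr_{p,q} = F^p_{p+q} / F^{p-1}_{p+q}`. -/
abbrev Gr (deg fil : ℤ → Submodule k M) (pq : ℤ × ℤ) : Type w :=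
  ↥(filPiece deg fil pq) ⧸ (fil (pq.1 - 1) ⊓ deg (pq.1 + pq.2)).submoduleOf (filPiece deg fil pq)

/-- The class of an element of `F^p_{p+q}` in `Gr_{p,q}`. -/
abbrev toGr (deg fil : ℤ → Submodule k M) (pq : ℤ × ℤ) :
    ↥(filPiece deg fil pq) →ₗ[k] Gr deg fil pq :=
  Submodule.mkQ _

/-- Let `cls_{p,q} : F^p_{p+q} → V_{p,q}` be the projection to the associated bigraded module `V`
of the filtered graded module `M`. The map `δ` is the map `Gr(Δ)` induced on `V` by the filtered
map `Δ : M → M ⊗ M`: for `z ∈ F^p_{p+q}`, the element `Δ z` is congruent modulo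
`∑_{c + d = p - 1} F^c ⊗ F^d` to some
`w ∈ ⨁_{a + b = p, c + d = q} F^a_{a+c} ⊗ F^b_{b+d}`, and `δ [z]` is the image of every such `w`. -/
def InducesOnGr (deg fil : ℤ → Submodule k M) {V : ℤ × ℤ → Type*} [∀ pq, AddCommGroup (V pq)]
    [∀ pq, Module k (V pq)] (cls : ∀ pq, ↥(filPiece deg fil pq) →ₗ[k] V pq)
    (Δ : M →ₗ[k] M ⊗[k] M) (δ : (⨁ pq, V pq) →ₗ[k] (⨁ pq, V pq) ⊗[k] (⨁ pq, V pq)) : Prop :=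
  let inc : (⨁ pq, ↥(filPiece deg fil pq)) →ₗ[k] M :=
    DirectSum.toModule k (ℤ × ℤ) M fun pq => (filPiece deg fil pq).subtype
  let tot : (⨁ pq, ↥(filPiece deg fil pq)) →ₗ[k] ⨁ pq, V pq := DirectSum.lmap cls
  ∀ (pq : ℤ × ℤ) (z : ↥(filPiece deg fil pq)),
    (∃ w ∈ tensorFamily component pq,
      Δ z - TensorProduct.map inc inc w ∈ tensorFamily fil (pq.1 - 1)) ∧
    ∀ w ∈ tensorFamily component pq,
      Δ z - TensorProduct.map inc inc w ∈ tensorFamily fil (pq.1 - 1) →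
        δ (DirectSum.lof k _ _ pq (cls pq z)) = TensorProduct.map tot tot w

/-- First quadrant filtrations: `0 = F^{-1}_n ⊆ F^0_n ⊆ ⋯ ⊆ F^n_n = M_n` for all `n`. -/
def IsFirstQuadrantFiltration (deg fil : ℤ → Submodule k M) : Prop :=
  Monotone fil ∧ ∀ n p, (p < 0 → fil p ⊓ deg n = ⊥) ∧ (n ≤ p → deg n ≤ fil p)

/-- A filtered differential graded module: a graded module `M = ⨁ M_n` with a differential of
degree `-1` and an increasing filtration by graded subcomplexes. -/
structure FilteredDGModule (k : Type v) [CommRing k] (M : Type w) [AddCommGroup M]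
    [Module k M] where
  d : M →ₗ[k] M
  deg : ℤ → Submodule k M
  fil : ℤ → Submodule k M
  isInternal : DirectSum.IsInternal deg
  d_deg : ∀ n, ∀ x ∈ deg n, d x ∈ deg (n - 1)
  d_d : ∀ x, d (d x) = 0
  fil_mono : Monotone fil
  d_fil : ∀ p, ∀ x ∈ fil p, d x ∈ fil p
  fil_homogeneous : ∀ p, fil p = ⨆ n, fil p ⊓ deg n

namespace FilteredDGModule

variable (C : FilteredDGModule k M)

/-- The sign involution `x ↦ (-1)^{|x|} x`. -/
def sign : M →ₗ[k] M :=
  DirectSum.toModule k ℤ M (fun n => (n.negOnePow : ℤ) • (C.deg n).subtype) ∘ₗ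
    (LinearEquiv.ofBijective (DirectSum.coeLinearMap C.deg) C.isInternal).symm.toLinearMap

/-- `(C, Δ, ε)` is a filtered differential graded coalgebra: `Δ` and `ε` are the comultiplication
and counit of a graded coalgebra, `Δ` is a chain map which maps `F^p` to
`∑_{c + d = p} F^c ⊗ F^d`, and `ε` is a chain map. -/
def IsFilteredDGCoalgebra (Δ : M →ₗ[k] M ⊗[k] M) (ε : M →ₗ[k] k) : Prop :=
  (∃ S : GradedCoalgebra k M C.deg, S.comul = Δ ∧ S.counit = ε) ∧
  (∀ x, Δ (C.d x) = tensorD C.sign C.d (Δ x)) ∧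
  (∀ x, ε (C.d x) = 0) ∧
  (∀ p, ∀ x ∈ C.fil p, Δ x ∈ tensorFamily C.fil p)

/-- The `r`-almost cycles `Z^r_{p,q} = F^p_{p+q} ∩ ∂⁻¹(F^{p-r}_{p+q-1})`. -/
def Z (r : ℤ) (pq : ℤ × ℤ) : Submodule k M :=
  filPiece C.deg C.fil pq ⊓ (C.fil (pq.1 - r) ⊓ C.deg (pq.1 + pq.2 - 1)).comap C.d

/-- The `r`-almost boundaries `B^r_{p,q} = F^p_{p+q} ∩ ∂(F^{p+r}_{p+q+1})`. -/
def B (r : ℤ) (pq : ℤ × ℤ) : Submodule k M :=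
  filPiece C.deg C.fil pq ⊓ (C.fil (pq.1 + r) ⊓ C.deg (pq.1 + pq.2 + 1)).map C.d

/-- The submodule `B^{r-1}_{p,q} + F^{p-1}_{p+q}`. -/
def denom (r : ℤ) (pq : ℤ × ℤ) : Submodule k M :=
  C.B (r - 1) pq ⊔ (C.fil (pq.1 - 1) ⊓ C.deg (pq.1 + pq.2))

/-- `E^r_{p,q} = (Z^r_{p,q} + F^{p-1}_{p+q}) / (B^{r-1}_{p,q} + F^{p-1}_{p+q})`, written as the
quotient of `Z^r_{p,q}` by its intersection with `B^{r-1}_{p,q} + F^{p-1}_{p+q}` (note that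
`B^{r-1}_{p,q} ⊆ Z^r_{p,q}`). -/
abbrev E (r : ℤ) (pq : ℤ × ℤ) : Type w :=
  ↥(C.Z r pq) ⧸ (C.denom r pq).submoduleOf (C.Z r pq)

variable {C}

lemma mem_Z {r : ℤ} {pq : ℤ × ℤ} {x : M} : x ∈ C.Z r pq ↔
    x ∈ C.fil pq.1 ∧ x ∈ C.deg (pq.1 + pq.2) ∧ C.d x ∈ C.fil (pq.1 - r) := by
  refine ⟨fun h => ⟨h.1.1, h.1.2, h.2.1⟩, fun h => ⟨⟨h.1, h.2.1⟩, h.2.2, C.d_deg _ _ h.2.1⟩⟩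

lemma mem_denom {r : ℤ} {pq : ℤ × ℤ} {x : M} : x ∈ C.denom r pq ↔
    ∃ y, y ∈ C.fil (pq.1 + r - 1) ∧ y ∈ C.deg (pq.1 + pq.2 + 1) ∧ C.d y ∈ C.fil pq.1 ∧
      ∃ f, f ∈ C.fil (pq.1 - 1) ∧ f ∈ C.deg (pq.1 + pq.2) ∧ C.d y + f = x := by
  simp only [denom, B, Submodule.mem_sup, Submodule.mem_inf, Submodule.mem_map]
  constructor
  · rintro ⟨_, ⟨⟨h1, _⟩, y, ⟨hy, hy'⟩, rfl⟩, f, hf, rfl⟩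
    exact ⟨y, by rwa [add_sub_assoc], hy', h1, f, hf.1, hf.2, rfl⟩
  · rintro ⟨y, hy, hy', h1, f, hf, hf', rfl⟩
    have := C.d_deg _ _ hy'
    rw [add_sub_cancel_right] at this
    exact ⟨_, ⟨⟨h1, this⟩, y, ⟨by rwa [← add_sub_assoc], hy'⟩, rfl⟩, f, ⟨hf, hf'⟩, rfl⟩

variable (C)

/-- The differential `d^r : E^r_{p,q} → E^r_{p-r,q+r-1}`, induced by `∂ : Z^r_{p,q} →
Z^r_{p-r,q+r-1}`. -/
def dE (r : ℤ) (pq pq' : ℤ × ℤ) (h : pq + (-r, r - 1) = pq') : C.E r pq →ₗ[k] C.E r pq' :=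
  Submodule.mapQ _ _
    (C.d.restrict (p := C.Z r pq) (q := C.Z r pq') (by
      subst h
      intro x hx
      rw [mem_Z] at hx ⊢
      refine ⟨by simpa [sub_eq_add_neg] using hx.2.2, ?_, by simp [C.d_d]⟩
      have := C.d_deg _ _ hx.2.1
      convert this using 2
      simp; ring))
    (by
      subst h
      rintro ⟨x, hx⟩ hxd
      rw [mem_Z] at hx
      change x ∈ C.denom r pq at hxd
      change C.d x ∈ C.denom r _
      obtain ⟨y, hy, hy', h1, f, hf, hf', rfl⟩ := mem_denom.1 hxd
      refine mem_denom.2 ⟨f, ?_, ?_, ?_, 0, zero_mem _, zero_mem _, ?_⟩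
      · simpa using hf
      · convert hf' using 2; simp; ring
      · simpa [C.d_d, sub_eq_add_neg] using hx.2.2
      · simp [C.d_d])

lemma dE_mk (r : ℤ) (pq pq' : ℤ × ℤ) (h : pq + (-r, r - 1) = pq') (x : C.Z r pq) :
    ∃ h', C.dE r pq pq' h (Submodule.Quotient.mk x) = Submodule.Quotient.mk ⟨C.d x, h'⟩ :=
  ⟨_, rfl⟩

/-- The `r`-th page `(E^r, d^r)`. -/
def page (r : ℤ) :
    HomologicalComplex (ModuleCat.{w} k) (ComplexShape.up' ((-r, r - 1) : ℤ × ℤ)) where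
  X pq := ModuleCat.of k (C.E r pq)
  d pq pq' := open Classical in
    if h : pq + (-r, r - 1) = pq' then ModuleCat.ofHom (C.dE r pq pq' h) else 0
  shape pq pq' h := dif_neg h
  d_comp_d' pq pq' pq'' h h' := by
    have h : pq + (-r, r - 1) = pq' := h
    have h' : pq' + (-r, r - 1) = pq'' := h'
    rw [dif_pos h, dif_pos h']
    ext x
    obtain ⟨h1, e1⟩ := C.dE_mk r pq pq' h x
    obtain ⟨h2, e2⟩ := C.dE_mk r pq' pq'' h' ⟨_, h1⟩
    simp only [ModuleCat.hom_comp, ModuleCat.hom_ofHom, LinearMap.comp_apply, Submodule.mkQ_apply]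
    rw [e1, e2]
    simp only [C.d_d]
    rfl

lemma page_d (r : ℤ) (pq pq' : ℤ × ℤ) (h : pq + (-r, r - 1) = pq') :
    (C.page r).d pq pq' = ModuleCat.ofHom (C.dE r pq pq' h) := dif_pos h

lemma Z_succ_le (r : ℤ) (pq : ℤ × ℤ) : C.Z (r + 1) pq ≤ C.Z r pq := by
  intro x hx
  rw [mem_Z] at hx ⊢
  exact ⟨hx.1, hx.2.1, C.fil_mono (by lia) hx.2.2⟩

/-- The short complex `E^r_{p+r,q-r+1} → E^r_{p,q} → E^r_{p-r,q+r-1}`. -/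
abbrev scE (r : ℤ) (pq : ℤ × ℤ) : ShortComplex (ModuleCat.{w} k) :=
  (C.page r).sc' (pq - (-r, r - 1)) pq (pq + (-r, r - 1))

lemma scE_g (r : ℤ) (pq : ℤ × ℤ) (x : C.E r pq) :
    (C.scE r pq).g.hom x = C.dE r pq _ rfl x := by
  change (C.page r).d _ _ x = _
  rw [page_d _ _ _ _ rfl]
  rfl

lemma scE_f (r : ℤ) (pq : ℤ × ℤ) (x : C.E r (pq - (-r, r - 1))) :
    (C.scE r pq).f.hom x = C.dE r _ pq (sub_add_cancel _ _) x := by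
  change (C.page r).d _ _ x = _
  rw [page_d _ _ _ _ (sub_add_cancel _ _)]
  rfl

/-- The map `Z^{r+1}_{p,q} → ker d^r_{p,q}`, `z ↦ [z]`. -/
def cycleClass (r : ℤ) (pq : ℤ × ℤ) :
    C.Z (r + 1) pq →ₗ[k] LinearMap.ker (C.scE r pq).g.hom :=
  LinearMap.codRestrict _
    ((Submodule.mkQ ((C.denom r pq).submoduleOf (C.Z r pq))) ∘ₗ
      Submodule.inclusion (C.Z_succ_le r pq)) (by
    intro x
    refine LinearMap.mem_ker.2 ((C.scE_g r pq _).trans ?_)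
    obtain ⟨h, e⟩ := C.dE_mk r pq _ rfl (Submodule.inclusion (C.Z_succ_le r pq) x)
    refine e.trans ((Submodule.Quotient.mk_eq_zero _).2 ?_)
    have hx := mem_Z.1 x.2
    refine mem_denom.2 ⟨0, zero_mem _, zero_mem _, by simp, C.d x, ?_, (mem_Z.1 h).2.1, by simp⟩
    convert hx.2.2 using 2
    simp; ring)

/-- The map `Z^{r+1}_{p,q} → ker d^r_{p,q} / im d^r_{p+r,q-r+1}`, `z ↦ [[z]]`. -/
def homologyClass (r : ℤ) (pq : ℤ × ℤ) :
    C.Z (r + 1) pq →ₗ[k] (C.scE r pq).moduleCatLeftHomologyData.H :=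
  (LinearMap.range (C.scE r pq).moduleCatToCycles).mkQ ∘ₗ C.cycleClass r pq

lemma homologyClass_surjective (r : ℤ) (pq : ℤ × ℤ) :
    Function.Surjective (C.homologyClass r pq) := by
  intro y
  obtain ⟨⟨y, hy⟩, rfl⟩ := Submodule.Quotient.mk_surjective _ y
  obtain ⟨⟨z, hz⟩, rfl⟩ := Submodule.Quotient.mk_surjective _ y
  have hy0 := (C.scE_g r pq _).symm.trans (LinearMap.mem_ker.1 hy)
  obtain ⟨h, e⟩ := C.dE_mk r pq _ rfl ⟨z, hz⟩
  have hd := (Submodule.Quotient.mk_eq_zero _).1 (e.symm.trans hy0)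
  obtain ⟨t, ht, ht', h1, f, hf, hf', e⟩ := mem_denom.1 (show C.d z ∈ C.denom r _ from hd)
  have hz' := mem_Z.1 hz
  simp only [Prod.fst_add, Prod.snd_add] at ht ht' hf hf' e
  have ht1 : t ∈ C.fil (pq.1 - 1) := by convert ht using 2; ring
  have ht2 : t ∈ C.deg (pq.1 + pq.2) := by convert ht' using 2; ring
  have hzt : z - t ∈ C.Z (r + 1) pq := by
    refine mem_Z.2 ⟨sub_mem hz'.1 (C.fil_mono (by lia) ht1), sub_mem hz'.2.1 ht2, ?_⟩
    rw [map_sub, ← e, add_sub_cancel_left]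
    convert hf using 2; ring
  refine ⟨⟨z - t, hzt⟩, ?_⟩
  change Submodule.Quotient.mk _ = Submodule.Quotient.mk _
  congr 1
  apply Subtype.ext
  refine (Submodule.Quotient.eq _).2 ?_
  change (z - t) - z ∈ C.denom r pq
  refine mem_denom.2 ⟨0, zero_mem _, zero_mem _, by simp, -t, neg_mem ht1, neg_mem ht2, by simp⟩

lemma ker_homologyClass (r : ℤ) (pq : ℤ × ℤ) :
    LinearMap.ker (C.homologyClass r pq) = (C.denom (r + 1) pq).submoduleOf (C.Z (r + 1) pq) := by
  ext ⟨z, hz⟩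
  have hz' := mem_Z.1 hz
  have key : C.homologyClass r pq ⟨z, hz⟩ = 0 ↔ ∃ y : C.Z r (pq - (-r, r - 1)),
      C.d y - z ∈ C.denom r pq := by
    refine (Submodule.Quotient.mk_eq_zero _).trans ?_
    constructor
    · rintro ⟨y, hy⟩
      obtain ⟨y, rfl⟩ := Submodule.Quotient.mk_surjective _ y
      refine ⟨y, ?_⟩
      have hy := congrArg Subtype.val hy
      obtain ⟨h, e⟩ := C.dE_mk r _ pq (sub_add_cancel _ _) y
      have hy := (e.symm.trans ((C.scE_f r pq _).symm.trans hy))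
      exact (Submodule.Quotient.eq ((C.denom r pq).submoduleOf (C.Z r pq))).1 hy
    · rintro ⟨y, hy⟩
      refine ⟨Submodule.Quotient.mk y, Subtype.ext ?_⟩
      obtain ⟨h, e⟩ := C.dE_mk r _ pq (sub_add_cancel _ _) y
      refine (C.scE_f r pq _).trans (e.trans ((Submodule.Quotient.eq _).2 hy))
  refine key.trans ?_
  change _ ↔ z ∈ C.denom (r + 1) pq
  constructor
  · rintro ⟨⟨y, hy⟩, h⟩
    have hy' := mem_Z.1 hy
    simp only [Prod.fst_sub, Prod.snd_sub] at hy'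
    obtain ⟨t, ht, ht', h1, f, hf, hf', e⟩ := mem_denom.1 h
    refine mem_denom.2 ⟨y - t, sub_mem ?_ ?_, sub_mem ?_ ht', ?_, -f, neg_mem hf, neg_mem hf', ?_⟩
    · convert hy'.1 using 2; ring
    · exact C.fil_mono (by lia) ht
    · convert hy'.2.1 using 2; ring
    · rw [map_sub]
      refine sub_mem ?_ h1
      convert hy'.2.2 using 2; ring
    · rw [map_sub]
      have e : C.d t + f = C.d y - z := e
      rw [← sub_eq_zero]
      rw [← sub_eq_zero] at e
      rw [← neg_eq_zero, ← e]
      abel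
  · intro h
    obtain ⟨t, ht, ht', h1, f, hf, hf', e⟩ := mem_denom.1 h
    refine ⟨⟨t, mem_Z.2 ⟨?_, ?_, ?_⟩⟩, ?_⟩
    · convert ht using 2; simp; ring
    · convert ht' using 2; simp; ring
    · convert h1 using 2; simp
    · refine mem_denom.2 ⟨0, zero_mem _, zero_mem _, by simp, -f, neg_mem hf, neg_mem hf', ?_⟩
      change C.d 0 + -f = C.d t - z
      rw [← e]; simp

/-- `ker d^r / im d^r ≅ E^{r+1}`, by `[[z]] ↦ [z]` for `z ∈ Z^{r+1}_{p,q}`. -/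
def homologyEquiv (r : ℤ) (pq : ℤ × ℤ) :
    (C.scE r pq).moduleCatLeftHomologyData.H ≃ₗ[k] C.E (r + 1) pq :=
  ((Submodule.quotEquivOfEq _ _ (C.ker_homologyClass r pq).symm).trans
    ((C.homologyClass r pq).quotKerEquivOfSurjective (C.homologyClass_surjective r pq))).symm

/-- The spectral sequence of a filtered differential graded module. -/
def spectralSequence :
    SpectralSequence (ModuleCat.{w} k)
      (fun r => ComplexShape.up' ((-r, r - 1) : ℤ × ℤ)) 0 where
  page r _ := C.page r
  iso r r' pq hrr' _ :=
    (C.page r).homologyIsoSc' (pq - (-r, r - 1)) pq (pq + (-r, r - 1))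
        (ComplexShape.prev_eq' _ (sub_add_cancel _ _)) (ComplexShape.next_eq' _ rfl) ≪≫
      (C.scE r pq).moduleCatHomologyIso ≪≫ (C.homologyEquiv r pq).toModuleIso ≪≫
      eqToIso (by subst hrr'; rfl)


/-- The class of an element of `F^p_{p+q} = Z^0_{p,q}` in `E^0_{p,q} = F^p_{p+q} / F^{p-1}_{p+q}`. -/
def toPageZero (pq : ℤ × ℤ) : ↥(filPiece C.deg C.fil pq) →ₗ[k] C.E 0 pq :=
  Submodule.mkQ _ ∘ₗ Submodule.inclusion (fun x hx =>
    mem_Z.2 ⟨hx.1, hx.2, by simpa using C.d_fil _ x hx.1⟩)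

/-- The (total) homology `H_*(C) = ker ∂ / im ∂`. -/
abbrev Homology : Type w :=
  ↥(LinearMap.ker C.d) ⧸ (LinearMap.range C.d).submoduleOf (LinearMap.ker C.d)

/-- The homology class of a cycle. -/
abbrev toHomology : ↥(LinearMap.ker C.d) →ₗ[k] C.Homology := Submodule.mkQ _

/-- The subspace of `H_*(C)` of the classes of cycles in the submodule `N`. -/
def homologyImage (N : Submodule k M) : Submodule k C.Homology :=
  (N.submoduleOf (LinearMap.ker C.d)).map C.toHomology

/-- The grading of `H_*(C)`. -/
def homologyDeg (n : ℤ) : Submodule k C.Homology := C.homologyImage (C.deg n)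

/-- The filtration of `H_*(C)`: `F^p H_*(C)` is the image of `H_*(F^p)`. -/
def homologyFil (p : ℤ) : Submodule k C.Homology := C.homologyImage (C.fil p)

/-- The graded coalgebra structure `S` on `H_*(C)` is the one induced by `Δ` and `ε`: its
comultiplication is `H(C) → H(C ⊗ C) ≅ H(C) ⊗ H(C)` and its counit is `[z] ↦ ε z`. -/
def IsHomologyCoalgebra (Δ : M →ₗ[k] M ⊗[k] M) (ε : M →ₗ[k] k)
    (S : GradedCoalgebra k C.Homology C.homologyDeg) : Prop :=
  InducesOnHomology (tensorD C.sign C.d) (LinearMap.ker C.d).subtype C.toHomology Δ S.comul ∧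
  ∀ z : ↥(LinearMap.ker C.d), S.counit (C.toHomology z) = ε z


end FilteredDGModule

end Algebra

/-! ### Spectral sequences of coalgebras -/

section Spectral

variable {k : Type v} [CommRing k]

/-- Homologically graded spectral sequences of `k`-modules, with `d^r` of bidegree `(-r, r - 1)`,
starting with the page `E^0`. -/
abbrev HSpectralSequence (k : Type v) [CommRing k] :=
  SpectralSequence (ModuleCat.{w} k) (fun r => ComplexShape.up' ((-r, r - 1) : ℤ × ℤ)) 0

namespace HSpectralSequence

variable (E : HSpectralSequence.{v, w} k)

/-- The term `E^r_{p,q}`. -/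
abbrev X (r : ℕ) (pq : ℤ × ℤ) : Type w := (E.page (r : ℤ)).X pq

/-- The total module `E^r = ⨁_{p,q} E^r_{p,q}` of the `r`-th page. -/
abbrev Total (r : ℕ) : Type w := ⨁ pq : ℤ × ℤ, E.X r pq

/-- The differential `d^r` of the `r`-th page. -/
def D (r : ℕ) : E.Total r →ₗ[k] E.Total r :=
  DirectSum.toModule k (ℤ × ℤ) _ fun pq =>
    DirectSum.lof k (ℤ × ℤ) (E.X r) (pq + (-(r : ℤ), (r : ℤ) - 1)) ∘ₗ
      ((E.page (r : ℤ)).d pq (pq + (-(r : ℤ), (r : ℤ) - 1))).hom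

/-- The sign involution `x ↦ (-1)^{p+q} x` for `x ∈ E^r_{p,q}`. -/
def sign (r : ℕ) : E.Total r →ₗ[k] E.Total r :=
  DirectSum.lmap fun pq => ((pq.1 + pq.2).negOnePow : ℤ) • LinearMap.id

/-- The total module of the cycles of `(E^r, d^r)`. -/
abbrev Cycles (r : ℕ) : Type w := ⨁ pq : ℤ × ℤ, ((E.page (r : ℤ)).cycles pq : Type w)

/-- The inclusion of the cycles in `E^r`. -/
def incCycles (r : ℕ) : E.Cycles r →ₗ[k] E.Total r :=
  DirectSum.lmap fun pq => ((E.page (r : ℤ)).iCycles pq).hom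

/-- The projection from the cycles of `E^r` to `H(E^r) ≅ E^{r+1}`, in bidegree `pq`. -/
def toNext (r : ℕ) (pq : ℤ × ℤ) : (E.page (r : ℤ)).cycles pq ⟶ (E.page ((r + 1 : ℕ) : ℤ)).X pq :=
  (E.page (r : ℤ)).homologyπ pq ≫ (E.iso (r : ℤ) ((r + 1 : ℕ) : ℤ) pq).hom

/-- The projection from the cycles of `E^r` to `H(E^r) ≅ E^{r+1}`. -/
def clsCycles (r : ℕ) : E.Cycles r →ₗ[k] E.Total (r + 1) :=
  DirectSum.lmap fun pq => (E.toNext r pq).hom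

/-- The structure of a spectral sequence of coalgebras: every page is a bigraded coalgebra, the
differentials satisfy the co-Leibniz rule, and the coalgebra `E^{r+1}` is the homology of the
differential coalgebra `E^r`. -/
structure CoalgebraStructure where
  coalg (r : ℕ) : GradedCoalgebra k (E.Total r) (component (V := E.X r))
  coLeibniz (r : ℕ) (x : E.Total r) :
    (coalg r).comul (E.D r x) = tensorD (E.sign r) (E.D r) ((coalg r).comul x)
  comul_succ (r : ℕ) : InducesOnHomology (tensorD (E.sign r) (E.D r)) (E.incCycles r)
    (E.clsCycles r) (coalg r).comul (coalg (r + 1)).comul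
  counit_succ (r : ℕ) (z : E.Cycles r) :
    (coalg (r + 1)).counit (E.clsCycles r z) = (coalg r).counit (E.incCycles r z)

/-- First quadrant spectral sequences. -/
def IsFirstQuadrant : Prop :=
  ∀ (r : ℕ) (pq : ℤ × ℤ), pq.1 < 0 ∨ pq.2 < 0 → Limits.IsZero ((E.page (r : ℤ)).X pq)

/-- The number `max (p + 1) (q + 2)`; in a first quadrant spectral sequence no nonzero
differential `d^r` with `r ≥ max (p + 1) (q + 2)` starts or ends in bidegree `(p, q)`. -/
def stableFrom (pq : ℤ × ℤ) : ℕ := (max (pq.1 + 1) (pq.2 + 2)).toNat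

variable {E}

lemma IsFirstQuadrant.d_eq_zero (hE : E.IsFirstQuadrant) (r : ℕ) (pq pq' : ℤ × ℤ)
    (h : stableFrom pq ≤ r) : (E.page (r : ℤ)).d pq pq' = 0 := by
  by_cases hr : pq + (-(r : ℤ), (r : ℤ) - 1) = pq'
  · refine (hE r pq' (Or.inl ?_)).eq_of_tgt _ _
    subst hr
    simp only [stableFrom, Int.toNat_le] at h
    simp only [Prod.fst_add]
    lia
  · exact (E.page (r : ℤ)).shape _ _ hr

/-- The map `E^r_{p,q} → H(E^r)_{p,q} ≅ E^{r+1}_{p,q}` for `r ≥ max (p + 1) (q + 2)`: all elements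
of `E^r_{p,q}` are cycles. -/
def IsFirstQuadrant.step (hE : E.IsFirstQuadrant) (r : ℕ) (pq : ℤ × ℤ)
    (h : stableFrom pq ≤ r) : E.X r pq →ₗ[k] E.X (r + 1) pq :=
  ((E.page (r : ℤ)).liftCycles (𝟙 _) _ rfl
    (by rw [hE.d_eq_zero r pq _ h, Limits.comp_zero]) ≫ E.toNext r pq).hom

variable (E) in
/-- The term `E^∞_{p,q}`, i.e. `E^r_{p,q}` for `r = max (p + 1) (q + 2)`. -/
abbrev Infinity (pq : ℤ × ℤ) : Type w := E.X (stableFrom pq) pq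

/-- The identification of `E^∞_{p,q}` with `E^r_{p,q}`, for all `r ≥ max (p + 1) (q + 2)`. -/
def IsFirstQuadrant.stab (hE : E.IsFirstQuadrant) (pq : ℤ × ℤ) (r : ℕ) (h : stableFrom pq ≤ r) :
    E.Infinity pq →ₗ[k] E.X r pq :=
  Nat.leRec (motive := fun r _ => E.Infinity pq →ₗ[k] E.X r pq) LinearMap.id
    (fun r h f => hE.step r pq h ∘ₗ f) h

/-- The map `E^∞ → E^r` which is the identification in all bidegrees `(p, q)` with
`r ≥ max (p + 1) (q + 2)` and zero in the other bidegrees. -/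
def IsFirstQuadrant.stabTotal (hE : E.IsFirstQuadrant) (r : ℕ) :
    (⨁ pq, E.Infinity pq) →ₗ[k] E.Total r :=
  DirectSum.lmap fun pq => if h : stableFrom pq ≤ r then hE.stab pq r h else 0

/-- The bigraded coalgebra structure `S` on `E^∞` is the one of the spectral sequence of
coalgebras `A`: in every bidegree it is the one of `E^r` for all large `r`. -/
def CoalgebraStructure.IsInfinityCoalgebra (A : E.CoalgebraStructure) (hE : E.IsFirstQuadrant)
    (S : GradedCoalgebra k (⨁ pq, E.Infinity pq) (component (V := E.Infinity))) : Prop :=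
  ∀ (pq : ℤ × ℤ) (r : ℕ), stableFrom pq ≤ r → ∀ x ∈ component (k := k) (V := E.Infinity) pq,
    (A.coalg r).comul (hE.stabTotal r x) =
      TensorProduct.map (hE.stabTotal r) (hE.stabTotal r) (S.comul x) ∧
    (A.coalg r).counit (hE.stabTotal r x) = S.counit x

/-- The graded coalgebra `S` is a filtered graded coalgebra. -/
def _root_.SerreSS.GradedCoalgebra.IsFiltered {H : Type w} [AddCommGroup H] [Module k H]
    {deg : ℤ → Submodule k H} (S : GradedCoalgebra k H deg) (fil : ℤ → Submodule k H) : Prop :=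
  (∀ p, ∀ x ∈ fil p, S.comul x ∈ tensorFamily fil p) ∧
  ∀ p, p < 0 → ∀ x ∈ fil p, S.counit x = 0

/-- The bigraded coalgebra structure `G` on `Gr(H)` is the one induced by the filtered graded
coalgebra structure `S` of `H`. -/
def _root_.SerreSS.GradedCoalgebra.IsGrCoalgebra {H : Type w} [AddCommGroup H] [Module k H]
    {deg : ℤ → Submodule k H} (S : GradedCoalgebra k H deg) (fil : ℤ → Submodule k H)
    (G : GradedCoalgebra k (⨁ pq, Gr deg fil pq) (component (V := Gr deg fil))) : Prop :=
  InducesOnGr deg fil (toGr deg fil) S.comul G.comul ∧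
  ∀ z : ↥(filPiece deg fil (0, 0)),
    G.counit (DirectSum.lof k _ (Gr deg fil) (0, 0) (toGr deg fil (0, 0) z)) = S.counit z

/-- The spectral sequence of coalgebras `A` converges to the filtered graded coalgebra `S` as a
coalgebra: it is a first quadrant spectral sequence, the filtration of `H` is a first quadrant
filtration, and there are isomorphisms
`E^∞_{p,q} ≅ F^p H_{p+q} / F^{p-1} H_{p+q}` which form an isomorphism of bigraded coalgebras
`E^∞ ≅ Gr(H)`. -/
def CoalgebraStructure.ConvergesTo (A : E.CoalgebraStructure) {H : Type w} [AddCommGroup H]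
    [Module k H] {deg : ℤ → Submodule k H} (fil : ℤ → Submodule k H)
    (S : GradedCoalgebra k H deg) : Prop :=
  IsFirstQuadrantFiltration deg fil ∧ S.IsFiltered fil ∧
  ∃ (hE : E.IsFirstQuadrant)
    (I : GradedCoalgebra k (⨁ pq, E.Infinity pq) (component (V := E.Infinity)))
    (G : GradedCoalgebra k (⨁ pq, Gr deg fil pq) (component (V := Gr deg fil)))
    (θ : ∀ pq, E.Infinity pq ≃ₗ[k] Gr deg fil pq),
    A.IsInfinityCoalgebra hE I ∧ S.IsGrCoalgebra fil G ∧
    let Θ : (⨁ pq, E.Infinity pq) →ₗ[k] ⨁ pq, Gr deg fil pq :=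
      DirectSum.lmap fun pq => (θ pq).toLinearMap
    (∀ x, G.comul (Θ x) = TensorProduct.map Θ Θ (I.comul x)) ∧ ∀ x, G.counit (Θ x) = I.counit x

end HSpectralSequence

variable {M : Type w} [AddCommGroup M] [Module k M] (C : FilteredDGModule k M)

/-- The structure `A` of a spectral sequence of coalgebras on the spectral sequence of `C` is the
one induced by `Δ : C → C ⊗ C` and `ε : C → k`: the coalgebra `E^0 = Gr(C)` is `Gr(Δ)` and `Gr(ε)`.
(The coalgebra structures of the pages `E^1, E^2, …` are then determined by that of `E^0`, because
`E^{r+1}` is the homology coalgebra of `E^r`.) -/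
def FilteredDGModule.IsInducedCoalgebraStructure (Δ : M →ₗ[k] M ⊗[k] M) (ε : M →ₗ[k] k)
    (A : HSpectralSequence.CoalgebraStructure C.spectralSequence) : Prop :=
  InducesOnGr C.deg C.fil (V := HSpectralSequence.X C.spectralSequence 0) C.toPageZero Δ
    (A.coalg 0).comul ∧
  ∀ z : ↥(filPiece C.deg C.fil (0, 0)),
    (A.coalg 0).counit (DirectSum.lof k _ (HSpectralSequence.X C.spectralSequence 0) (0, 0)
      (C.toPageZero (0, 0) z)) = ε z

end Spectral
/-! ### Singular chains and the Serre filtration -/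

section Simplicial

variable (k : Type v) [CommRing k]

/-- The set of `n`-simplices of a simplicial set. -/
abbrev Simplices (S : SSet.{u}) (n : ℕ) : Type u := S.obj (Opposite.op (SimplexCategory.mk n))

/-- The simplices of a simplicial set, of all dimensions. -/
abbrev Simplex (S : SSet.{u}) : Type u := Σ n : ℕ, Simplices S n

/-- The module `C_*(S) = ⨁_n C_n(S)` of (unnormalized) simplicial chains of a simplicial set,
the free module on all simplices. For the singular simplicial set of a space these are the
singular chains. -/
abbrev Chains (S : SSet.{u}) : Type (max u v) := Simplex S →₀ k

variable (S : SSet.{u})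

/-- The boundary of a simplex, `∂ σ = ∑_i (-1)^i d_i σ`. -/
def boundary : Simplex S → Chains k S
  | ⟨0, _⟩ => 0
  | ⟨n + 1, a⟩ => ∑ i : Fin (n + 2), Finsupp.single ⟨n, S.δ i a⟩ ((-1) ^ (i : ℕ))

/-- The boundary map of the chain complex. -/
def chainsD : Chains k S →ₗ[k] Chains k S := Finsupp.linearCombination k (boundary k S)

/-- The chains of degree `n`. -/
def chainsDeg (n : ℤ) : Submodule k (Chains k S) := Finsupp.supported k k {a | (a.1 : ℤ) = n}

/-- The inclusion `[0, 1, …, i]` of the front `i`-face of the `n`-simplex. -/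
def front (n : ℕ) (i : Fin (n + 1)) : SimplexCategory.mk (i : ℕ) ⟶ SimplexCategory.mk n :=
  SimplexCategory.mkHom ⟨fun j => ⟨j, by lia⟩, fun _ _ h => h⟩

/-- The inclusion `[i, i + 1, …, n]` of the back `(n - i)`-face of the `n`-simplex. -/
def back (n : ℕ) (i : Fin (n + 1)) : SimplexCategory.mk (n - (i : ℕ)) ⟶ SimplexCategory.mk n :=
  SimplexCategory.mkHom ⟨fun j => ⟨i + j, by lia⟩, fun _ _ h => Nat.add_le_add_left h _⟩

/-- The Alexander--Whitney diagonal `Δ σ = ∑_i (σ ∘ [0, …, i]) ⊗ (σ ∘ [i, …, n])`. -/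
def diagonal : Chains k S →ₗ[k] Chains k S ⊗[k] Chains k S :=
  Finsupp.linearCombination k fun a : Simplex S =>
    ∑ i : Fin (a.1 + 1),
      (Finsupp.single ⟨(i : ℕ), S.map (front a.1 i).op a.2⟩ 1 : Chains k S) ⊗ₜ[k]
        (Finsupp.single ⟨a.1 - (i : ℕ), S.map (back a.1 i).op a.2⟩ 1 : Chains k S)

/-- The augmentation, `ε σ = 1` for `0`-simplices and `ε σ = 0` for all other simplices. -/
def augmentation : Chains k S →ₗ[k] k :=
  Finsupp.linearCombination k fun a : Simplex S => if a.1 = 0 then 1 else 0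

variable {S} {T : SSet.{u}} (f : S ⟶ T)

/-- The set of the simplices `σ` of the filtration stage `p`: those for which `f ∘ σ = τ ∘ s` for
a simplex `τ` of dimension `m ≤ p` and a surjection (composition of codegeneracies)
`s : [n] → [m]`. An `n`-simplex with `n ≥ p ≥ 0` is in this set iff it is `(n - p)`-degenerate with
respect to `f`, all simplices of dimension `≤ p` are in it, and the set is empty if `p < 0`. -/
def serreSimplices (p : ℤ) : Set (Simplex S) :=
  {a | ∃ (m : ℕ) (_ : (m : ℤ) ≤ p) (s : SimplexCategory.mk a.1 ⟶ SimplexCategory.mk m)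
    (τ : Simplices T m), Function.Surjective s.toOrderHom ∧ f.app _ a.2 = T.map s.op τ}

/-- The Serre filtration. -/
def serreFil (p : ℤ) : Submodule k (Chains k S) := Finsupp.supported k k (serreSimplices f p)

variable (S) in
lemma chainsD_single (n : ℕ) (a : Simplices S (n + 1)) (c : k) :
    chainsD k S (Finsupp.single ⟨n + 1, a⟩ c) =
      ∑ i : Fin (n + 2), Finsupp.single ⟨n, S.δ i a⟩ (c * (-1) ^ (i : ℕ)) := by
  simp [chainsD, boundary, Finset.smul_sum]

variable (S) in
lemma chainsD_single_zero (a : Simplices S 0) (c : k) :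
    chainsD k S (Finsupp.single ⟨0, a⟩ c) = 0 := by
  simp [chainsD, boundary]


lemma map_mem_of_single {N : Submodule k (Chains k S)} {s : Set (Simplex S)}
    (g : Chains k S →ₗ[k] Chains k S) (h : ∀ a ∈ s, g (Finsupp.single a 1) ∈ N) :
    ∀ x ∈ Finsupp.supported k k s, g x ∈ N := by
  intro x hx
  rw [Finsupp.supported_eq_span_single] at hx
  have : Submodule.span k ((fun i => Finsupp.single i (1 : k)) '' s) ≤ N.comap g := by
    rw [Submodule.span_le]
    rintro _ ⟨a, ha, rfl⟩
    exact h a ha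
  exact this hx

variable (S) in
/-- The simplicial module `n ↦ C_n(S)`. -/
def chainsSimplicial : SimplicialObject (ModuleCat.{max u v} k) where
  obj n := ModuleCat.of k (S.obj n →₀ k)
  map g := ModuleCat.ofHom (Finsupp.lmapDomain k k (S.map g))
  map_id n := by
    ext : 1
    refine Finsupp.lhom_ext fun a c => ?_
    simp [Finsupp.mapDomain_single]
  map_comp g h := by
    ext : 1
    refine Finsupp.lhom_ext fun a c => ?_
    simp [Finsupp.mapDomain_single]

variable (S) in
/-- The boundary map `C_{n+1}(S) → C_n(S)`. -/
def faceSum (n : ℕ) : (Simplices S (n + 1) →₀ k) →ₗ[k] (Simplices S n →₀ k) :=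
  ∑ i : Fin (n + 2), (-1 : ℤ) ^ (i : ℕ) • Finsupp.lmapDomain k k (S.δ i)

variable (S) in
lemma hom_objD (n : ℕ) :
    (AlgebraicTopology.AlternatingFaceMapComplex.objD (chainsSimplicial k S) n).hom =
      faceSum k S n := by
  rw [AlgebraicTopology.AlternatingFaceMapComplex.objD, ModuleCat.hom_sum]
  rfl

variable (S) in
lemma faceSum_faceSum (n : ℕ) (x : Simplices S (n + 1 + 1) →₀ k) :
    faceSum k S n (faceSum k S (n + 1) x) = 0 := by
  have h := congrArg ModuleCat.Hom.hom
    (AlgebraicTopology.AlternatingFaceMapComplex.d_squared (chainsSimplicial k S) n)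
  rw [ModuleCat.hom_comp, hom_objD, hom_objD] at h
  exact LinearMap.congr_fun h x

variable (S) in
lemma chainsD_lmapDomain (n : ℕ) (x : Simplices S (n + 1) →₀ k) :
    chainsD k S (Finsupp.lmapDomain k k (Sigma.mk (β := Simplices S) (n + 1)) x) =
      Finsupp.lmapDomain k k (Sigma.mk (β := Simplices S) n) (faceSum k S n x) := by
  induction x using Finsupp.induction_linear with
  | zero => simp
  | add x y hx hy => simp only [map_add, hx, hy]
  | single a c =>
    simp only [faceSum, LinearMap.sum_apply, LinearMap.smul_apply, map_sum, map_zsmul]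
    rw [Finsupp.lmapDomain_apply, Finsupp.mapDomain_single, chainsD_single]
    refine Finset.sum_congr rfl fun i _ => ?_
    rw [Finsupp.lmapDomain_apply, Finsupp.lmapDomain_apply, Finsupp.mapDomain_single,
      Finsupp.mapDomain_single, Finsupp.smul_single]
    congr 1
    rw [zsmul_eq_mul, mul_comm]
    push_cast
    rfl

variable (S) in
lemma chainsD_chainsD (x : Chains k S) : chainsD k S (chainsD k S x) = 0 := by
  induction x using Finsupp.induction_linear with
  | zero => simp
  | add x y hx hy => rw [map_add, map_add, hx, hy, add_zero]
  | single a c =>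
    obtain ⟨n, a⟩ := a
    match n, a with
    | 0, a => simp [chainsD_single_zero]
    | 1, a =>
      rw [chainsD_single, map_sum]
      exact Finset.sum_eq_zero fun i _ => chainsD_single_zero k S _ _
    | n + 2, a =>
      have e : (Finsupp.single ⟨n + 2, a⟩ c : Chains k S) =
          Finsupp.lmapDomain k k (Sigma.mk (β := Simplices S) (n + 1 + 1))
            (Finsupp.single a c) := by
        rw [Finsupp.lmapDomain_apply, Finsupp.mapDomain_single]
      rw [e, chainsD_lmapDomain, chainsD_lmapDomain, faceSum_faceSum, map_zero]

variable (S) in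
lemma chainsD_mem_deg (n : ℤ) : ∀ x ∈ chainsDeg k S n, chainsD k S x ∈ chainsDeg k S (n - 1) := by
  refine map_mem_of_single k _ ?_
  rintro ⟨m, a⟩ (h : (m : ℤ) = n)
  match m, a with
  | 0, a => simp [chainsD_single_zero]
  | m + 1, a =>
    rw [chainsD_single]
    refine sum_mem fun i _ => Finsupp.single_mem_supported k _ ?_
    change (m : ℤ) = n - 1
    push_cast at h
    lia

variable (S) in
lemma isInternal_chainsDeg : DirectSum.IsInternal (chainsDeg k S) := by
  refine DirectSum.isInternal_submodule_of_iSupIndep_of_iSup_eq_top ?_ ?_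
  · intro n
    have : ⨆ j, ⨆ (_ : j ≠ n), chainsDeg k S j ≤
        Finsupp.supported k k {a : Simplex S | (a.1 : ℤ) ≠ n} := by
      refine iSup₂_le fun j hj => Finsupp.supported_mono ?_
      rintro a (rfl : _ = _)
      exact hj
    refine Disjoint.mono_right this (Finsupp.disjoint_supported_supported ?_)
    exact Set.disjoint_left.2 fun a h h' => h' h
  · rw [eq_top_iff]
    rintro x -
    induction x using Finsupp.induction_linear with
    | zero => exact zero_mem _
    | add x y hx hy => exact add_mem hx hy
    | single a c =>
      exact Submodule.mem_iSup_of_mem (a.1 : ℤ) (Finsupp.single_mem_supported k _ rfl)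

lemma chainsD_mem_serreFil (p : ℤ) : ∀ x ∈ serreFil k f p, chainsD k S x ∈ serreFil k f p := by
  refine map_mem_of_single k _ ?_
  rintro ⟨n, a⟩ ⟨m, hm, s, t, hs, h⟩
  match n, a with
  | 0, a => simp [chainsD_single_zero]
  | n + 1, a =>
    rw [chainsD_single]
    refine sum_mem fun i _ => Finsupp.single_mem_supported k _ ?_
    let g : SimplexCategory.mk n ⟶ SimplexCategory.mk m := SimplexCategory.δ i ≫ s
    refine ⟨(Limits.image g).len, ?_, Limits.factorThruImage g,
      T.map (Limits.image.ι g).op t, ?_, ?_⟩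
    · exact le_trans (by exact_mod_cast SimplexCategory.len_le_of_mono (Limits.image.ι g)) hm
    · exact SimplexCategory.epi_iff_surjective.1 inferInstance
    · have h1 : f.app _ (S.δ i a) = T.map (SimplexCategory.δ i).op (f.app _ a) :=
        NatTrans.naturality_apply f (SimplexCategory.δ i).op a
      have h2 : T.map (Limits.factorThruImage g).op (T.map (Limits.image.ι g).op t) =
          T.map (Limits.factorThruImage g ≫ Limits.image.ι g).op t := by
        rw [op_comp, Functor.map_comp]; rfl
      have h3 : T.map (SimplexCategory.δ i).op (T.map s.op t) =
          T.map (SimplexCategory.δ i ≫ s).op t := by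
        rw [op_comp, Functor.map_comp]; rfl
      refine h1.trans ?_
      rw [show f.app _ a = _ from h]
      refine h3.trans (Eq.trans ?_ h2.symm)
      rw [Limits.image.fac]

lemma serreFil_mono : Monotone (serreFil k f) := fun _ _ h =>
  Finsupp.supported_mono fun _ ⟨m, hm, s, t, hs, e⟩ => ⟨m, hm.trans h, s, t, hs, e⟩

lemma serreFil_homogeneous (p : ℤ) :
    serreFil k f p = ⨆ n, serreFil k f p ⊓ chainsDeg k S n := by
  refine le_antisymm ?_ (iSup_le fun n => inf_le_left)
  intro x hx
  have := map_mem_of_single (s := serreSimplices f p) k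
    (N := ⨆ n, serreFil k f p ⊓ chainsDeg k S n) LinearMap.id (fun a ha =>
      Submodule.mem_iSup_of_mem (a.1 : ℤ)
        ⟨Finsupp.single_mem_supported k _ ha, Finsupp.single_mem_supported k _ rfl⟩)
  exact this x hx

/-- The chains of `S` with the Serre filtration of `f : S ⟶ T`. -/
def serreComplex : FilteredDGModule k (Chains k S) where
  d := chainsD k S
  deg := chainsDeg k S
  fil := serreFil k f
  isInternal := isInternal_chainsDeg k S
  d_deg := chainsD_mem_deg k S
  d_d := chainsD_chainsD k S
  fil_mono := serreFil_mono k f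
  d_fil := chainsD_mem_serreFil k f
  fil_homogeneous := serreFil_homogeneous k f

end Simplicial

section Topology

variable (k : Type v) [CommRing k] {E B : Type u} [TopologicalSpace E] [TopologicalSpace B]

/-- Serre fibrations: continuous maps with the homotopy lifting property for all cubes
(equivalently, for all CW complexes). -/
def IsSerreFibration (π : C(E, B)) : Prop :=
  ∀ (n : ℕ) (h : C((Fin n → unitInterval) × unitInterval, B)) (g : C(Fin n → unitInterval, E)),
    (∀ x, h (x, 0) = π (g x)) →
      ∃ H : C((Fin n → unitInterval) × unitInterval, E),
        (∀ x, H (x, 0) = g x) ∧ ∀ y, π (H y) = h y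

/-- The singular simplicial set of a space. -/
abbrev Sing (X : Type u) [TopologicalSpace X] : SSet.{u} := TopCat.toSSet.obj (TopCat.of X)

/-- The map of singular simplicial sets induced by a continuous map. -/
abbrev singMap (π : C(E, B)) : Sing E ⟶ Sing B := TopCat.toSSet.map (TopCat.ofHom π)

/-- The singular chains `C_*(E; k)` with the Serre filtration of `π : E → B`. Its spectral sequence
is the homological Serre spectral sequence of `π`, and its homology is `H_*(E; k)`. -/
abbrev singularSerreComplex (π : C(E, B)) : FilteredDGModule k (Chains k (Sing E)) :=
  serreComplex k (singMap π)

/-- The homological Serre spectral sequence. -/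
abbrev serreSpectralSequence (π : C(E, B)) : HSpectralSequence.{v, max u v} k :=
  (singularSerreComplex k π).spectralSequence

end Topology

end SerreSS

end

/-! Everything is reduced to duality over the field `k`. Products of functionals separate the points
of a tensor product (`Separates.tensor`), so a comultiplication on a subquotient `W` of the chains
`M` is pinned down by its pairings: for suitable functionals α, β on `M`, the number (α ⊗ β)(δ[z])
must equal (α ⊗ β)(Δ z), the value at `z` of the convolution product of α and β (`IsDualComul`). As
soon as the functionals in use are closed under convolution and separate `W` (`DualData`),
coassociativity, counit, degrees, co-Leibniz rule and uniqueness are inherited from the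
corresponding identities for Δ on `M`. No tensor product of spectral sequences has to be formed.

For the page E^r the functionals in bidegree (p, q) are those concentrated in degree p + q that
vanish on F^{p-1} and on ∂F^{p+r-1}. They are closed under convolution because Δ is a filtered chain
map (`IsFilteredDGCoalgebra.dualData`). Existence of δ still requires an element with the prescribed
pairings. On E^0 it comes from lifting Δ z to a sum of terms in F^a ⊗ F^b with a + b = p
(`exists_lift_tensorFamily`). From E^r to E^{r+1} it comes from the Künneth theorem: Δ of a cycle is
a cycle, hence homologous to some w in Z ⊗ Z, by an explicit homotopy
(`exists_map_inc_sub_mem_range`), and the class of w has the right pairings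
(`form_cls_of_mem_range`). The homology of `M` is treated in the same way, with cocycles as
functionals.

For convergence, once r ≥ max(p+1, q+2) the functionals of E^r in bidegree (p, q) are exactly the
homogeneous cocycles vanishing on F^{p-1}. They descend to functionals on H vanishing on F^{p-1}H,
so the evident isomorphism from E^∞ to Gr(H) respects all pairings, hence the coalgebra structures.
That H is a filtered coalgebra is again tested on functionals (`mem_tensorFamily_fil_of_forms`),
since a functional vanishing on F^{a-1}H lifts to a cocycle vanishing on F^{a-1} (`exists_cocycle`).

The topological input is combinatorial. If the image of σ in the base is τ ∘ s with s onto [m],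
cutting σ at vertex i gives a front face lying over the vertices 0, …, s(i) of τ and a back face
lying over s(i), …, m, so the filtrations add up to at most m (`diagonal_mem_tensorFamily`). -/

noncomputable section

namespace SerreSS

/-! ### Linear functionals on tensor products -/

section LinearAlgebra

variable {k : Type v} [Field k]
variable {V W V' W' : Type*} [AddCommGroup V] [Module k V] [AddCommGroup W] [Module k W]
  [AddCommGroup V'] [Module k V'] [AddCommGroup W'] [Module k W']

/-- The functional `x ⊗ y ↦ α x * β y` on `V ⊗ W`. -/
def form (α : V →ₗ[k] k) (β : W →ₗ[k] k) : V ⊗[k] W →ₗ[k] k :=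
  LinearMap.mul' k k ∘ₗ TensorProduct.map α β

@[simp]
lemma form_tmul (α : V →ₗ[k] k) (β : W →ₗ[k] k) (x : V) (y : W) :
    form α β (x ⊗ₜ y) = α x * β y := by
  simp [form]

lemma form_map (α : V' →ₗ[k] k) (β : W' →ₗ[k] k) (f : V →ₗ[k] V') (g : W →ₗ[k] W')
    (x : V ⊗[k] W) : form α β (TensorProduct.map f g x) = form (α ∘ₗ f) (β ∘ₗ g) x := by
  induction x using TensorProduct.induction_on with
  | zero => simp
  | tmul x y => simp
  | add x y hx hy => simp only [map_add, hx, hy]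

@[simp]
lemma form_zero_left (β : W →ₗ[k] k) : form (0 : V →ₗ[k] k) β = 0 := by
  ext; simp

@[simp]
lemma form_zero_right (α : V →ₗ[k] k) : form α (0 : W →ₗ[k] k) = 0 := by
  ext; simp

lemma form_smul_left (c : k) (α : V →ₗ[k] k) (β : W →ₗ[k] k) :
    form (c • α) β = c • form α β := by
  ext; simp [mul_assoc]

lemma form_smul_right (c : k) (α : V →ₗ[k] k) (β : W →ₗ[k] k) :
    form α (c • β) = c • form α β := by
  ext; simp [mul_left_comm]

/-- A set of functionals which separates the points. -/
def Separates (S : Set (V →ₗ[k] k)) : Prop := ∀ x, (∀ φ ∈ S, φ x = 0) → x = 0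

lemma separates_univ : Separates (Set.univ : Set (V →ₗ[k] k)) := fun x hx =>
  (Module.forall_dual_apply_eq_zero_iff k x).1 fun φ => hx φ trivial

/-- Contract one factor at a time: the partial contraction of `x` by φ lies in `W` and is killed by
all ψ, so it vanishes. In a basis of `W` its coordinates are the values of φ on the coordinates of
`x`, which are therefore zero as well. -/
lemma Separates.tensor {S : Set (V →ₗ[k] k)} {S' : Set (W →ₗ[k] k)} (hS : Separates S)
    (hS' : Separates S') : Separates {ω | ∃ φ ∈ S, ∃ ψ ∈ S', ω = form φ ψ} := by
  intro x hx
  classical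
  let b := Module.Basis.ofVectorSpace k W
  let e := TensorProduct.equivFinsuppOfBasisRight (M := V) b
  refine e.injective ?_
  rw [map_zero]
  ext i
  refine hS _ fun φ hφ => ?_
  have h0 : (TensorProduct.lid k W) (TensorProduct.map φ LinearMap.id x) = 0 := by
    refine hS' _ fun ψ hψ => ?_
    rw [← hx _ ⟨φ, hφ, ψ, hψ, rfl⟩]
    clear hx
    induction x using TensorProduct.induction_on with
    | zero => simp
    | tmul x y => simp
    | add x y hx hy => simp only [map_add, hx, hy]
  have h1 : b.repr ((TensorProduct.lid k W) (TensorProduct.map φ LinearMap.id x)) i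
      = φ (e x i) := by
    clear h0 hx
    induction x using TensorProduct.induction_on with
    | zero => simp
    | tmul x y => simp [e, mul_comm]
    | add x y hx hy => simp only [map_add, Finsupp.add_apply, hx, hy]
  rw [← h1, h0]
  simp

lemma Separates.eq {S : Set (V →ₗ[k] k)} (hS : Separates S) {x y : V}
    (h : ∀ φ ∈ S, φ x = φ y) : x = y := by
  rw [← sub_eq_zero]
  refine hS _ fun φ hφ => ?_
  rw [map_sub, h φ hφ, sub_self]

/-- A linear relation which is defined everywhere contains the graph of a linear map. -/
lemma exists_linearMap_of_relation (R : Submodule k (V × W)) (h : ∀ x, ∃ y, (x, y) ∈ R) :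
    ∃ f : V →ₗ[k] W, ∀ x, (x, f x) ∈ R := by
  -- A linear section of the first projection of the relation exists over a field.
  obtain ⟨g, hg⟩ := LinearMap.exists_rightInverse_of_surjective
    (LinearMap.fst k V W ∘ₗ R.subtype) (LinearMap.range_eq_top.2 fun x => by
      obtain ⟨y, hy⟩ := h x
      exact ⟨⟨_, hy⟩, rfl⟩)
  refine ⟨LinearMap.snd k V W ∘ₗ R.subtype ∘ₗ g, fun x => ?_⟩
  have h1 : (g x : V × W).1 = x := LinearMap.congr_fun hg x
  have h2 : (x, (g x : V × W).2) = (g x : V × W) := Prod.ext h1.symm rfl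
  exact h2 ▸ (g x).2

/-- Linear maps of vector spaces have generalized inverses. -/
lemma exists_generalized_inverse (f : V →ₗ[k] W) : ∃ g : W →ₗ[k] V, ∀ x, f (g (f x)) = f x := by
  obtain ⟨s, hs⟩ := LinearMap.exists_rightInverse_of_surjective f.rangeRestrict
    f.range_rangeRestrict
  obtain ⟨t, ht⟩ := (LinearMap.range f).exists_isCompl
  refine ⟨s ∘ₗ (LinearMap.range f).projectionOnto t ht, fun x => ?_⟩
  have h1 : (LinearMap.range f).projectionOnto t ht (f x) = f.rangeRestrict x :=
    Submodule.projectionOnto_apply_left ht (f.rangeRestrict x)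
  rw [LinearMap.comp_apply, h1]
  exact congrArg Subtype.val (LinearMap.congr_fun hs (f.rangeRestrict x))

/-! ### Tensor products of families -/

variable {M : Type w} [AddCommGroup M] [Module k M]

lemma tmul_mem_tensorFamily {ι : Type*} [Add ι] {A : ι → Submodule k M} {i j : ι} {x y : M}
    (hx : x ∈ A i) (hy : y ∈ A j) : x ⊗ₜ y ∈ tensorFamily A (i + j) :=
  Submodule.mem_iSup_of_mem i <| Submodule.mem_iSup_of_mem j <|
    Submodule.mem_iSup_of_mem rfl <| Submodule.apply_mem_map₂ _ hx hy

lemma tensorFamily_le {ι : Type*} [Add ι] {A : ι → Submodule k M} {n : ι}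
    {N : Submodule k (M ⊗[k] M)}
    (h : ∀ i j, i + j = n → ∀ x ∈ A i, ∀ y ∈ A j, x ⊗ₜ y ∈ N) : tensorFamily A n ≤ N :=
  iSup_le fun i => iSup_le fun j => iSup_le fun hij =>
    Submodule.map₂_le.2 fun x hx y hy => h i j hij x hx y hy

lemma form_eq_zero_of_mem_tensorFamily {ι : Type*} [Add ι] {A : ι → Submodule k M} {n : ι}
    {α β : M →ₗ[k] k} (h : ∀ i j, i + j = n → ∀ x ∈ A i, ∀ y ∈ A j, α x * β y = 0)
    {x : M ⊗[k] M} (hx : x ∈ tensorFamily A n) : form α β x = 0 := by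
  have : tensorFamily A n ≤ LinearMap.ker (form α β) :=
    tensorFamily_le fun i j hij x hx y hy => by
      rw [LinearMap.mem_ker, form_tmul, h i j hij x hx y hy]
  exact this hx

end LinearAlgebra

/-! ### Projections to the components of a grading -/

section Grading

variable {k : Type v} [Field k] {M : Type w} [AddCommGroup M] [Module k M]
  {ι : Type*} [DecidableEq ι] {A : ι → Submodule k M}

/-- The projection of `M = ⨁ A i` to `A i`. -/
def gradedProj (hA : DirectSum.IsInternal A) (i : ι) : M →ₗ[k] M :=
  (A i).subtype ∘ₗ DirectSum.component k ι (fun i => A i) i ∘ₗ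
    (LinearEquiv.ofBijective (DirectSum.coeLinearMap A) hA).symm.toLinearMap

lemma gradedProj_mem (hA : DirectSum.IsInternal A) (i : ι) (x : M) : gradedProj hA i x ∈ A i :=
  Subtype.property _

lemma gradedProj_of_mem (hA : DirectSum.IsInternal A) {i : ι} {x : M} (hx : x ∈ A i) :
    gradedProj hA i x = x :=
  congrArg Subtype.val (hA.ofBijective_coeLinearMap_of_mem hx)

lemma gradedProj_of_mem_ne (hA : DirectSum.IsInternal A) {i j : ι} (h : i ≠ j) {x : M}
    (hx : x ∈ A i) : gradedProj hA j x = 0 :=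
  congrArg Subtype.val (hA.ofBijective_coeLinearMap_of_mem_ne h hx)

@[elab_as_elim]
lemma grading_induction (hA : DirectSum.IsInternal A) {P : M → Prop} (x : M)
    (hmem : ∀ i, ∀ x ∈ A i, P x) (hzero : P 0) (hadd : ∀ x y, P x → P y → P (x + y)) : P x := by
  have hx : x ∈ ⨆ i, A i := by rw [hA.submodule_iSup_eq_top]; trivial
  exact Submodule.iSup_induction A (motive := P) hx hmem hzero hadd

lemma eq_of_gradedProj_eq (hA : DirectSum.IsInternal A) {x y : M}
    (h : ∀ i, gradedProj hA i x = gradedProj hA i y) : x = y := by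
  refine (LinearEquiv.ofBijective (DirectSum.coeLinearMap A) hA).symm.injective ?_
  refine DFinsupp.ext fun i => Subtype.ext (h i)

/-- Stated for all large finite sets instead of the support of `x`, so that finitely many elements
can share one index set. -/
lemma eventually_sum_gradedProj (hA : DirectSum.IsInternal A) (x : M) :
    ∀ᶠ s : Finset ι in Filter.atTop, ∑ i ∈ s, gradedProj hA i x = x := by
  refine grading_induction hA x (fun i x hx => ?_) (by simp) fun x y hx hy => ?_
  · filter_upwards [Filter.eventually_ge_atTop {i}] with s hs
    rw [Finset.sum_eq_single i, gradedProj_of_mem hA hx]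
    · intro j _ hj
      exact gradedProj_of_mem_ne hA hj.symm hx
    · intro hi
      exact absurd (hs (Finset.mem_singleton_self i)) hi
  · filter_upwards [hx, hy] with s hx hy
    simp only [map_add, Finset.sum_add_distrib, hx, hy]

lemma eventually_sum_gradedProj_tensor (hA : DirectSum.IsInternal A) (x : M ⊗[k] M) :
    ∀ᶠ s : Finset ι in Filter.atTop,
      ∑ i ∈ s, ∑ j ∈ s, TensorProduct.map (gradedProj hA i) (gradedProj hA j) x = x := by
  induction x using TensorProduct.induction_on with
  | zero => simp
  | tmul x y =>
    filter_upwards [eventually_sum_gradedProj hA x, eventually_sum_gradedProj hA y] with s hx hy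
    simp only [TensorProduct.map_tmul]
    simp only [← TensorProduct.tmul_sum, ← TensorProduct.sum_tmul, hx, hy]
  | add x y hx hy =>
    filter_upwards [hx, hy] with s hx hy
    simp only [map_add, Finset.sum_add_distrib, hx, hy]

lemma exists_sum_gradedProj_tensor (hA : DirectSum.IsInternal A) (x : M ⊗[k] M) :
    ∃ s : Finset ι,
      ∑ i ∈ s, ∑ j ∈ s, TensorProduct.map (gradedProj hA i) (gradedProj hA j) x = x :=
  (eventually_sum_gradedProj_tensor hA x).exists

/-- The degree of a tensor can be tested with homogeneous functionals. -/
lemma mem_tensorFamily_of_forms [Add ι] (hA : DirectSum.IsInternal A) {l : ι} {x : M ⊗[k] M}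
    (h : ∀ i j, i + j ≠ l → ∀ α β : M →ₗ[k] k,
      form (α ∘ₗ gradedProj hA i) (β ∘ₗ gradedProj hA j) x = 0) :
    x ∈ tensorFamily A l := by
  obtain ⟨s, hs⟩ := exists_sum_gradedProj_tensor hA x
  rw [← hs]
  refine sum_mem fun i _ => sum_mem fun j _ => ?_
  by_cases hij : i + j = l
  · subst hij
    generalize x = y
    induction y using TensorProduct.induction_on with
    | zero => simp
    | tmul x y => exact tmul_mem_tensorFamily (gradedProj_mem hA i x) (gradedProj_mem hA j y)
    | add x y hx hy => rw [map_add]; exact add_mem hx hy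
  · have : TensorProduct.map (gradedProj hA i) (gradedProj hA j) x = 0 := by
      refine (separates_univ.tensor separates_univ) _ ?_
      rintro _ ⟨α, -, β, -, rfl⟩
      rw [form_map]
      exact h i j hij α β
    rw [this]
    exact zero_mem _

lemma form_gradedProj_of_mem_tensorFamily [Add ι] (hA : DirectSum.IsInternal A) {l i j : ι}
    (hij : i + j ≠ l) (α β : M →ₗ[k] k) {x : M ⊗[k] M} (hx : x ∈ tensorFamily A l) :
    form (α ∘ₗ gradedProj hA i) (β ∘ₗ gradedProj hA j) x = 0 := by
  refine form_eq_zero_of_mem_tensorFamily (fun i' j' h x hx y hy => ?_) hx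
  by_cases hi : i' = i
  · by_cases hj : j' = j
    · subst hi hj
      exact absurd h hij
    · simp [gradedProj_of_mem_ne hA hj hy]
  · simp [gradedProj_of_mem_ne hA hi hx]

end Grading

/-! ### Direct sums and their homogeneous components -/

section DirectSums

variable {k : Type v} [Field k] {ι : Type*} [DecidableEq ι] {V : ι → Type*}
  [∀ i, AddCommGroup (V i)] [∀ i, Module k (V i)]

lemma lof_mem_component (i : ι) (x : V i) :
    DirectSum.lof k ι V i x ∈ component (k := k) (V := V) i := ⟨x, rfl⟩

lemma component_lof_of_ne {i j : ι} (h : j ≠ i) (x : V j) :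
    DirectSum.component k ι V i (DirectSum.lof k ι V j x) = 0 := by
  rw [DirectSum.component.of, dif_neg h]

@[elab_as_elim]
lemma lof_induction {P : (⨁ i, V i) → Prop} (x : ⨁ i, V i)
    (lof : ∀ i x, P (DirectSum.lof k ι V i x)) (add : ∀ x y, P x → P y → P (x + y)) (zero : P 0) :
    P x :=
  DirectSum.induction_on x zero lof add

variable (k V) in
lemma isInternal_component : DirectSum.IsInternal (component (k := k) (V := V)) := by
  refine DirectSum.isInternal_submodule_of_iSupIndep_of_iSup_eq_top ?_ ?_
  · intro i
    rw [Submodule.disjoint_def]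
    rintro _ ⟨x, rfl⟩ hx
    have h : (⨆ j, ⨆ (_ : j ≠ i), component (k := k) (V := V) j) ≤
        LinearMap.ker (DirectSum.component k ι V i) := by
      refine iSup₂_le fun j hj => ?_
      rintro _ ⟨y, rfl⟩
      exact component_lof_of_ne hj y
    have hx' : DirectSum.component k ι V i (DirectSum.lof k ι V i x) = 0 := h hx
    rw [DirectSum.component.lof_self] at hx'
    rw [hx', map_zero]
  · rw [eq_top_iff]
    rintro x -
    exact lof_induction (k := k) x (fun i x => Submodule.mem_iSup_of_mem i ⟨x, rfl⟩)
      (fun _ _ => add_mem) (zero_mem _)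

end DirectSums

/-! ### The Künneth theorem -/

section Kunneth

variable {k : Type v} [Field k] {T : Type*} [AddCommGroup T] [Module k T]

/-- A graded contracting homotopy onto the homology. -/
lemma exists_graded_homotopy {ι : Type*} [AddCommGroup ι] [DecidableEq ι] {A : ι → Submodule k T}
    (hA : DirectSum.IsInternal A) (s d : T →ₗ[k] T) (b : ι) (χ : ι → k)
    (hd : ∀ i, ∀ x ∈ A i, d x ∈ A (i + b)) (hs : ∀ i, ∀ x ∈ A i, s x = χ i • x)
    (hχ : ∀ i, χ (i + b) = - χ i) :
    ∃ h : T →ₗ[k] T, (∀ x, d (h (d x)) = d x) ∧ ∀ x, s (h x) = - h (s x) := by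
  -- Generalized inverses of `d` are chosen degree by degree. The resulting `h` has degree `-b`, and
  -- since `χ` changes sign under this shift, `h` anticommutes with `s`.
  have key : ∀ j, ∃ g : T →ₗ[k] T, (∀ x, g x ∈ A (j - b)) ∧ ∀ x ∈ A (j - b), d (g (d x)) = d x := by
    intro j
    obtain ⟨g, hg⟩ := exists_generalized_inverse (d ∘ₗ (A (j - b)).subtype)
    exact ⟨(A (j - b)).subtype ∘ₗ g, fun x => (g x).2, fun x hx => hg ⟨x, hx⟩⟩
  choose g hg hdg using key
  let h : T →ₗ[k] T := DirectSum.toModule k ι T (fun j => g j ∘ₗ (A j).subtype) ∘ₗ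
    (LinearEquiv.ofBijective (DirectSum.coeLinearMap A) hA).symm.toLinearMap
  have hh : ∀ j, ∀ x ∈ A j, h x = g j x := by
    intro j x hx
    have e : (LinearEquiv.ofBijective (DirectSum.coeLinearMap A) hA).symm x =
        DirectSum.lof k ι (fun i => A i) j ⟨x, hx⟩ := by
      rw [LinearEquiv.symm_apply_eq]
      exact (DirectSum.coeLinearMap_lof A j ⟨x, hx⟩).symm
    simp only [h, LinearMap.comp_apply, LinearEquiv.coe_coe, e, DirectSum.toModule_lof]
    rfl
  refine ⟨h, fun x => ?_, fun x => ?_⟩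
  · refine grading_induction hA x (fun i x hx => ?_) (by simp) fun x y hx hy => ?_
    · rw [hh _ _ (hd i x hx)]
      exact hdg (i + b) x (by rwa [add_sub_cancel_right])
    · simp [hx, hy]
  · refine grading_induction hA x (fun i x hx => ?_) (by simp) fun x y hx hy => ?_
    · have h1 := hχ (i - b)
      rw [sub_add_cancel] at h1
      rw [hs i x hx, map_smul, hh i x hx, hs _ _ (hg i x), h1, neg_smul, neg_neg]
    · simp [hx, hy]; abel

/-- The cycles of `T ⊗ T` are homologous to elements of `Z ⊗ Z`, where `Z` are the cycles
of `T`. -/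
lemma exists_map_inc_sub_mem_range {Z : Type*} [AddCommGroup Z] [Module k Z] (s d h : T →ₗ[k] T)
    (hss : ∀ x, s (s x) = x) (hsd : ∀ x, s (d x) = - d (s x)) (hdd : ∀ x, d (d x) = 0)
    (hdh : ∀ x, d (h (d x)) = d x) (hsh : ∀ x, s (h x) = - h (s x))
    (inc : Z →ₗ[k] T) (hinc : ∀ x, d x = 0 → x ∈ LinearMap.range inc) (u : T ⊗[k] T)
    (hu : tensorD s d u = 0) :
    ∃ w : Z ⊗[k] Z, u - TensorProduct.map inc inc w ∈ LinearMap.range (tensorD s d) := by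
  -- `p` is chain homotopic to the identity, and dhd = d makes all its values cycles.
  let p : T →ₗ[k] T := LinearMap.id - d ∘ₗ h - h ∘ₗ d
  have hp : ∀ x, p x = x - d (h x) - h (d x) := fun x => rfl
  have hdp : ∀ x, d (p x) = 0 := fun x => by simp [hp, hdd, hdh]
  -- `q` lifts `p` through `inc`, which need not be injective.
  obtain ⟨q, hq⟩ := exists_linearMap_of_relation (LinearMap.ker
    (p ∘ₗ LinearMap.fst k T Z - inc ∘ₗ LinearMap.snd k T Z)) (fun x => by
      obtain ⟨z, hz⟩ := hinc _ (hdp x)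
      exact ⟨z, by simp [hz]⟩)
  have hq : ∀ x, inc (q x) = p x := fun x => by
    have := LinearMap.mem_ker.1 (hq x)
    simp [sub_eq_zero] at this
    exact this.symm
  -- This homotopy comes from 1 ⊗ 1 - p ⊗ p = (1 - p) ⊗ 1 + p ⊗ (1 - p). The sign `s` in the second
  -- summand cancels the Koszul sign in `tensorD`, and dp = pd = 0 removes the cross terms.
  let K : T ⊗[k] T →ₗ[k] T ⊗[k] T := TensorProduct.map h LinearMap.id +
    TensorProduct.map (s ∘ₗ p) h
  have key : tensorD s d ∘ₗ K + K ∘ₗ tensorD s d =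
      LinearMap.id - TensorProduct.map inc inc ∘ₗ TensorProduct.map q q := by
    ext x y
    have e3 : ∀ x, d (s x) = - s (d x) := fun x => by rw [hsd, neg_neg]
    have e4 : ∀ x, h (s x) = - s (h x) := fun x => by rw [hsh, neg_neg]
    simp [tensorD, K, hq, hp, hss, hdd, hdh, e3, e4,
      TensorProduct.tmul_sub, TensorProduct.sub_tmul, TensorProduct.neg_tmul]
    abel
  refine ⟨TensorProduct.map q q u, K u, ?_⟩
  have := LinearMap.congr_fun key u
  simpa [hu] using this

end Kunneth

end SerreSS

end

noncomputable section

namespace SerreSS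

/-! ### Coalgebra structures determined by functionals -/

section DualCoalgebra

variable {k : Type v} [Field k] {M W W' : Type*} [AddCommGroup M] [Module k M]
  [AddCommGroup W] [Module k W] [AddCommGroup W'] [Module k W'] {ι : Type*} [AddMonoid ι]

lemma form_assoc {X Y Z : Type*} [AddCommGroup X] [Module k X] [AddCommGroup Y] [Module k Y]
    [AddCommGroup Z] [Module k Z] (a : X →ₗ[k] k) (b : Y →ₗ[k] k) (c : Z →ₗ[k] k)
    (x : (X ⊗[k] Y) ⊗[k] Z) :
    form a (form b c) (TensorProduct.assoc k X Y Z x) = form (form a b) c x := by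
  have : form a (form b c) ∘ₗ (TensorProduct.assoc k X Y Z).toLinearMap = form (form a b) c := by
    ext x y z
    simp [mul_assoc]
  exact LinearMap.congr_fun this x

/-- The functionals `α ∘ τ i` on `W`, where `α ∈ U i`, separate the points of `W`, and the
functionals `α ∈ U i` on `M` are closed under the convolution product. -/
structure DualData (Δ : M →ₗ[k] M ⊗[k] M) (ε : M →ₗ[k] k) (U : ι → Submodule k (M →ₗ[k] k))
    (τ : ι → W →ₗ[k] M) : Prop where
  separates : Separates {φ | ∃ i, ∃ α ∈ U i, φ = α ∘ₗ τ i}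
  one_mem : ε ∈ U 0
  mul_mem : ∀ {i j α β}, α ∈ U i → β ∈ U j → form α β ∘ₗ Δ ∈ U (i + j)

/-- The comultiplication `δ` of `W` is dual to the convolution product. -/
def IsDualComul (Δ : M →ₗ[k] M ⊗[k] M) (U : ι → Submodule k (M →ₗ[k] k)) (τ : ι → W →ₗ[k] M)
    (δ : W →ₗ[k] W ⊗[k] W) : Prop :=
  ∀ i j, ∀ α ∈ U i, ∀ β ∈ U j, ∀ x,
    form (α ∘ₗ τ i) (β ∘ₗ τ j) (δ x) = form α β (Δ (τ (i + j) x))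

variable {Δ : M →ₗ[k] M ⊗[k] M} {ε : M →ₗ[k] k} {U : ι → Submodule k (M →ₗ[k] k)}
  {τ : ι → W →ₗ[k] M}

/-- The uniqueness principle by which identities in W ⊗ W are verified: it suffices to compare
pairings. -/
lemma DualData.ext₂ (h : DualData Δ ε U τ) {x y : W ⊗[k] W}
    (hxy : ∀ i j, ∀ α ∈ U i, ∀ β ∈ U j,
      form (α ∘ₗ τ i) (β ∘ₗ τ j) x = form (α ∘ₗ τ i) (β ∘ₗ τ j) y) : x = y := by
  refine (h.separates.tensor h.separates).eq ?_
  rintro _ ⟨_, ⟨i, α, hα, rfl⟩, _, ⟨j, β, hβ, rfl⟩, rfl⟩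
  exact hxy i j α hα β hβ

/-- The prescribed pairings form a linear relation between `x` and `y`, so solving for `y` one `x`
at a time already yields a linear map. -/
lemma exists_isDualComul (hy : ∀ x, ∃ y : W ⊗[k] W, ∀ i j, ∀ α ∈ U i, ∀ β ∈ U j,
    form (α ∘ₗ τ i) (β ∘ₗ τ j) y = form α β (Δ (τ (i + j) x))) :
    ∃ δ : W →ₗ[k] W ⊗[k] W, IsDualComul Δ U τ δ := by
  let R : Submodule k (W × (W ⊗[k] W)) :=
    { carrier := {p | ∀ i j, ∀ α ∈ U i, ∀ β ∈ U j,
        form (α ∘ₗ τ i) (β ∘ₗ τ j) p.2 = form α β (Δ (τ (i + j) p.1))}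
      zero_mem' := by intro i j α _ β _; simp
      add_mem' := by
        intro p q hp hq i j α hα β hβ
        simp [hp i j α hα β hβ, hq i j α hα β hβ]
      smul_mem' := by
        intro c p hp i j α hα β hβ
        simp [hp i j α hα β hβ] }
  obtain ⟨δ, hδ⟩ := exists_linearMap_of_relation R hy
  exact ⟨δ, fun i j α hα β hβ x => hδ x i j α hα β hβ⟩

lemma IsDualComul.comp {δ : W →ₗ[k] W ⊗[k] W} (h : IsDualComul Δ U τ δ) {i j : ι}
    {α β : M →ₗ[k] k} (hα : α ∈ U i) (hβ : β ∈ U j) :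
    form (α ∘ₗ τ i) (β ∘ₗ τ j) ∘ₗ δ = (form α β ∘ₗ Δ) ∘ₗ τ (i + j) :=
  LinearMap.ext fun x => h i j α hα β hβ x

/-- The coalgebra structure on `W` with a comultiplication which is dual to the convolution
product. -/
@[reducible]
def DualData.coalgebra (S : Coalgebra k M) (h : DualData S.comul S.counit U τ)
    {δ : W →ₗ[k] W ⊗[k] W} (hδ : IsDualComul S.comul U τ δ) : Coalgebra k W where
  comul := δ
  counit := S.counit ∘ₗ τ 0
  coassoc := by
    ext x
    refine (h.separates.tensor (h.separates.tensor h.separates)).eq ?_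
    rintro _ ⟨_, ⟨i, α, hα, rfl⟩, _, ⟨_, ⟨j, β, hβ, rfl⟩, _, ⟨l, γ, hγ, rfl⟩, rfl⟩, rfl⟩
    simp only [LinearMap.comp_apply, LinearEquiv.coe_coe]
    -- Paired with α, β, γ, the two sides become the two bracketings of their convolution product.
    -- Closure under convolution is what allows `hδ` to be applied twice.
    rw [form_assoc, LinearMap.rTensor, LinearMap.lTensor, form_map, form_map, LinearMap.comp_id,
      LinearMap.comp_id, hδ.comp hα hβ, hδ.comp hβ hγ, hδ _ _ _ (h.mul_mem hα hβ) _ hγ,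
      hδ _ _ _ hα _ (h.mul_mem hβ hγ), add_assoc]
    have e := congrArg (form α (form β γ)) (LinearMap.congr_fun S.coassoc (τ (i + (j + l)) x))
    simp only [LinearMap.comp_apply, LinearEquiv.coe_coe] at e
    rwa [form_assoc, LinearMap.rTensor, LinearMap.lTensor, form_map, form_map, LinearMap.comp_id,
      LinearMap.comp_id] at e
  rTensor_counit_comp_comul := by
    ext x
    refine (separates_univ.tensor h.separates).eq ?_
    rintro _ ⟨c, -, _, ⟨i, α, hα, rfl⟩, rfl⟩
    have e := congrArg (form LinearMap.id α)
      (LinearMap.congr_fun S.rTensor_counit_comp_comul (τ i x))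
    -- A functional on the factor `k` is a multiple of the identity, so only the identity has to be
    -- tested.
    obtain ⟨c, rfl⟩ : ∃ c' : k, c = c' • LinearMap.id := ⟨c 1, by ext; simp⟩
    rw [form_smul_left, LinearMap.smul_apply, LinearMap.smul_apply]
    congr 1
    simp only [LinearMap.comp_apply] at e ⊢
    rw [LinearMap.rTensor, form_map, LinearMap.id_comp, LinearMap.comp_id,
      hδ _ _ _ h.one_mem _ hα, zero_add]
    rw [LinearMap.rTensor, form_map, LinearMap.id_comp, LinearMap.comp_id] at e
    simpa using e
  lTensor_counit_comp_comul := by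
    ext x
    refine (h.separates.tensor separates_univ).eq ?_
    rintro _ ⟨_, ⟨i, α, hα, rfl⟩, c, -, rfl⟩
    have e := congrArg (form α LinearMap.id)
      (LinearMap.congr_fun S.lTensor_counit_comp_comul (τ i x))
    obtain ⟨c, rfl⟩ : ∃ c' : k, c = c' • LinearMap.id := ⟨c 1, by ext; simp⟩
    rw [form_smul_right, LinearMap.smul_apply, LinearMap.smul_apply]
    congr 1
    simp only [LinearMap.comp_apply] at e ⊢
    rw [LinearMap.lTensor, form_map, LinearMap.id_comp, LinearMap.comp_id,
      hδ _ _ _ hα _ h.one_mem, add_zero]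
    rw [LinearMap.lTensor, form_map, LinearMap.id_comp, LinearMap.comp_id] at e
    simpa using e

lemma form_tensorD (α β : W →ₗ[k] k) (s d : W →ₗ[k] W) (x : W ⊗[k] W) :
    form α β (tensorD s d x) = form (α ∘ₗ d) β x + form (α ∘ₗ s) (β ∘ₗ d) x := by
  simp only [tensorD, LinearMap.add_apply, map_add, form_map, LinearMap.comp_id]

section Homology

variable {U' : ι → Submodule k (M →ₗ[k] k)} {τ' : ι → W' →ₗ[k] M} {Z : Type*} [AddCommGroup Z]
  [Module k Z] {inc : Z →ₗ[k] W} {cls : Z →ₗ[k] W'} {s d : W →ₗ[k] W} {δ : W →ₗ[k] W ⊗[k] W}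

/-- Functionals that vanish on boundaries kill the image of the Koszul differential, so `w` and δ of
the cycle have the same pairing. This gives both existence of the induced comultiplication and its
independence of `w`. -/
lemma form_cls_of_mem_range (hδ : IsDualComul Δ U τ δ) (h' : DualData Δ ε U' τ')
    (hU : ∀ i, U' i ≤ U i) (hcls : ∀ i, ∀ α ∈ U' i, ∀ z, α (τ' i (cls z)) = α (τ i (inc z)))
    (hd : ∀ i, ∀ α ∈ U' i, ∀ x, α (τ i (d x)) = 0) {z : Z} {w : Z ⊗[k] Z}
    (hw : δ (inc z) - TensorProduct.map inc inc w ∈ LinearMap.range (tensorD s d)) (i j : ι)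
    (α : M →ₗ[k] k) (hα : α ∈ U' i) (β : M →ₗ[k] k) (hβ : β ∈ U' j) :
    form (α ∘ₗ τ' i) (β ∘ₗ τ' j) (TensorProduct.map cls cls w) =
      form α β (Δ (τ' (i + j) (cls z))) := by
  obtain ⟨y, hy⟩ := hw
  have hα0 : (α ∘ₗ τ i) ∘ₗ d = 0 := LinearMap.ext (hd i α hα)
  have hβ0 : (β ∘ₗ τ j) ∘ₗ d = 0 := LinearMap.ext (hd j β hβ)
  have h1 : (α ∘ₗ τ' i) ∘ₗ cls = (α ∘ₗ τ i) ∘ₗ inc := LinearMap.ext (hcls i α hα)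
  have h2 : (β ∘ₗ τ' j) ∘ₗ cls = (β ∘ₗ τ j) ∘ₗ inc := LinearMap.ext (hcls j β hβ)
  have h3 := congrArg (form (α ∘ₗ τ i) (β ∘ₗ τ j)) hy
  rw [form_tensorD, hα0, hβ0, form_zero_left, form_zero_right, map_sub, form_map,
    hδ _ _ _ (hU _ hα) _ (hU _ hβ)] at h3
  have h4 := hcls (i + j) _ (h'.mul_mem hα hβ) z
  simp only [LinearMap.comp_apply, LinearMap.zero_apply, add_zero] at h3 h4
  rw [form_map, h1, h2, h4]
  exact (sub_eq_zero.1 h3.symm).symm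

lemma exists_isDualComul_homology (hδ : IsDualComul Δ U τ δ) (h' : DualData Δ ε U' τ')
    (hU : ∀ i, U' i ≤ U i) (hcls : ∀ i, ∀ α ∈ U' i, ∀ z, α (τ' i (cls z)) = α (τ i (inc z)))
    (hd : ∀ i, ∀ α ∈ U' i, ∀ x, α (τ i (d x)) = 0) (hsurj : Function.Surjective cls)
    (hex : ∀ z, ∃ w : Z ⊗[k] Z,
      δ (inc z) - TensorProduct.map inc inc w ∈ LinearMap.range (tensorD s d)) :
    ∃ δ' : W' →ₗ[k] W' ⊗[k] W', IsDualComul Δ U' τ' δ' := by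
  refine exists_isDualComul fun x => ?_
  obtain ⟨z, rfl⟩ := hsurj x
  obtain ⟨w, hw⟩ := hex z
  exact ⟨_, form_cls_of_mem_range hδ h' hU hcls hd hw⟩

lemma IsDualComul.inducesOnHomology (hδ : IsDualComul Δ U τ δ) (h' : DualData Δ ε U' τ')
    (hU : ∀ i, U' i ≤ U i) (hcls : ∀ i, ∀ α ∈ U' i, ∀ z, α (τ' i (cls z)) = α (τ i (inc z)))
    (hd : ∀ i, ∀ α ∈ U' i, ∀ x, α (τ i (d x)) = 0)
    (hex : ∀ z, ∃ w : Z ⊗[k] Z,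
      δ (inc z) - TensorProduct.map inc inc w ∈ LinearMap.range (tensorD s d))
    {δ' : W' →ₗ[k] W' ⊗[k] W'} (hδ' : IsDualComul Δ U' τ' δ') :
    InducesOnHomology (tensorD s d) inc cls δ δ' := by
  refine fun z => ⟨hex z, fun w hw => h'.ext₂ fun i j α hα β hβ => ?_⟩
  rw [form_cls_of_mem_range hδ h' hU hcls hd hw i j α hα β hβ, hδ' i j α hα β hβ]

end Homology

end DualCoalgebra

/-! ### Families of subquotients -/

section PageData

variable {k : Type v} [Field k] {M : Type w} [AddCommGroup M] [Module k M]
  {ι : Type*} [DecidableEq ι] {V : ι → Type*} [∀ i, AddCommGroup (V i)] [∀ i, Module k (V i)]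

variable (k M V) in
/-- A presentation `V i ≅ Z i / (Z i ∩ N i)` of a family of modules as subquotients of `M`. -/
structure PageData where
  Z : ι → Submodule k M
  N : ι → Submodule k M
  cls : ∀ i, Z i →ₗ[k] V i
  surj : ∀ i, Function.Surjective (cls i)
  cls_eq_zero : ∀ i z, cls i z = 0 ↔ (z : M) ∈ N i

namespace PageData

variable (P : PageData k M V)

/-- The functionals on `M` which vanish on `N i`. -/
def cochains (i : ι) : Submodule k (M →ₗ[k] k) := (P.N i).dualAnnihilator

lemma mem_cochains {i : ι} {α : M →ₗ[k] k} : α ∈ P.cochains i ↔ ∀ x ∈ P.N i, α x = 0 :=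
  Submodule.mem_dualAnnihilator α

lemma exists_section (i : ι) : ∃ s : V i →ₗ[k] P.Z i, ∀ x, P.cls i (s x) = x := by
  obtain ⟨s, hs⟩ := LinearMap.exists_rightInverse_of_surjective (P.cls i)
    (LinearMap.range_eq_top.2 (P.surj i))
  exact ⟨s, LinearMap.congr_fun hs⟩

/-- A map `⨁ V i → M` which assigns representatives to the elements of `V i`. -/
def rep (i : ι) : (⨁ i, V i) →ₗ[k] M :=
  (P.Z i).subtype ∘ₗ (P.exists_section i).choose ∘ₗ DirectSum.component k ι V i

lemma rep_lof_of_ne {i j : ι} (h : j ≠ i) (x : V j) :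
    P.rep i (DirectSum.lof k ι V j x) = 0 := by
  simp only [rep, LinearMap.comp_apply]
  rw [component_lof_of_ne h, map_zero, map_zero]

/-- The representative selected by `rep` differs from `z` by an element of `N i`, so cochains do not
see the arbitrary choice. -/
lemma apply_rep_lof {i : ι} {α : M →ₗ[k] k} (hα : α ∈ P.cochains i) (z : P.Z i) :
    α (P.rep i (DirectSum.lof k ι V i (P.cls i z))) = α z := by
  simp only [rep, LinearMap.comp_apply]
  rw [DirectSum.component.lof_self, ← sub_eq_zero, ← map_sub]
  refine (P.mem_cochains.1 hα) _ ?_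
  refine (P.cls_eq_zero i ((P.exists_section i).choose (P.cls i z) - z)).1 ?_
  rw [map_sub, (P.exists_section i).choose_spec, sub_self]

/-- Every functional on `V i` is represented by a functional on `M`. -/
lemma exists_cochain (i : ι) (a : (⨁ i, V i) →ₗ[k] k) :
    ∃ α ∈ P.cochains i, α ∘ₗ P.rep i = a ∘ₗ gradedProj (isInternal_component k V) i := by
  obtain ⟨s, hs⟩ := P.exists_section i
  -- `V i` embeds in `M ⧸ N i`; a linear retraction of this embedding extends functionals from `V i`
  -- to `M`.
  let f : V i →ₗ[k] M ⧸ P.N i := (P.N i).mkQ ∘ₗ (P.Z i).subtype ∘ₗ s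
  obtain ⟨g, hg⟩ := f.exists_leftInverse_of_injective (by
    rw [LinearMap.ker_eq_bot']
    intro x hx
    rw [← hs x, P.cls_eq_zero]
    exact (Submodule.Quotient.mk_eq_zero _).1 hx)
  have hmem : (a ∘ₗ DirectSum.lof k ι V i ∘ₗ g ∘ₗ (P.N i).mkQ) ∈ P.cochains i := by
    rw [P.mem_cochains]
    intro x hx
    have : (P.N i).mkQ x = 0 := (Submodule.Quotient.mk_eq_zero _).2 hx
    simp only [LinearMap.comp_apply, this, map_zero]
  refine ⟨_, hmem, ?_⟩
  refine DirectSum.linearMap_ext k fun j => LinearMap.ext fun x => ?_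
  change (a ∘ₗ DirectSum.lof k ι V i ∘ₗ g ∘ₗ (P.N i).mkQ) (P.rep i (DirectSum.lof k ι V j x)) =
    a (gradedProj (isInternal_component k V) i (DirectSum.lof k ι V j x))
  by_cases hj : j = i
  · subst hj
    obtain ⟨z, rfl⟩ : ∃ z, P.cls j (s z) = x := ⟨x, hs x⟩
    rw [P.apply_rep_lof hmem, gradedProj_of_mem _ (lof_mem_component j _), hs]
    exact congrArg (a ∘ₗ DirectSum.lof k ι V j) (LinearMap.congr_fun hg z)
  · rw [P.rep_lof_of_ne hj, gradedProj_of_mem_ne _ hj (lof_mem_component j _), map_zero, map_zero]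

lemma separates : Separates (k := k) (V := ⨁ i, V i)
    {φ | ∃ i, ∃ α ∈ P.cochains i, φ = α ∘ₗ P.rep i} := by
  intro x hx
  refine eq_of_gradedProj_eq (k := k) (isInternal_component k V) fun i => ?_
  rw [map_zero]
  refine separates_univ (k := k) _ fun a _ => ?_
  obtain ⟨α, hα, e⟩ := P.exists_cochain i a
  exact (LinearMap.congr_fun e x).symm.trans (hx _ ⟨i, α, hα, rfl⟩)

variable [AddMonoid ι] {Δ : M →ₗ[k] M ⊗[k] M} {ε : M →ₗ[k] k}

lemma exists_isDualComul (hy : ∀ l (v : V l), ∃ y : (⨁ i, V i) ⊗[k] (⨁ i, V i),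
    ∀ i j, ∀ α ∈ P.cochains i, ∀ β ∈ P.cochains j, form (α ∘ₗ P.rep i) (β ∘ₗ P.rep j) y =
      form α β (Δ (P.rep (i + j) (DirectSum.lof k ι V l v)))) :
    ∃ δ : (⨁ i, V i) →ₗ[k] (⨁ i, V i) ⊗[k] (⨁ i, V i),
      IsDualComul Δ P.cochains P.rep δ := by
  refine SerreSS.exists_isDualComul fun x => ?_
  refine lof_induction (k := k) x hy ?_ ⟨0, by simp⟩
  rintro x y ⟨x', hx⟩ ⟨y', hy⟩
  refine ⟨x' + y', fun i j α hα β hβ => ?_⟩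
  simp only [map_add, hx i j α hα β hβ, hy i j α hα β hβ]

variable {P}

/-- A pairing in degrees `i`, `j` only reads `rep (i + j)`, which vanishes on the component `l`
unless `i + j = l`. -/
lemma comul_mem {δ : (⨁ i, V i) →ₗ[k] (⨁ i, V i) ⊗[k] (⨁ i, V i)}
    (hδ : IsDualComul Δ P.cochains P.rep δ) (l : ι) :
    ∀ x ∈ component (k := k) (V := V) l, δ x ∈ tensorFamily component l := by
  rintro _ ⟨v, rfl⟩
  refine mem_tensorFamily_of_forms (isInternal_component k V) fun i j hij a b => ?_
  obtain ⟨α, hα, e⟩ := P.exists_cochain i a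
  obtain ⟨β, hβ, e'⟩ := P.exists_cochain j b
  rw [← e, ← e', hδ i j α hα β hβ, P.rep_lof_of_ne hij.symm, map_zero, map_zero]

/-- The bigraded coalgebra structure on `⨁ V i`. -/
def gradedCoalgebra (S : Coalgebra k M) (h : DualData S.comul S.counit P.cochains P.rep)
    {δ : (⨁ i, V i) →ₗ[k] (⨁ i, V i) ⊗[k] (⨁ i, V i)}
    (hδ : IsDualComul S.comul P.cochains P.rep δ) :
    GradedCoalgebra k (⨁ i, V i) (component (V := V)) where
  toCoalgebra := h.coalgebra S hδ
  comul_mem := comul_mem hδ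
  counit_eq_zero := by
    rintro i hi _ ⟨v, rfl⟩
    change S.counit (P.rep 0 _) = 0
    rw [P.rep_lof_of_ne hi, map_zero]

end PageData

end PageData

end SerreSS

end

noncomputable section

namespace SerreSS

/-! ### Filtered graded coalgebras and their associated bigraded coalgebras -/

section Filtered

variable {k : Type v} [Field k] {M : Type w} [AddCommGroup M] [Module k M]
  {deg fil : ℤ → Submodule k M}

/-- If i + j = p < a + c, then i < a or j < c. Dually, the filtrations of functionals add up under
convolution. -/
lemma form_eq_zero_of_fil (hmono : Monotone fil) {α β : M →ₗ[k] k} {a c p : ℤ}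
    (hα : ∀ x ∈ fil (a - 1), α x = 0) (hβ : ∀ x ∈ fil (c - 1), β x = 0) (hp : p < a + c)
    {x : M ⊗[k] M} (hx : x ∈ tensorFamily fil p) : form α β x = 0 := by
  refine form_eq_zero_of_mem_tensorFamily (fun i j hij x hx y hy => ?_) hx
  by_cases hi : i < a
  · rw [hα x (hmono (by lia) hx), zero_mul]
  · rw [hβ y (hmono (by lia) hy), mul_zero]

lemma form_eq_zero_of_deg {α β : M →ₗ[k] k} {a c n : ℤ}
    (hα : ∀ i, i ≠ a → ∀ x ∈ deg i, α x = 0) (hβ : ∀ i, i ≠ c → ∀ x ∈ deg i, β x = 0)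
    (hn : n ≠ a + c) {x : M ⊗[k] M} (hx : x ∈ tensorFamily deg n) : form α β x = 0 := by
  refine form_eq_zero_of_mem_tensorFamily (fun i j hij x hx y hy => ?_) hx
  by_cases hi : i = a
  · rw [hβ j (by lia) y hy, mul_zero]
  · rw [hα i hi x hx, zero_mul]

lemma exists_complement_map (F : Submodule k M) :
    ∃ e : M →ₗ[k] M, (∀ x ∈ F, e x = 0) ∧ ∀ x, x - e x ∈ F := by
  obtain ⟨t, ht⟩ := F.exists_isCompl
  refine ⟨LinearMap.id - F.subtype ∘ₗ F.projectionOnto t ht, fun x hx => ?_, fun x => ?_⟩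
  · have := Submodule.projectionOnto_apply_left ht ⟨x, hx⟩
    simp only [LinearMap.sub_apply, LinearMap.id_apply, LinearMap.comp_apply, this]
    simp
  · simp

/-- The filtration of the tensor product can be tested with functionals. -/
lemma mem_tensorFamily_fil_of_forms (hmono : Monotone fil) (hbot : fil (-1) = ⊥)
    (hex : ∀ x, ∃ n : ℕ, x ∈ fil n) {p : ℤ} (x : M ⊗[k] M)
    (h : ∀ (a c : ℤ), a + c = p + 1 → ∀ α β : M →ₗ[k] k, (∀ x ∈ fil (a - 1), α x = 0) →
      (∀ x ∈ fil (c - 1), β x = 0) → form α β x = 0) : x ∈ tensorFamily fil p := by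
  -- Induction on the filtration of the first factor; the shift by one makes the case `n = 0` the
  -- zero module.
  have key : ∀ n : ℕ, ∀ x ∈ Submodule.map₂ (TensorProduct.mk k M M) (fil ((n : ℤ) - 1)) ⊤,
      (∀ (a c : ℤ), a + c = p + 1 → ∀ α β : M →ₗ[k] k, (∀ x ∈ fil (a - 1), α x = 0) →
        (∀ x ∈ fil (c - 1), β x = 0) → form α β x = 0) → x ∈ tensorFamily fil p := by
    intro n
    induction n with
    | zero =>
      intro x hx _
      rw [Nat.cast_zero, zero_sub, hbot, Submodule.map₂_bot_left, Submodule.mem_bot] at hx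
      rw [hx]
      exact zero_mem _
    | succ n ih =>
      intro x hx h
      -- With `e`, `f` the projections killing F^{n-1} and F^{p-n}, split `x` into (1-e)⊗1, e⊗(1-f)
      -- and e⊗f parts. The last vanishes by the hypothesis for a = n, c = p-n+1, the middle one
      -- lies in F^n ⊗ F^{p-n}, and the first falls under the induction hypothesis.
      obtain ⟨e, he, he'⟩ := exists_complement_map (fil ((n : ℤ) - 1))
      obtain ⟨f, hf, hf'⟩ := exists_complement_map (fil (p - n))
      rw [show ((n + 1 : ℕ) : ℤ) - 1 = n by push_cast; ring] at hx
      have h0 : TensorProduct.map e f x = 0 := by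
        refine (separates_univ.tensor separates_univ) _ ?_
        rintro _ ⟨α, -, β, -, rfl⟩
        rw [form_map]
        refine h n (p - n + 1) (by ring) _ _ (fun x hx => ?_) (fun x hx => ?_)
        · rw [LinearMap.comp_apply, he x hx, map_zero]
        · rw [add_sub_cancel_right] at hx
          rw [LinearMap.comp_apply, hf x hx, map_zero]
      have h1 : TensorProduct.map e (LinearMap.id - f) x ∈ tensorFamily fil p := by
        have : Submodule.map₂ (TensorProduct.mk k M M) (fil n) ⊤ ≤
            (tensorFamily fil p).comap (TensorProduct.map e (LinearMap.id - f)) := by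
          refine Submodule.map₂_le.2 fun y hy z _ => ?_
          have hy' : e y ∈ fil n := by
            have := sub_mem hy (hmono (by lia) (he' y))
            rwa [sub_sub_cancel] at this
          have := tmul_mem_tensorFamily hy' (hf' z)
          rwa [add_sub_cancel] at this
        exact this hx
      have h2 : TensorProduct.map (LinearMap.id - e) LinearMap.id x ∈
          Submodule.map₂ (TensorProduct.mk k M M) (fil ((n : ℤ) - 1)) ⊤ := by
        generalize x = u
        induction u using TensorProduct.induction_on with
        | zero => simp
        | tmul y z => exact Submodule.apply_mem_map₂ _ (he' y) trivial
        | add y z hy hz => rw [map_add]; exact add_mem hy hz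
      have h3 : x = TensorProduct.map (LinearMap.id - e) LinearMap.id x +
          (TensorProduct.map e (LinearMap.id - f) x + TensorProduct.map e f x) := by
        generalize x = u
        induction u using TensorProduct.induction_on with
        | zero => simp
        | tmul y z => simp [TensorProduct.sub_tmul, TensorProduct.tmul_sub]
        | add y z hy hz =>
          nth_rewrite 1 [hy, hz]
          simp only [map_add]
          abel
      rw [h0, add_zero] at h3
      rw [h3]
      refine add_mem (ih _ h2 fun a c hac α β hα hβ => ?_) h1
      rw [eq_sub_of_add_eq h3.symm, map_sub, h a c hac α β hα hβ,
        form_eq_zero_of_fil hmono hα hβ (by lia) h1, sub_zero]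
  obtain ⟨n, hn⟩ : ∃ n : ℕ,
      x ∈ Submodule.map₂ (TensorProduct.mk k M M) (fil ((n : ℤ) - 1)) ⊤ := by
    clear h
    induction x using TensorProduct.induction_on with
    | zero => exact ⟨0, zero_mem _⟩
    | tmul y z =>
      obtain ⟨n, hn⟩ := hex y
      refine ⟨n + 1, Submodule.apply_mem_map₂ _ ?_ trivial⟩
      simpa using hn
    | add y z hy hz =>
      obtain ⟨n, hn⟩ := hy
      obtain ⟨m, hm⟩ := hz
      refine ⟨max n m, add_mem ?_ ?_⟩
      · exact Submodule.map₂_le_map₂_left (hmono (by simp)) hn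
      · exact Submodule.map₂_le_map₂_left (hmono (by simp)) hm
  exact key n x hn h

/-- The map `⨁ F^p_{p+q} → M`. -/
abbrev incFil (deg fil : ℤ → Submodule k M) : (⨁ pq, ↥(filPiece deg fil pq)) →ₗ[k] M :=
  DirectSum.toModule k (ℤ × ℤ) M fun pq => (filPiece deg fil pq).subtype

lemma incFil_lof (pq : ℤ × ℤ) (x : ↥(filPiece deg fil pq)) :
    incFil deg fil (DirectSum.lof k _ (fun pq => ↥(filPiece deg fil pq)) pq x) = x :=
  DirectSum.toModule_lof (φ := fun pq => (filPiece deg fil pq).subtype) k pq x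

/-- Projecting to degrees (i, j) preserves the filtration and cuts F^a ⊗ F^c down to homogeneous
pieces; the projections with i + j ≠ p + q vanish on `u`. The lift is exact, which is stronger than
the congruence demanded by `InducesOnGr`. -/
lemma exists_lift_tensorFamily (hdeg : DirectSum.IsInternal deg)
    (hfil : ∀ p n, ∀ x ∈ fil p, gradedProj hdeg n x ∈ fil p) {pq : ℤ × ℤ} {u : M ⊗[k] M}
    (hu : u ∈ tensorFamily fil pq.1) (hu' : u ∈ tensorFamily deg (pq.1 + pq.2)) :
    ∃ w ∈ tensorFamily component pq,
      TensorProduct.map (incFil deg fil) (incFil deg fil) w = u := by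
  suffices h : u ∈ (tensorFamily component pq).map
      (TensorProduct.map (incFil deg fil) (incFil deg fil)) from h
  obtain ⟨s, hs⟩ := exists_sum_gradedProj_tensor hdeg u
  rw [← hs]
  refine sum_mem fun i _ => sum_mem fun j _ => ?_
  by_cases hij : i + j = pq.1 + pq.2
  · have : tensorFamily fil pq.1 ≤ ((tensorFamily component pq).map
        (TensorProduct.map (incFil deg fil) (incFil deg fil))).comap
          (TensorProduct.map (gradedProj hdeg i) (gradedProj hdeg j)) := by
      refine tensorFamily_le fun a c hac x hx y hy => ?_
      have hx' : gradedProj hdeg i x ∈ filPiece deg fil (a, i - a) :=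
        ⟨hfil a i x hx, by simpa using gradedProj_mem hdeg i x⟩
      have hy' : gradedProj hdeg j y ∈ filPiece deg fil (c, j - c) :=
        ⟨hfil c j y hy, by simpa using gradedProj_mem hdeg j y⟩
      have hpq : (a, i - a) + (c, j - c) = pq := Prod.ext hac (by simp; lia)
      refine ⟨_, hpq ▸ tmul_mem_tensorFamily 
        (lof_mem_component (k := k) (V := fun pq => ↥(filPiece deg fil pq)) _ ⟨_, hx'⟩)
        (lof_mem_component (k := k) (V := fun pq => ↥(filPiece deg fil pq)) _ ⟨_, hy'⟩), ?_⟩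
      rw [TensorProduct.map_tmul, incFil_lof, incFil_lof, TensorProduct.map_tmul]
    exact this hu
  · have : TensorProduct.map (gradedProj hdeg i) (gradedProj hdeg j) u = 0 := by
      refine (separates_univ.tensor separates_univ) _ ?_
      rintro _ ⟨α, -, β, -, rfl⟩
      rw [form_map]
      exact form_gradedProj_of_mem_tensorFamily hdeg hij α β hu'
    rw [this]
    exact zero_mem _

variable {V : ℤ × ℤ → Type*} [∀ i, AddCommGroup (V i)] [∀ i, Module k (V i)]

/-- The presentation of `V` as a family of subquotients of `M` is compatible with the maps
`F^p_{p+q} → V_{p,q}`. -/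
structure PageData.GrCompatible (P : PageData k M V) (deg fil : ℤ → Submodule k M)
    (cls : ∀ pq, ↥(filPiece deg fil pq) →ₗ[k] V pq) : Prop where
  mono : Monotone fil
  apply_rep {i α} : α ∈ P.cochains i → ∀ z : ↥(filPiece deg fil i),
    α (P.rep i (DirectSum.lof k _ V i (cls i z))) = α z
  fil_le (i) : fil (i.1 - 1) ≤ P.N i
  deg_le (i n) : n ≠ i.1 + i.2 → deg n ≤ P.N i

namespace PageData.GrCompatible

variable {P : PageData k M V} {cls : ∀ pq, ↥(filPiece deg fil pq) →ₗ[k] V pq}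

/-- After passage to `V` only the (i, j) part of `w` contributes, by the definition of `rep`. Before
that passage the other parts of total bidegree i + j contribute nothing either, since in each of
them one factor is killed by α or β. -/
lemma form_lmap (hP : P.GrCompatible deg fil cls) {i j l : ℤ × ℤ} {α β : M →ₗ[k] k}
    (hα : α ∈ P.cochains i) (hβ : β ∈ P.cochains j)
    {w : (⨁ pq, ↥(filPiece deg fil pq)) ⊗[k] (⨁ pq, ↥(filPiece deg fil pq))}
    (hw : w ∈ tensorFamily component l) :
    form (α ∘ₗ P.rep i) (β ∘ₗ P.rep j)
        (TensorProduct.map (DirectSum.lmap cls) (DirectSum.lmap cls) w) =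
      if i + j = l then
        form α β (TensorProduct.map (incFil deg fil) (incFil deg fil) w) else 0 := by
  have hα' := P.mem_cochains.1 hα
  have hβ' := P.mem_cochains.1 hβ
  rw [form_map, form_map]
  split_ifs with hij
  · subst hij
    rw [← sub_eq_zero, ← LinearMap.sub_apply]
    have : tensorFamily (component (k := k)) (i + j) ≤ LinearMap.ker
        (form ((α ∘ₗ P.rep i) ∘ₗ DirectSum.lmap cls) ((β ∘ₗ P.rep j) ∘ₗ DirectSum.lmap cls) -
          form (α ∘ₗ incFil deg fil) (β ∘ₗ incFil deg fil)) := by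
      refine tensorFamily_le ?_
      rintro a b hab _ ⟨x, rfl⟩ _ ⟨y, rfl⟩
      rw [LinearMap.mem_ker, LinearMap.sub_apply, sub_eq_zero, form_tmul, form_tmul]
      simp only [LinearMap.comp_apply, DirectSum.lmap_lof]
      rw [incFil_lof, incFil_lof]
      have hab1 := congrArg Prod.fst hab
      have hab2 := congrArg Prod.snd hab
      simp only [Prod.fst_add, Prod.snd_add] at hab1 hab2
      by_cases ha : a = i
      · subst ha
        obtain rfl : b = j := add_left_cancel hab
        rw [hP.apply_rep hα, hP.apply_rep hβ]
      · rw [P.rep_lof_of_ne ha, map_zero, zero_mul]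
        by_cases h1 : a.1 + a.2 = i.1 + i.2
        · have h2 : a.1 ≠ i.1 := fun h2 => ha (Prod.ext h2 (by lia))
          by_cases h3 : a.1 < i.1
          · rw [hα' x (hP.fil_le i (hP.mono (by lia) x.2.1)), zero_mul]
          · rw [hβ' y (hP.fil_le j (hP.mono (by lia) y.2.1)), mul_zero]
        · rw [hα' x (hP.deg_le i _ h1 x.2.2), zero_mul]
    exact this hw
  · refine form_eq_zero_of_mem_tensorFamily ?_ hw
    rintro a b hab _ ⟨x, rfl⟩ _ ⟨y, rfl⟩
    simp only [LinearMap.comp_apply, DirectSum.lmap_lof]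
    by_cases ha : a = i
    · by_cases hb : b = j
      · subst ha hb
        exact absurd hab hij
      · rw [P.rep_lof_of_ne hb, map_zero, mul_zero]
    · rw [P.rep_lof_of_ne ha, map_zero, zero_mul]

variable {Δ : M →ₗ[k] M ⊗[k] M} {ε : M →ₗ[k] k}

lemma exists_isDualComul (hP : P.GrCompatible deg fil cls)
    (hsurj : ∀ i, Function.Surjective (cls i)) (h : DualData Δ ε P.cochains P.rep)
    (hex : ∀ pq, ∀ z : ↥(filPiece deg fil pq), ∃ w ∈ tensorFamily component pq,
      TensorProduct.map (incFil deg fil) (incFil deg fil) w = Δ z) :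
    ∃ δ : (⨁ i, V i) →ₗ[k] (⨁ i, V i) ⊗[k] (⨁ i, V i), IsDualComul Δ P.cochains P.rep δ := by
  refine P.exists_isDualComul fun l v => ?_
  obtain ⟨z, rfl⟩ := hsurj l v
  obtain ⟨w, hw, e⟩ := hex l z
  refine ⟨_, fun i j α hα β hβ => (hP.form_lmap hα hβ hw).trans ?_⟩
  split_ifs with hij
  · subst hij
    rw [e]
    exact (hP.apply_rep (h.mul_mem hα hβ) z).symm
  · rw [P.rep_lof_of_ne (Ne.symm hij), map_zero, map_zero]

lemma inducesOnGr (hP : P.GrCompatible deg fil cls) (h : DualData Δ ε P.cochains P.rep)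
    (hex : ∀ pq, ∀ z : ↥(filPiece deg fil pq), ∃ w ∈ tensorFamily component pq,
      TensorProduct.map (incFil deg fil) (incFil deg fil) w = Δ z)
    {δ : (⨁ i, V i) →ₗ[k] (⨁ i, V i) ⊗[k] (⨁ i, V i)}
    (hδ : IsDualComul Δ P.cochains P.rep δ) : InducesOnGr deg fil cls Δ δ := by
  refine fun pq z => ⟨?_, fun w hw hzw => h.ext₂ fun i j α hα β hβ => ?_⟩
  · obtain ⟨w, hw, e⟩ := hex pq z
    refine ⟨w, hw, ?_⟩
    rw [← e, sub_self]
    exact zero_mem _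
  · rw [hδ i j α hα β hβ, hP.form_lmap hα hβ hw]
    split_ifs with hij
    · subst hij
      refine (hP.apply_rep (h.mul_mem hα hβ) z).trans ?_
      -- The error term has filtration one less than `i.1 + j.1`, hence is invisible to the pairing.
      rw [← sub_eq_zero, LinearMap.comp_apply, ← map_sub]
      refine form_eq_zero_of_fil (a := i.1) (c := j.1) hP.mono
        (fun x hx => P.mem_cochains.1 hα x (hP.fil_le i hx))
        (fun x hx => P.mem_cochains.1 hβ x (hP.fil_le j hx)) ?_ hzw
      simp
    · rw [P.rep_lof_of_ne (Ne.symm hij), map_zero, map_zero]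

end PageData.GrCompatible

/-- The presentation of the associated bigraded module as a family of subquotients. -/
def grPageData (deg fil : ℤ → Submodule k M) (hdeg : DirectSum.IsInternal deg)
    (hfil : ∀ p n, ∀ x ∈ fil p, gradedProj hdeg n x ∈ fil p) : PageData k M (Gr deg fil) where
  Z := filPiece deg fil
  -- Including the other degrees makes cochains homogeneous functionals on all of `M`, without
  -- changing the quotient of `Z`.
  N pq := fil (pq.1 - 1) ⊔ ⨆ (n : ℤ) (_ : n ≠ pq.1 + pq.2), deg n
  cls := toGr deg fil
  surj i := Submodule.mkQ_surjective _
  cls_eq_zero := by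
    intro i z
    refine (Submodule.Quotient.mk_eq_zero _).trans ?_
    change (z : M) ∈ fil (i.1 - 1) ⊓ deg (i.1 + i.2) ↔ _
    refine ⟨fun h => Submodule.mem_sup_left h.1, fun h => ⟨?_, z.2.2⟩⟩
    have : fil (i.1 - 1) ⊔ ⨆ (n : ℤ) (_ : n ≠ i.1 + i.2), deg n ≤
        (fil (i.1 - 1)).comap (gradedProj hdeg (i.1 + i.2)) := by
      refine sup_le (hfil _ _) (iSup₂_le fun n hn x hx => ?_)
      rw [Submodule.mem_comap, gradedProj_of_mem_ne hdeg hn hx]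
      exact zero_mem _
    have hz := this h
    rwa [Submodule.mem_comap, gradedProj_of_mem hdeg z.2.2] at hz

lemma grPageData_compatible (hmono : Monotone fil) (hdeg : DirectSum.IsInternal deg)
    (hfil : ∀ p n, ∀ x ∈ fil p, gradedProj hdeg n x ∈ fil p) :
    (grPageData deg fil hdeg hfil).GrCompatible deg fil (toGr deg fil) where
  mono := hmono
  apply_rep hα z := (grPageData deg fil hdeg hfil).apply_rep_lof hα z
  fil_le _ := le_sup_left
  deg_le _ n hn := le_sup_of_le_right (le_iSup₂_of_le n hn le_rfl)

lemma mem_cochains_grPageData {hdeg : DirectSum.IsInternal deg}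
    {hfil : ∀ p n, ∀ x ∈ fil p, gradedProj hdeg n x ∈ fil p} {i : ℤ × ℤ} {α : M →ₗ[k] k} :
    α ∈ (grPageData deg fil hdeg hfil).cochains i ↔
      (∀ x ∈ fil (i.1 - 1), α x = 0) ∧ ∀ n, n ≠ i.1 + i.2 → ∀ x ∈ deg n, α x = 0 := by
  rw [PageData.mem_cochains]
  refine ⟨fun h => ⟨fun x hx => h x (Submodule.mem_sup_left hx), fun n hn x hx =>
    h x (Submodule.mem_sup_right (Submodule.mem_iSup_of_mem n (Submodule.mem_iSup_of_mem hn hx)))⟩,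
    fun ⟨h1, h2⟩ x hx => ?_⟩
  have : fil (i.1 - 1) ⊔ ⨆ (n : ℤ) (_ : n ≠ i.1 + i.2), deg n ≤ LinearMap.ker α :=
    sup_le h1 (iSup₂_le h2)
  exact this hx

end Filtered

end SerreSS

end

noncomputable section

namespace SerreSS

/-! ### The pages of the spectral sequence of a filtered complex -/

namespace FilteredDGModule

section Pages

variable {k : Type v} [Field k] {M : Type w} [AddCommGroup M] [Module k M]
  (C : FilteredDGModule k M)

open HSpectralSequence in
/-- The class of an element of `Z^r_{p,q}` in `E^r_{p,q}`. -/
def pageCls (r : ℕ) (pq : ℤ × ℤ) : C.Z r pq →ₗ[k] X C.spectralSequence r pq :=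
  Submodule.mkQ ((C.denom r pq).submoduleOf (C.Z r pq))

lemma pageCls_surjective (r : ℕ) (pq : ℤ × ℤ) : Function.Surjective (C.pageCls r pq) :=
  Submodule.mkQ_surjective _

lemma pageCls_eq_zero (r : ℕ) (pq : ℤ × ℤ) (z : C.Z r pq) :
    C.pageCls r pq z = 0 ↔ (z : M) ∈ C.denom r pq :=
  Submodule.Quotient.mk_eq_zero _

lemma d_mem_Z {r : ℤ} {pq : ℤ × ℤ} {x : M} (hx : x ∈ C.Z r pq) :
    C.d x ∈ C.Z r (pq + (-r, r - 1)) := by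
  rw [mem_Z] at hx ⊢
  refine ⟨by simpa [sub_eq_add_neg] using hx.2.2, ?_, by simp [C.d_d]⟩
  convert C.d_deg _ _ hx.2.1 using 2
  simp; ring

lemma page_d_pageCls (r : ℕ) (pq : ℤ × ℤ) (z : C.Z r pq) :
    ((C.spectralSequence.page (r : ℤ)).d pq (pq + (-(r : ℤ), (r : ℤ) - 1))).hom
      (C.pageCls r pq z) = C.pageCls r _ ⟨C.d z, C.d_mem_Z z.2⟩ := by
  have h := C.page_d r pq _ rfl
  change ((C.page r).d pq _).hom _ = _
  rw [h]
  rfl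

open HSpectralSequence in
lemma D_pageCls (r : ℕ) (pq : ℤ × ℤ) (z : C.Z r pq) :
    D C.spectralSequence r (DirectSum.lof k _ (X C.spectralSequence r) pq (C.pageCls r pq z)) =
      DirectSum.lof k _ (X C.spectralSequence r) (pq + (-(r : ℤ), (r : ℤ) - 1))
        (C.pageCls r _ ⟨C.d z, C.d_mem_Z z.2⟩) := by
  rw [← page_d_pageCls]
  exact DirectSum.toModule_lof k pq _

/-- The inclusion `Z^{r+1}_{p,q} → Z^r_{p,q}`. -/
def inclZ (r : ℕ) (pq : ℤ × ℤ) : C.Z ((r + 1 : ℕ) : ℤ) pq →ₗ[k] C.Z r pq :=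
  Submodule.inclusion (C.Z_succ_le r pq)

/-- Compares the abstract cycles and homology of a page with the kernel and quotient model behind
`homologyEquiv`, so that `toNext` can be computed on elements. -/
lemma cycles_isIso_hom (r : ℕ) (pq : ℤ × ℤ) :
    ∃ Φ : (C.page r).cycles pq ⟶ (C.scE r pq).moduleCatLeftHomologyData.K,
      Φ ≫ (C.scE r pq).moduleCatLeftHomologyData.i = (C.page r).iCycles pq ∧
      HSpectralSequence.toNext C.spectralSequence r pq =
        Φ ≫ (C.scE r pq).moduleCatLeftHomologyData.π ≫ (C.homologyEquiv r pq).toModuleIso.hom := by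
  have hi : (ComplexShape.up' ((-(r : ℤ), (r : ℤ) - 1) : ℤ × ℤ)).prev pq =
      pq - (-(r : ℤ), (r : ℤ) - 1) := ComplexShape.prev_eq' _ (sub_add_cancel _ _)
  have hk : (ComplexShape.up' ((-(r : ℤ), (r : ℤ) - 1) : ℤ × ℤ)).next pq =
      pq + (-(r : ℤ), (r : ℤ) - 1) := ComplexShape.next_eq' _ rfl
  refine ⟨((C.page r).cyclesIsoSc' _ pq _ hi hk).hom ≫ (C.scE r pq).moduleCatCyclesIso.hom, ?_, ?_⟩
  · rw [Category.assoc, ShortComplex.moduleCatCyclesIso_hom_i,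
      HomologicalComplex.cyclesIsoSc'_hom_iCycles]
  · have h : HSpectralSequence.toNext C.spectralSequence r pq = (C.page r).homologyπ pq ≫
      ((C.page r).homologyIsoSc' _ pq _ hi hk).hom ≫ (C.scE r pq).moduleCatHomologyIso.hom ≫
        (C.homologyEquiv r pq).toModuleIso.hom ≫ 𝟙 _ := rfl
    refine h.trans ?_
    rw [Category.comp_id, HomologicalComplex.π_homologyIsoSc'_hom_assoc,
      ShortComplex.π_moduleCatCyclesIso_hom_assoc, Category.assoc]

/-- Passage to the next page keeps the representing chain, provided the latter is chosen in Z^{r+1}.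
-/
lemma toNext_apply (r : ℕ) (pq : ℤ × ℤ) (c : (C.spectralSequence.page (r : ℤ)).cycles pq)
    (z : C.Z ((r + 1 : ℕ) : ℤ) pq)
    (h : ((C.spectralSequence.page (r : ℤ)).iCycles pq).hom c = C.pageCls r pq (C.inclZ r pq z)) :
    (HSpectralSequence.toNext C.spectralSequence r pq).hom c = C.pageCls (r + 1) pq z := by
  obtain ⟨Φ, h1, h2⟩ := C.cycles_isIso_hom r pq
  rw [h2]
  have h3 : Φ.hom c = C.cycleClass r pq z := by
    refine Subtype.ext ?_
    have h4 : ((C.scE r pq).moduleCatLeftHomologyData.i).hom (Φ.hom c) =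
      ((C.page r).iCycles pq).hom c := by rw [← h1]; rfl
    exact h4.trans h
  change (C.homologyEquiv r pq) ((LinearMap.range (C.scE r pq).moduleCatToCycles).mkQ (Φ.hom c)) = _
  rw [h3]
  change (C.homologyEquiv r pq) (C.homologyClass r pq z) = _
  exact (LinearEquiv.symm_apply_eq _).2 rfl

/-- If d^r[z] = 0, then ∂z = ∂t + f with t in F^{p-1} and f in F^{p-r-1}. Then z - t lies in Z^{r+1}
and has the same class as z. -/
lemma exists_Z_succ_of_d_eq_zero (r : ℕ) (pq : ℤ × ℤ)
    (x : HSpectralSequence.X C.spectralSequence r pq)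
    (hx : ((C.spectralSequence.page (r : ℤ)).d pq (pq + (-(r : ℤ), (r : ℤ) - 1))).hom x = 0) :
    ∃ z, x = C.pageCls r pq (C.inclZ r pq z) := by
  obtain ⟨⟨z, hz⟩, rfl⟩ := C.pageCls_surjective r pq x
  rw [page_d_pageCls, pageCls_eq_zero] at hx
  obtain ⟨t, ht, ht', h1, f, hf, hf', e⟩ := mem_denom.1 hx
  have hz' := mem_Z.1 hz
  simp only [Prod.fst_add, Prod.snd_add] at ht ht' hf hf' e
  have ht1 : t ∈ C.fil (pq.1 - 1) := by convert ht using 2; ring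
  have ht2 : t ∈ C.deg (pq.1 + pq.2) := by convert ht' using 2; ring
  have hzt : z - t ∈ C.Z ((r + 1 : ℕ) : ℤ) pq := by
    refine mem_Z.2 ⟨sub_mem hz'.1 (C.fil_mono (by lia) ht1), sub_mem hz'.2.1 ht2, ?_⟩
    rw [map_sub, ← e, add_sub_cancel_left]
    convert hf using 2; push_cast; ring
  refine ⟨⟨z - t, hzt⟩, ?_⟩
  rw [← sub_eq_zero, ← map_sub, pageCls_eq_zero]
  change z - (z - t) ∈ _
  rw [sub_sub_cancel]
  exact Submodule.mem_sup_right ⟨ht1, ht2⟩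

lemma exists_cycles (r : ℕ) (pq : ℤ × ℤ) (z : C.Z ((r + 1 : ℕ) : ℤ) pq) :
    ∃ c, ((C.spectralSequence.page (r : ℤ)).iCycles pq).hom c =
      C.pageCls r pq (C.inclZ r pq z) := by
  let φ : ModuleCat.of k (C.Z ((r + 1 : ℕ) : ℤ) pq) ⟶ (C.spectralSequence.page (r : ℤ)).X pq :=
    ModuleCat.ofHom (C.pageCls r pq ∘ₗ C.inclZ r pq)
  have hφ : φ ≫ (C.spectralSequence.page (r : ℤ)).d pq (pq + (-(r : ℤ), (r : ℤ) - 1)) = 0 := by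
    ext z
    -- For z in Z^{r+1} the boundary lies in F^{p-r-1}, one step below the filtration of the target
    -- of d^r.
    refine (C.page_d_pageCls r pq (C.inclZ r pq z)).trans ((C.pageCls_eq_zero _ _ _).2 ?_)
    have hz := mem_Z.1 z.2
    have e1 : (pq + (-(r : ℤ), (r : ℤ) - 1)).1 - 1 = pq.1 - ((r + 1 : ℕ) : ℤ) := by
      simp only [Prod.fst_add]; push_cast; ring
    have e2 : (pq + (-(r : ℤ), (r : ℤ) - 1)).1 + (pq + (-(r : ℤ), (r : ℤ) - 1)).2 =
        pq.1 + pq.2 - 1 := by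
      simp only [Prod.fst_add, Prod.snd_add]; ring
    refine Submodule.mem_sup_right ⟨?_, ?_⟩
    · rw [e1]
      exact hz.2.2
    · rw [e2]
      exact C.d_deg _ _ hz.2.1
  refine ⟨((C.spectralSequence.page (r : ℤ)).liftCycles φ _ (ComplexShape.next_eq' _ rfl) hφ).hom z,
    ?_⟩
  have := (C.spectralSequence.page (r : ℤ)).liftCycles_i φ _ (ComplexShape.next_eq' _ rfl) hφ
  exact LinearMap.congr_fun (congrArg ModuleCat.Hom.hom this) z

lemma exists_rep_cycles (r : ℕ) (pq : ℤ × ℤ) (c : (C.spectralSequence.page (r : ℤ)).cycles pq) :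
    ∃ z, ((C.spectralSequence.page (r : ℤ)).iCycles pq).hom c =
      C.pageCls r pq (C.inclZ r pq z) := by
  refine C.exists_Z_succ_of_d_eq_zero r pq _ ?_
  have := (C.spectralSequence.page (r : ℤ)).iCycles_d pq (pq + (-(r : ℤ), (r : ℤ) - 1))
  exact LinearMap.congr_fun (congrArg ModuleCat.Hom.hom this) c

end Pages

end FilteredDGModule

end SerreSS

end

noncomputable section

namespace SerreSS

namespace FilteredDGModule

/-! ### Cochains of the pages and the induced coalgebra structures -/

section Pages

variable {k : Type v} [Field k] {M : Type w} [AddCommGroup M] [Module k M]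
  (C : FilteredDGModule k M)

lemma gradedProj_mem_fil (p n : ℤ) : ∀ x ∈ C.fil p, gradedProj C.isInternal n x ∈ C.fil p := by
  have : C.fil p ≤ (C.fil p).comap (gradedProj C.isInternal n) := by
    nth_rewrite 1 [C.fil_homogeneous p]
    refine iSup_le fun m x hx => ?_
    rw [Submodule.mem_comap]
    by_cases h : m = n
    · subst h
      rw [gradedProj_of_mem C.isInternal hx.2]
      exact hx.1
    · rw [gradedProj_of_mem_ne C.isInternal h hx.2]
      exact zero_mem _
  exact this

lemma d_gradedProj (n : ℤ) (x : M) :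
    C.d (gradedProj C.isInternal n x) = gradedProj C.isInternal (n - 1) (C.d x) := by
  refine grading_induction C.isInternal x (fun m x hx => ?_) (by simp) fun x y hx hy => ?_
  · by_cases h : m = n
    · subst h
      rw [gradedProj_of_mem C.isInternal hx, gradedProj_of_mem C.isInternal (C.d_deg _ _ hx)]
    · rw [gradedProj_of_mem_ne C.isInternal h hx,
        gradedProj_of_mem_ne C.isInternal (by lia) (C.d_deg _ _ hx), map_zero]
  · rw [map_add, map_add, map_add, map_add, hx, hy]

lemma sign_apply {n : ℤ} {x : M} (hx : x ∈ C.deg n) : C.sign x = (n.negOnePow : ℤ) • x := by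
  have e : (LinearEquiv.ofBijective (DirectSum.coeLinearMap C.deg) C.isInternal).symm x =
      DirectSum.lof k ℤ (fun i => C.deg i) n ⟨x, hx⟩ := by
    rw [LinearEquiv.symm_apply_eq]
    exact (DirectSum.coeLinearMap_lof C.deg n ⟨x, hx⟩).symm
  rw [sign, LinearMap.comp_apply, LinearEquiv.coe_coe, e]
  exact DirectSum.toModule_lof (φ := fun n => (n.negOnePow : ℤ) • (C.deg n).subtype) k n ⟨x, hx⟩

lemma sign_sign (x : M) : C.sign (C.sign x) = x := by
  refine grading_induction C.isInternal x (fun m x hx => ?_) (by simp) fun x y hx hy => ?_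
  · rw [C.sign_apply hx, map_zsmul, C.sign_apply hx, smul_smul, ← Units.val_mul,
      Int.units_mul_self, Units.val_one, one_smul]
  · rw [map_add, map_add, hx, hy]

lemma sign_d (x : M) : C.sign (C.d x) = - C.d (C.sign x) := by
  refine grading_induction C.isInternal x (fun m x hx => ?_) (by simp) fun x y hx hy => ?_
  · rw [C.sign_apply hx, map_zsmul, C.sign_apply (C.d_deg _ _ hx), Int.negOnePow_sub,
      Int.negOnePow_one]
    simp
  · simp only [map_add, hx, hy, neg_add]

lemma sign_mem_fil (p : ℤ) : ∀ x ∈ C.fil p, C.sign x ∈ C.fil p := by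
  have : C.fil p ≤ (C.fil p).comap C.sign := by
    nth_rewrite 1 [C.fil_homogeneous p]
    refine iSup_le fun m x hx => ?_
    rw [Submodule.mem_comap, C.sign_apply hx.2]
    exact zsmul_mem hx.1 _
  exact this

/-- The submodule `F^{p-1} + ∂ F^{p+r-1} + ∑_{n ≠ p+q} M_n`. -/
def pageN (r : ℕ) (pq : ℤ × ℤ) : Submodule k M :=
  C.fil (pq.1 - 1) ⊔ (C.fil (pq.1 + r - 1)).map C.d ⊔ ⨆ (n : ℤ) (_ : n ≠ pq.1 + pq.2), C.deg n

lemma pageN_le_iff (r : ℕ) (pq : ℤ × ℤ) (N : Submodule k M) : C.pageN r pq ≤ N ↔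
    (∀ x ∈ C.fil (pq.1 - 1), x ∈ N) ∧ (∀ x ∈ C.fil (pq.1 + r - 1), C.d x ∈ N) ∧
      ∀ n, n ≠ pq.1 + pq.2 → ∀ x ∈ C.deg n, x ∈ N := by
  rw [pageN, sup_le_iff, sup_le_iff, Submodule.map_le_iff_le_comap, iSup₂_le_iff, and_assoc]
  rfl

/-- The projection to degree p + q fixes `z` and maps `pageN` to homogeneous elements of the
denominator, so the larger submodule cuts out the same elements of F^p_{p+q}. -/
lemma mem_denom_iff (r : ℕ) (pq : ℤ × ℤ) {z : M} (hz : z ∈ filPiece C.deg C.fil pq) :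
    z ∈ C.denom r pq ↔ z ∈ C.pageN r pq := by
  obtain ⟨h1, h2, -⟩ := (C.pageN_le_iff r pq _).1 le_rfl
  constructor
  · intro h
    obtain ⟨y, hy, -, -, f, hf, -, rfl⟩ := mem_denom.1 h
    exact add_mem (h2 y hy) (h1 f hf)
  · intro h
    have key : C.pageN r pq ≤ ((C.fil (pq.1 + r - 1) ⊓ C.deg (pq.1 + pq.2 + 1)).map C.d ⊔
        (C.fil (pq.1 - 1) ⊓ C.deg (pq.1 + pq.2))).comap
          (gradedProj C.isInternal (pq.1 + pq.2)) := by
      refine (C.pageN_le_iff r pq _).2 ⟨fun x hx => ?_, fun x hx => ?_, fun n hn x hx => ?_⟩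
      · exact Submodule.mem_sup_right ⟨C.gradedProj_mem_fil _ _ x hx, gradedProj_mem _ _ _⟩
      · refine Submodule.mem_sup_left ⟨gradedProj C.isInternal (pq.1 + pq.2 + 1) x,
          ⟨C.gradedProj_mem_fil _ _ x hx, gradedProj_mem _ _ _⟩, ?_⟩
        rw [d_gradedProj, add_sub_cancel_right]
      · rw [Submodule.mem_comap, gradedProj_of_mem_ne C.isInternal hn hx]
        exact zero_mem _
    have h3 := key h
    rw [Submodule.mem_comap, gradedProj_of_mem _ hz.2] at h3
    obtain ⟨_, ⟨y, ⟨hy, hy'⟩, rfl⟩, f, ⟨hf, hf'⟩, rfl⟩ := Submodule.mem_sup.1 h3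
    refine mem_denom.2 ⟨y, hy, hy', ?_, f, hf, hf', rfl⟩
    -- That ∂y lies in F^p is automatic, as ∂y is the difference of `z` and `f`.
    have := sub_mem hz.1 (C.fil_mono (by lia) hf)
    rwa [add_sub_cancel_right] at this

/-- The presentation of the `r`-th page by subquotients. -/
def pageData (r : ℕ) : PageData k M (HSpectralSequence.X C.spectralSequence r) where
  Z := C.Z r
  N := C.pageN r
  cls := C.pageCls r
  surj := C.pageCls_surjective r
  cls_eq_zero pq z := (C.pageCls_eq_zero r pq z).trans (C.mem_denom_iff r pq z.2.1)

lemma apply_rep_pageCls {r : ℕ} {i : ℤ × ℤ} {α : M →ₗ[k] k}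
    (hα : α ∈ (C.pageData r).cochains i) (z : C.Z r i) :
    α ((C.pageData r).rep i (DirectSum.lof k _ (HSpectralSequence.X C.spectralSequence r) i
      (C.pageCls r i z))) = α z :=
  (C.pageData r).apply_rep_lof hα z

/-- These are the almost cocycles of the dual filtration: α has filtration p and its coboundary α ∘
∂ has filtration p + r. -/
lemma mem_cochains {r : ℕ} {pq : ℤ × ℤ} {α : M →ₗ[k] k} : α ∈ (C.pageData r).cochains pq ↔
    (∀ x ∈ C.fil (pq.1 - 1), α x = 0) ∧ (∀ x ∈ C.fil (pq.1 + r - 1), α (C.d x) = 0) ∧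
      ∀ n, n ≠ pq.1 + pq.2 → ∀ x ∈ C.deg n, α x = 0 := by
  rw [PageData.mem_cochains]
  exact C.pageN_le_iff r pq (LinearMap.ker α)

lemma cochains_succ_le (r : ℕ) (pq : ℤ × ℤ) :
    (C.pageData (r + 1)).cochains pq ≤ (C.pageData r).cochains pq := by
  intro α hα
  rw [mem_cochains] at hα ⊢
  exact ⟨hα.1, fun x hx => hα.2.1 x (C.fil_mono (by lia) hx), hα.2.2⟩

lemma comp_d_mem_cochains {r : ℕ} {i : ℤ × ℤ} {α : M →ₗ[k] k}
    (hα : α ∈ (C.pageData r).cochains i) :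
    α ∘ₗ C.d ∈ (C.pageData r).cochains (i + ((r : ℤ), 1 - (r : ℤ))) := by
  rw [mem_cochains] at hα ⊢
  refine ⟨fun x hx => hα.2.1 x hx, fun x _ => by simp [C.d_d], fun n hn x hx => ?_⟩
  refine hα.2.2 (n - 1) ?_ _ (C.d_deg n x hx)
  simp only [Prod.fst_add, Prod.snd_add] at hn
  lia

lemma comp_sign_mem_cochains {r : ℕ} {i : ℤ × ℤ} {α : M →ₗ[k] k}
    (hα : α ∈ (C.pageData r).cochains i) : α ∘ₗ C.sign ∈ (C.pageData r).cochains i := by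
  rw [mem_cochains] at hα ⊢
  refine ⟨fun x hx => hα.1 _ (C.sign_mem_fil _ x hx), fun x hx => ?_, fun n hn x hx => ?_⟩
  · rw [LinearMap.comp_apply, sign_d, map_neg, hα.2.1 _ (C.sign_mem_fil _ x hx), neg_zero]
  · rw [LinearMap.comp_apply, C.sign_apply hx, map_zsmul, hα.2.2 n hn x hx, smul_zero]

/-- The transpose of d^r is the coboundary α ↦ α ∘ ∂, of bidegree (r, 1 - r); this is how d^r enters
the duality. -/
lemma apply_rep_D {r : ℕ} {i : ℤ × ℤ} {α : M →ₗ[k] k} (hα : α ∈ (C.pageData r).cochains i)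
    (x : HSpectralSequence.Total C.spectralSequence r) :
    α ((C.pageData r).rep i (HSpectralSequence.D C.spectralSequence r x)) =
      α (C.d ((C.pageData r).rep (i + ((r : ℤ), 1 - (r : ℤ))) x)) := by
  refine lof_induction (k := k) x (fun l v => ?_)
    (fun x y hx hy => by simp only [map_add, hx, hy]) (by simp)
  obtain ⟨z, rfl⟩ := C.pageCls_surjective r l v
  rw [D_pageCls]
  by_cases h : l = i + ((r : ℤ), 1 - (r : ℤ))
  · have h' : l + (-(r : ℤ), (r : ℤ) - 1) = i := by
      rw [h, add_assoc]
      simp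
    rw [← h]
    subst h'
    rw [C.apply_rep_pageCls hα]
    refine (C.apply_rep_pageCls (α := α ∘ₗ C.d) (i := l) ?_ z).symm
    rw [h]
    exact C.comp_d_mem_cochains hα
  · rw [PageData.rep_lof_of_ne _ h, PageData.rep_lof_of_ne, map_zero, map_zero, map_zero]
    rintro rfl
    exact h (by rw [add_assoc]; simp)

lemma apply_rep_sign {r : ℕ} {i : ℤ × ℤ} {α : M →ₗ[k] k} (hα : α ∈ (C.pageData r).cochains i)
    (x : HSpectralSequence.Total C.spectralSequence r) :
    α ((C.pageData r).rep i (HSpectralSequence.sign C.spectralSequence r x)) =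
      α (C.sign ((C.pageData r).rep i x)) := by
  refine lof_induction (k := k) x (fun l v => ?_)
    (fun x y hx hy => by simp only [map_add, hx, hy]) (by simp)
  obtain ⟨z, rfl⟩ := C.pageCls_surjective r l v
  rw [HSpectralSequence.sign, DirectSum.lmap_lof]
  by_cases h : l = i
  · subst h
    refine Eq.trans ?_ (C.apply_rep_pageCls (C.comp_sign_mem_cochains hα) z).symm
    rw [LinearMap.smul_apply, LinearMap.id_apply, map_zsmul, map_zsmul, map_zsmul,
      LinearMap.comp_apply, C.sign_apply (mem_Z.1 z.2).2.1, map_zsmul,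
      C.apply_rep_pageCls hα]
  · rw [PageData.rep_lof_of_ne _ h, PageData.rep_lof_of_ne _ h]
    simp

variable {C} {Δ : M →ₗ[k] M ⊗[k] M} {ε : M →ₗ[k] k}

lemma IsFilteredDGCoalgebra.comul_deg (hC : C.IsFilteredDGCoalgebra Δ ε) (n : ℤ) :
    ∀ x ∈ C.deg n, Δ x ∈ tensorFamily C.deg n := by
  obtain ⟨S, hS, -⟩ := hC.1
  rw [← hS]
  exact S.comul_mem n

lemma IsFilteredDGCoalgebra.counit_deg (hC : C.IsFilteredDGCoalgebra Δ ε) (n : ℤ) (hn : n ≠ 0) :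
    ∀ x ∈ C.deg n, ε x = 0 := by
  obtain ⟨S, -, hS⟩ := hC.1
  rw [← hS]
  exact S.counit_eq_zero n hn

/-- Because Δ is a chain map, the coboundary of a convolution product is (α∂)·β + (αs)·(β∂) with `s`
the sign. Each summand has one factor whose filtration is raised by r, so the product is again an
almost cocycle. The counit lies in bidegree 0 because F^{-1} = 0. -/
lemma IsFilteredDGCoalgebra.dualData (hC : C.IsFilteredDGCoalgebra Δ ε) (h0 : C.fil (-1) = ⊥)
    (r : ℕ) : DualData Δ ε (C.pageData r).cochains (C.pageData r).rep where
  separates := (C.pageData r).separates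
  one_mem := by
    rw [mem_cochains]
    refine ⟨fun x hx => ?_, fun x _ => hC.2.2.1 x, fun n hn x hx => hC.counit_deg n hn x hx⟩
    rw [Prod.fst_zero, zero_sub, h0, Submodule.mem_bot] at hx
    rw [hx, map_zero]
  mul_mem {i j α β} hα hβ := by
    have hα' := C.mem_cochains.1 (C.comp_sign_mem_cochains hα)
    rw [mem_cochains] at hα hβ ⊢
    refine ⟨fun x hx => ?_, fun x hx => ?_, fun n hn x hx => ?_⟩
    · exact form_eq_zero_of_fil C.fil_mono hα.1 hβ.1 (by simp) (hC.2.2.2 _ x hx)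
    · rw [LinearMap.comp_apply, hC.2.1, form_tensorD]
      have hx' := hC.2.2.2 _ x hx
      rw [form_eq_zero_of_fil (a := i.1 + r) (c := j.1) C.fil_mono hα.2.1 hβ.1 (by simp; lia) hx',
        form_eq_zero_of_fil (a := i.1) (c := j.1 + r) C.fil_mono hα'.1 hβ.2.1 (by simp; lia) hx',
        add_zero]
    · refine form_eq_zero_of_deg hα.2.2 hβ.2.2 ?_ (hC.comul_deg n x hx)
      simp only [Prod.fst_add, Prod.snd_add] at hn
      lia

/-- Paired with α and β, the co-Leibniz rule on the page becomes the chain map property of Δ on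
representatives. -/
lemma IsFilteredDGCoalgebra.comul_D (hC : C.IsFilteredDGCoalgebra Δ ε) (h0 : C.fil (-1) = ⊥)
    {r : ℕ} {δ : HSpectralSequence.Total C.spectralSequence r →ₗ[k]
      HSpectralSequence.Total C.spectralSequence r ⊗[k]
        HSpectralSequence.Total C.spectralSequence r}
    (hδ : IsDualComul Δ (C.pageData r).cochains (C.pageData r).rep δ)
    (x : HSpectralSequence.Total C.spectralSequence r) :
    δ (HSpectralSequence.D C.spectralSequence r x) =
      tensorD (HSpectralSequence.sign C.spectralSequence r)
        (HSpectralSequence.D C.spectralSequence r) (δ x) := by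
  refine (hC.dualData h0 r).ext₂ fun i j α hα β hβ => ?_
  have e1 : (α ∘ₗ (C.pageData r).rep i) ∘ₗ HSpectralSequence.D C.spectralSequence r =
      (α ∘ₗ C.d) ∘ₗ (C.pageData r).rep (i + ((r : ℤ), 1 - (r : ℤ))) :=
    LinearMap.ext fun x => C.apply_rep_D hα x
  have e2 : (β ∘ₗ (C.pageData r).rep j) ∘ₗ HSpectralSequence.D C.spectralSequence r =
      (β ∘ₗ C.d) ∘ₗ (C.pageData r).rep (j + ((r : ℤ), 1 - (r : ℤ))) :=
    LinearMap.ext fun x => C.apply_rep_D hβ x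
  have e3 : (α ∘ₗ (C.pageData r).rep i) ∘ₗ HSpectralSequence.sign C.spectralSequence r =
      (α ∘ₗ C.sign) ∘ₗ (C.pageData r).rep i :=
    LinearMap.ext fun x => C.apply_rep_sign hα x
  rw [form_tensorD, e1, e2, e3, hδ i j α hα β hβ,
    hδ _ j _ (C.comp_d_mem_cochains hα) β hβ,
    hδ i _ _ (C.comp_sign_mem_cochains hα) _ (C.comp_d_mem_cochains hβ)]
  have h1 := C.apply_rep_D ((hC.dualData h0 r).mul_mem hα hβ) x
  simp only [LinearMap.comp_apply] at h1
  rw [h1, hC.2.1, form_tensorD, ← add_assoc i j, add_right_comm i j]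

/-- A cycle of E^r and its class in E^{r+1} are represented by the same element of Z^{r+1}. -/
lemma apply_rep_clsCycles {r : ℕ} {i : ℤ × ℤ} {α : M →ₗ[k] k}
    (hα : α ∈ (C.pageData (r + 1)).cochains i)
    (c : HSpectralSequence.Cycles C.spectralSequence r) :
    α ((C.pageData (r + 1)).rep i (HSpectralSequence.clsCycles C.spectralSequence r c)) =
      α ((C.pageData r).rep i (HSpectralSequence.incCycles C.spectralSequence r c)) := by
  refine lof_induction (k := k) c (fun l c => ?_)
    (fun x y hx hy => by simp only [map_add, hx, hy]) (by simp)
  rw [HSpectralSequence.clsCycles, HSpectralSequence.incCycles, DirectSum.lmap_lof,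
    DirectSum.lmap_lof]
  by_cases h : l = i
  · subst h
    obtain ⟨z, hz⟩ := C.exists_rep_cycles r l c
    rw [C.toNext_apply r l c z hz, hz, C.apply_rep_pageCls hα,
      C.apply_rep_pageCls (C.cochains_succ_le r l hα)]
    rfl
  · rw [PageData.rep_lof_of_ne _ h, PageData.rep_lof_of_ne _ h]

lemma clsCycles_surjective (r : ℕ) :
    Function.Surjective (HSpectralSequence.clsCycles C.spectralSequence r) := by
  refine (DirectSum.lmap_surjective _).2 fun l v => ?_
  obtain ⟨z, rfl⟩ := C.pageCls_surjective (r + 1) l v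
  obtain ⟨c, hc⟩ := C.exists_cycles r l z
  exact ⟨c, C.toNext_apply r l c z hc⟩

lemma D_D (r : ℕ) (x : HSpectralSequence.Total C.spectralSequence r) :
    HSpectralSequence.D C.spectralSequence r (HSpectralSequence.D C.spectralSequence r x) = 0 := by
  refine lof_induction (k := k) x (fun l v => ?_)
    (fun x y hx hy => by simp only [map_add, hx, hy, add_zero]) (by simp)
  obtain ⟨z, rfl⟩ := C.pageCls_surjective r l v
  rw [D_pageCls, D_pageCls]
  have : (⟨C.d (C.d z), C.d_mem_Z (C.d_mem_Z z.2)⟩ : C.Z r _) = 0 := Subtype.ext (C.d_d z)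
  rw [this, map_zero, map_zero]

lemma D_lof (r : ℕ) (l : ℤ × ℤ) (v : HSpectralSequence.X C.spectralSequence r l) :
    HSpectralSequence.D C.spectralSequence r
        (DirectSum.lof k _ (HSpectralSequence.X C.spectralSequence r) l v) =
      DirectSum.lof k _ (HSpectralSequence.X C.spectralSequence r) (l + (-(r : ℤ), (r : ℤ) - 1))
        (((C.spectralSequence.page (r : ℤ)).d l (l + (-(r : ℤ), (r : ℤ) - 1))).hom v) :=
  DirectSum.toModule_lof k l v

/-- The differential shifts bidegrees uniformly, so the components of a cycle of the total module
are themselves cycles. -/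
lemma mem_range_incCycles (r : ℕ) (x : HSpectralSequence.Total C.spectralSequence r)
    (hx : HSpectralSequence.D C.spectralSequence r x = 0) :
    x ∈ LinearMap.range (HSpectralSequence.incCycles C.spectralSequence r) := by
  have hA := isInternal_component k (HSpectralSequence.X C.spectralSequence r)
  have hD : ∀ i x, HSpectralSequence.D C.spectralSequence r (gradedProj hA i x) =
      gradedProj hA (i + (-(r : ℤ), (r : ℤ) - 1)) (HSpectralSequence.D C.spectralSequence r x) := by
    intro i x
    refine lof_induction (k := k) x (fun l v => ?_)
      (fun x y hx hy => by simp only [map_add, hx, hy]) (by simp)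
    by_cases h : l = i
    · subst h
      rw [gradedProj_of_mem hA (lof_mem_component l v), D_lof,
        gradedProj_of_mem hA (lof_mem_component _ _)]
    · rw [gradedProj_of_mem_ne hA h (lof_mem_component l v), D_lof,
        gradedProj_of_mem_ne hA (fun e => h (add_right_cancel e)) (lof_mem_component _ _), map_zero]
  obtain ⟨s, hs⟩ := (eventually_sum_gradedProj hA x).exists
  rw [← hs]
  refine sum_mem fun i _ => ?_
  have h1 := hD i x
  rw [hx, map_zero] at h1
  obtain ⟨v, hv⟩ := gradedProj_mem hA i x
  rw [← hv, D_lof] at h1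
  have h2 := congrArg (DirectSum.component k _ (HSpectralSequence.X C.spectralSequence r)
    (i + (-(r : ℤ), (r : ℤ) - 1))) h1
  rw [DirectSum.component.lof_self, map_zero] at h2
  obtain ⟨z, rfl⟩ := C.exists_Z_succ_of_d_eq_zero r i v h2
  obtain ⟨c, hc⟩ := C.exists_cycles r i z
  refine ⟨DirectSum.lof k _ _ i c, ?_⟩
  rw [← hv, HSpectralSequence.incCycles, DirectSum.lmap_lof, hc]

/-- The Künneth theorem for the pages of the spectral sequence. -/
lemma exists_cycles_tensor (r : ℕ)
    (u : HSpectralSequence.Total C.spectralSequence r ⊗[k]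
      HSpectralSequence.Total C.spectralSequence r)
    (hu : tensorD (HSpectralSequence.sign C.spectralSequence r)
      (HSpectralSequence.D C.spectralSequence r) u = 0) :
    ∃ w : HSpectralSequence.Cycles C.spectralSequence r ⊗[k]
        HSpectralSequence.Cycles C.spectralSequence r,
      u - TensorProduct.map (HSpectralSequence.incCycles C.spectralSequence r)
        (HSpectralSequence.incCycles C.spectralSequence r) w ∈
          LinearMap.range (tensorD (HSpectralSequence.sign C.spectralSequence r)
            (HSpectralSequence.D C.spectralSequence r)) := by
  have hA := isInternal_component k (HSpectralSequence.X C.spectralSequence r)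
  let χ : ℤ × ℤ → k := fun i => (((i.1 + i.2).negOnePow : ℤ) : k)
  have hχ : ∀ i, χ (i + (-(r : ℤ), (r : ℤ) - 1)) = - χ i := by
    intro i
    have : (i + (-(r : ℤ), (r : ℤ) - 1)).1 + (i + (-(r : ℤ), (r : ℤ) - 1)).2 = i.1 + i.2 - 1 := by
      simp only [Prod.fst_add, Prod.snd_add]; ring
    simp only [χ, this, Int.negOnePow_sub, Int.negOnePow_one]
    simp
  have hχ' : ∀ i, χ i * χ i = 1 := by
    intro i
    simp only [χ, ← Int.cast_mul, ← Units.val_mul, Int.units_mul_self]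
    simp
  have hd : ∀ i, ∀ x ∈ component (k := k) (V := HSpectralSequence.X C.spectralSequence r) i,
      HSpectralSequence.D C.spectralSequence r x ∈
        component (k := k) (V := HSpectralSequence.X C.spectralSequence r)
          (i + (-(r : ℤ), (r : ℤ) - 1)) := by
    rintro i _ ⟨v, rfl⟩
    rw [D_lof]
    exact lof_mem_component _ _
  have hs : ∀ i, ∀ x ∈ component (k := k) (V := HSpectralSequence.X C.spectralSequence r) i,
      HSpectralSequence.sign C.spectralSequence r x = χ i • x := by
    rintro i _ ⟨v, rfl⟩
    rw [HSpectralSequence.sign, DirectSum.lmap_lof, ← map_smul, LinearMap.smul_apply,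
      LinearMap.id_apply, Int.cast_smul_eq_zsmul]
  obtain ⟨h, hdh, hsh⟩ := exists_graded_homotopy hA _ _ _ χ hd hs hχ
  refine exists_map_inc_sub_mem_range _ _ h (fun x => ?_) (fun x => ?_) (D_D r) hdh hsh _
    (mem_range_incCycles r) u hu
  · refine grading_induction hA x (fun i x hx => ?_) (by simp)
      fun x y hx hy => by rw [map_add, map_add, hx, hy]
    rw [hs i x hx, map_smul, hs i x hx, smul_smul, hχ', one_smul]
  · refine grading_induction hA x (fun i x hx => ?_) (by simp)
      fun x y hx hy => by simp only [map_add, hx, hy, neg_add]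
    rw [hs i x hx, map_smul, hs _ _ (hd i x hx), hχ, neg_smul]

lemma pageData_zero_compatible :
    (C.pageData 0).GrCompatible C.deg C.fil (V := HSpectralSequence.X C.spectralSequence 0)
      C.toPageZero where
  mono := C.fil_mono
  apply_rep {i α} hα z := C.apply_rep_pageCls hα
    ⟨z, mem_Z.2 ⟨z.2.1, z.2.2, by simpa using C.d_fil _ _ z.2.1⟩⟩
  fil_le i := ((C.pageN_le_iff 0 i _).1 le_rfl).1
  deg_le i n hn := ((C.pageN_le_iff 0 i _).1 le_rfl).2.2 n hn

lemma toPageZero_surjective (pq : ℤ × ℤ) : Function.Surjective (C.toPageZero pq) := by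
  intro v
  obtain ⟨z, rfl⟩ := Submodule.Quotient.mk_surjective _ v
  exact ⟨⟨z, (mem_Z.1 z.2).1, (mem_Z.1 z.2).2.1⟩, rfl⟩

lemma IsFilteredDGCoalgebra.exists_lift (hC : C.IsFilteredDGCoalgebra Δ ε) (pq : ℤ × ℤ)
    (z : ↥(filPiece C.deg C.fil pq)) : ∃ w ∈ tensorFamily component pq,
      TensorProduct.map (incFil C.deg C.fil) (incFil C.deg C.fil) w = Δ z :=
  exists_lift_tensorFamily C.isInternal C.gradedProj_mem_fil (hC.2.2.2 _ _ z.2.1)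
    (hC.comul_deg _ _ z.2.2)

/-- The spectral sequence of a filtered differential graded coalgebra is a spectral sequence of
coalgebras. -/
lemma IsFilteredDGCoalgebra.exists_coalgebraStructure (hC : C.IsFilteredDGCoalgebra Δ ε)
    (h0 : C.fil (-1) = ⊥) :
    ∃ A : HSpectralSequence.CoalgebraStructure C.spectralSequence,
      C.IsInducedCoalgebraStructure Δ ε A ∧
      ∀ r, IsDualComul Δ (C.pageData r).cochains (C.pageData r).rep (A.coalg r).comul ∧
        ∀ x, (A.coalg r).counit x = ε ((C.pageData r).rep 0 x) := by
  -- Cochains of page r + 1 annihilate the image of d^r: they vanish on ∂F^{p+r}, and F^{p+r}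
  -- contains the representatives at the source of d^r. Cochains of page r are only known to vanish
  -- on ∂F^{p+r-1}.
  have hd : ∀ (r : ℕ) (i : ℤ × ℤ), ∀ α ∈ (C.pageData (r + 1)).cochains i, ∀ x,
      α ((C.pageData r).rep i (HSpectralSequence.D C.spectralSequence r x)) = 0 := by
    intro r i α hα x
    rw [C.apply_rep_D (C.cochains_succ_le r i hα)]
    refine (C.mem_cochains.1 hα).2.1 _ ?_
    refine C.fil_mono ?_ (mem_Z.1 (Subtype.property (p := (· ∈ C.Z r (i + ((r : ℤ), 1 - (r : ℤ)))))
      _)).1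
    simp only [Prod.fst_add]
    push_cast
    lia
  have hex : ∀ (r : ℕ) δ, IsDualComul Δ (C.pageData r).cochains (C.pageData r).rep δ →
      ∀ z : HSpectralSequence.Cycles C.spectralSequence r,
      ∃ w : HSpectralSequence.Cycles C.spectralSequence r ⊗[k]
        HSpectralSequence.Cycles C.spectralSequence r,
      δ (HSpectralSequence.incCycles C.spectralSequence r z) -
        TensorProduct.map (HSpectralSequence.incCycles C.spectralSequence r)
        (HSpectralSequence.incCycles C.spectralSequence r) w ∈
          LinearMap.range (tensorD (HSpectralSequence.sign C.spectralSequence r)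
            (HSpectralSequence.D C.spectralSequence r)) := by
    intro r δ hδ z
    refine exists_cycles_tensor r _ ?_
    rw [← hC.comul_D h0 hδ]
    have : HSpectralSequence.D C.spectralSequence r
        (HSpectralSequence.incCycles C.spectralSequence r z) = 0 := by
      refine lof_induction (k := k) z (fun l c => ?_)
        (fun x y hx hy => by rw [map_add, map_add, hx, hy, add_zero]) (by simp)
      rw [HSpectralSequence.incCycles, DirectSum.lmap_lof, D_lof]
      have := (C.spectralSequence.page (r : ℤ)).iCycles_d l (l + (-(r : ℤ), (r : ℤ) - 1))
      have h2 := LinearMap.congr_fun (congrArg ModuleCat.Hom.hom this) c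
      exact (congrArg _ h2).trans (map_zero _)
    rw [this, map_zero]
  -- Each comultiplication is determined by its duality property, so the independent choices made
  -- here for different r are automatically compatible.
  have key : ∀ r, ∃ δ, IsDualComul Δ (C.pageData r).cochains (C.pageData r).rep δ := by
    intro r
    induction r with
    | zero =>
      exact (pageData_zero_compatible (C := C)).exists_isDualComul toPageZero_surjective
        (hC.dualData h0 0) hC.exists_lift
    | succ r ih =>
      obtain ⟨δ, hδ⟩ := ih
      exact exists_isDualComul_homology hδ (hC.dualData h0 (r + 1)) (C.cochains_succ_le r)
        (fun i α hα z => apply_rep_clsCycles hα z) (hd r) (clsCycles_surjective r) (hex r δ hδ)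
  choose δ hδ using key
  obtain ⟨S, hS, hS'⟩ := hC.1
  subst hS hS'
  refine ⟨{ coalg := fun r => PageData.gradedCoalgebra S.toCoalgebra (hC.dualData h0 r) (hδ r)
            coLeibniz := fun r x => hC.comul_D h0 (hδ r) x
            comul_succ := fun r => (hδ r).inducesOnHomology (hC.dualData h0 (r + 1))
              (C.cochains_succ_le r) (fun i α hα z => apply_rep_clsCycles hα z) (hd r)
              (hex r _ (hδ r)) (hδ (r + 1))
            counit_succ := fun r z => apply_rep_clsCycles (hC.dualData h0 (r + 1)).one_mem z },
    ⟨?_, ?_⟩, fun r => ⟨hδ r, fun x => rfl⟩⟩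
  · exact pageData_zero_compatible.inducesOnGr (hC.dualData h0 0) hC.exists_lift (hδ 0)
  · exact pageData_zero_compatible.apply_rep (hC.dualData h0 0).one_mem

end Pages

end FilteredDGModule

end SerreSS

end

/-! ### Associated bigraded coalgebras and extension of functionals -/

noncomputable section

namespace SerreSS

/-- A filtered graded coalgebra induces a bigraded coalgebra structure on the associated bigraded
module. -/
lemma GradedCoalgebra.exists_isGrCoalgebra {k : Type v} [Field k] {H : Type w} [AddCommGroup H]
    [Module k H] {deg fil : ℤ → Submodule k H} (S : GradedCoalgebra k H deg)
    (hS : S.IsFiltered fil) (hmono : Monotone fil) (hdeg : DirectSum.IsInternal deg)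
    (hfil : ∀ p n, ∀ x ∈ fil p, gradedProj hdeg n x ∈ fil p) :
    ∃ G : GradedCoalgebra k (⨁ pq, Gr deg fil pq) (component (V := Gr deg fil)),
      S.IsGrCoalgebra fil G ∧
      IsDualComul S.comul (grPageData deg fil hdeg hfil).cochains
        (grPageData deg fil hdeg hfil).rep G.comul ∧
      ∀ x, G.counit x = S.counit ((grPageData deg fil hdeg hfil).rep 0 x) := by
  have h : DualData S.comul S.counit (grPageData deg fil hdeg hfil).cochains
      (grPageData deg fil hdeg hfil).rep :=
    { separates := (grPageData deg fil hdeg hfil).separates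
      one_mem := by
        rw [mem_cochains_grPageData]
        exact ⟨hS.2 _ (by simp), fun n hn => S.counit_eq_zero n (by simpa using hn)⟩
      mul_mem := by
        intro i j α β hα hβ
        rw [mem_cochains_grPageData] at hα hβ ⊢
        refine ⟨fun x hx => ?_, fun n hn x hx => ?_⟩
        · exact form_eq_zero_of_fil hmono hα.1 hβ.1 (by simp) (hS.1 _ x hx)
        · refine form_eq_zero_of_deg hα.2 hβ.2 ?_ (S.comul_mem n x hx)
          simp only [Prod.fst_add, Prod.snd_add] at hn
          lia }
  have hP := grPageData_compatible hmono hdeg hfil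
  have hex : ∀ pq, ∀ z : ↥(filPiece deg fil pq), ∃ w ∈ tensorFamily component pq,
      TensorProduct.map (incFil deg fil) (incFil deg fil) w = S.comul z := fun pq z =>
    exists_lift_tensorFamily hdeg hfil (hS.1 _ _ z.2.1) (S.comul_mem _ _ z.2.2)
  obtain ⟨δ, hδ⟩ := hP.exists_isDualComul (fun _ => Submodule.mkQ_surjective _) h hex
  exact ⟨PageData.gradedCoalgebra S.toCoalgebra h hδ, ⟨hP.inducesOnGr h hex hδ,
    hP.apply_rep h.one_mem⟩, hδ, fun x => rfl⟩

/-- By `hf` the functional factors through the image of `K` in `M ⧸ F`; a generalized inverse `g` of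
K → M ⧸ F extends it, since g of the class of x differs from x by an element of `F`. -/
lemma exists_extension {k : Type v} [Field k] {M : Type*} [AddCommGroup M] [Module k M]
    (K F : Submodule k M) (f : K →ₗ[k] k) (hf : ∀ x : K, (x : M) ∈ F → f x = 0) :
    ∃ α : M →ₗ[k] k, (∀ x ∈ F, α x = 0) ∧ ∀ x : K, α x = f x := by
  obtain ⟨g, hg⟩ := exists_generalized_inverse (F.mkQ ∘ₗ K.subtype)
  refine ⟨f ∘ₗ g ∘ₗ F.mkQ, fun x hx => ?_, fun x => ?_⟩
  · have : F.mkQ x = 0 := (Submodule.Quotient.mk_eq_zero _).2 hx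
    simp only [LinearMap.comp_apply, this, map_zero]
  · rw [← sub_eq_zero]
    refine (map_sub f (g (F.mkQ x)) x).symm.trans (hf _ ?_)
    refine (Submodule.Quotient.mk_eq_zero _).1 ?_
    have := hg x
    rw [← sub_eq_zero, ← map_sub] at this
    exact this

namespace FilteredDGModule

/-! ### The homology coalgebra -/

section Homology

variable {k : Type v} [Field k] {M : Type w} [AddCommGroup M] [Module k M]
  (C : FilteredDGModule k M)

lemma mem_homologyImage {N : Submodule k M} {x : C.Homology} : x ∈ C.homologyImage N ↔
    ∃ z : LinearMap.ker C.d, (z : M) ∈ N ∧ C.toHomology z = x := Iff.rfl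

lemma toHomology_surjective : Function.Surjective C.toHomology := Submodule.mkQ_surjective _

lemma toHomology_eq_zero (z : LinearMap.ker C.d) :
    C.toHomology z = 0 ↔ (z : M) ∈ LinearMap.range C.d := Submodule.Quotient.mk_eq_zero _

lemma gradedProj_mem_ker (n : ℤ) {x : M} (hx : x ∈ LinearMap.ker C.d) :
    gradedProj C.isInternal n x ∈ LinearMap.ker C.d := by
  rw [LinearMap.mem_ker, d_gradedProj, LinearMap.mem_ker.1 hx, map_zero]

/-- The projection of the homology to its component of degree `n`. -/
def homologyProj (n : ℤ) : C.Homology →ₗ[k] C.Homology :=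
  Submodule.mapQ _ _ ((gradedProj C.isInternal n).restrict
    (p := LinearMap.ker C.d) (q := LinearMap.ker C.d) fun _ hx => C.gradedProj_mem_ker n hx) (by
      rintro ⟨_, h⟩ ⟨y, rfl⟩
      exact ⟨gradedProj C.isInternal (n + 1) y, by
        rw [d_gradedProj, add_sub_cancel_right]; rfl⟩)

lemma homologyProj_toHomology (n : ℤ) (z : LinearMap.ker C.d) :
    C.homologyProj n (C.toHomology z) =
      C.toHomology ⟨gradedProj C.isInternal n z, C.gradedProj_mem_ker n z.2⟩ := rfl

lemma homologyProj_of_mem {n : ℤ} {x : C.Homology} (hx : x ∈ C.homologyDeg n) :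
    C.homologyProj n x = x := by
  obtain ⟨z, hz, rfl⟩ := C.mem_homologyImage.1 hx
  rw [homologyProj_toHomology]
  congr 1
  exact Subtype.ext (gradedProj_of_mem C.isInternal hz)

lemma homologyProj_of_mem_ne {n m : ℤ} (h : m ≠ n) {x : C.Homology} (hx : x ∈ C.homologyDeg m) :
    C.homologyProj n x = 0 := by
  obtain ⟨z, hz, rfl⟩ := C.mem_homologyImage.1 hx
  rw [homologyProj_toHomology, toHomology_eq_zero]
  change gradedProj C.isInternal n (z : M) ∈ _
  rw [gradedProj_of_mem_ne C.isInternal h hz]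
  exact zero_mem _

lemma isInternal_homologyDeg : DirectSum.IsInternal C.homologyDeg := by
  refine DirectSum.isInternal_submodule_of_iSupIndep_of_iSup_eq_top ?_ ?_
  · intro n
    rw [Submodule.disjoint_def]
    intro x hx hx'
    have h : (⨆ m, ⨆ (_ : m ≠ n), C.homologyDeg m) ≤ LinearMap.ker (C.homologyProj n) :=
      iSup₂_le fun m hm y hy => C.homologyProj_of_mem_ne hm hy
    rw [← C.homologyProj_of_mem hx]
    exact h hx'
  · rw [eq_top_iff]
    rintro x -
    obtain ⟨z, rfl⟩ := C.toHomology_surjective x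
    obtain ⟨s, hs⟩ := (eventually_sum_gradedProj C.isInternal (z : M)).exists
    have e : z = ∑ n ∈ s, (⟨gradedProj C.isInternal n z, C.gradedProj_mem_ker n z.2⟩ :
        LinearMap.ker C.d) := Subtype.ext (by rw [Submodule.coe_sum]; exact hs.symm)
    rw [e, map_sum]
    refine sum_mem fun n _ => Submodule.mem_iSup_of_mem n ?_
    exact C.mem_homologyImage.2 ⟨_, gradedProj_mem _ _ _, rfl⟩

lemma gradedProj_homology (n : ℤ) (x : C.Homology) :
    gradedProj C.isInternal_homologyDeg n x = C.homologyProj n x := by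
  refine grading_induction C.isInternal_homologyDeg x (fun m x hx => ?_) (by simp)
    fun x y hx hy => by rw [map_add, map_add, hx, hy]
  by_cases h : m = n
  · subst h
    rw [gradedProj_of_mem _ hx, C.homologyProj_of_mem hx]
  · rw [gradedProj_of_mem_ne _ h hx, C.homologyProj_of_mem_ne h hx]

lemma gradedProj_mem_homologyFil (p n : ℤ) :
    ∀ x ∈ C.homologyFil p, gradedProj C.isInternal_homologyDeg n x ∈ C.homologyFil p := by
  intro x hx
  obtain ⟨z, hz, rfl⟩ := C.mem_homologyImage.1 hx
  rw [gradedProj_homology, homologyProj_toHomology]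
  exact C.mem_homologyImage.2 ⟨_, C.gradedProj_mem_fil p n _ hz, rfl⟩

lemma homologyFil_mono : Monotone C.homologyFil := by
  intro p q h x hx
  obtain ⟨z, hz, rfl⟩ := C.mem_homologyImage.1 hx
  exact C.mem_homologyImage.2 ⟨z, C.fil_mono h hz, rfl⟩

/-- The functionals on `M` which vanish on the boundaries. -/
def cocycles (_ : PUnit.{1}) : Submodule k (M →ₗ[k] k) := (LinearMap.range C.d).dualAnnihilator

variable {C} in
lemma mem_cocycles {i : PUnit.{1}} {α : M →ₗ[k] k} :
    α ∈ C.cocycles i ↔ ∀ x, α (C.d x) = 0 := by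
  rw [cocycles, Submodule.mem_dualAnnihilator]
  exact ⟨fun h x => h _ ⟨x, rfl⟩, by rintro h _ ⟨x, rfl⟩; exact h x⟩

lemma exists_homology_section : ∃ s : C.Homology →ₗ[k] LinearMap.ker C.d,
    ∀ x, C.toHomology (s x) = x := by
  obtain ⟨s, hs⟩ := LinearMap.exists_rightInverse_of_surjective C.toHomology
    (LinearMap.range_eq_top.2 C.toHomology_surjective)
  exact ⟨s, LinearMap.congr_fun hs⟩

/-- Cycles which represent the homology classes. -/
def homologyRep (_ : PUnit.{1}) : C.Homology →ₗ[k] M :=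
  (LinearMap.ker C.d).subtype ∘ₗ C.exists_homology_section.choose

lemma apply_homologyRep {α : M →ₗ[k] k} (hα : ∀ x, α (C.d x) = 0) (i : PUnit)
    (z : LinearMap.ker C.d) : α (C.homologyRep i (C.toHomology z)) = α z := by
  rw [← sub_eq_zero, ← map_sub]
  have h : C.toHomology (C.exists_homology_section.choose (C.toHomology z) - z) = 0 := by
    rw [map_sub, C.exists_homology_section.choose_spec, sub_self]
  obtain ⟨y, hy⟩ := (C.toHomology_eq_zero _).1 h
  have hy' : C.d y = C.homologyRep i (C.toHomology z) - z := hy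
  rw [← hy', hα]

variable {C} {Δ : M →ₗ[k] M ⊗[k] M} {ε : M →ₗ[k] k}

lemma exists_ker_tensor (u : M ⊗[k] M) (hu : tensorD C.sign C.d u = 0) :
    ∃ w : LinearMap.ker C.d ⊗[k] LinearMap.ker C.d,
      u - TensorProduct.map (LinearMap.ker C.d).subtype (LinearMap.ker C.d).subtype w ∈
        LinearMap.range (tensorD C.sign C.d) := by
  let χ : ℤ → k := fun n => ((n.negOnePow : ℤ) : k)
  obtain ⟨h, hdh, hsh⟩ := exists_graded_homotopy C.isInternal C.sign C.d (-1) χ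
    (fun n x hx => C.d_deg n x hx)
    (fun n x hx => by rw [C.sign_apply hx, Int.cast_smul_eq_zsmul])
    (fun n => by
      simp only [χ, ← sub_eq_add_neg, Int.negOnePow_sub, Int.negOnePow_one]
      simp)
  exact exists_map_inc_sub_mem_range _ _ h C.sign_sign C.sign_d C.d_d hdh hsh _
    (fun x hx => ⟨⟨x, hx⟩, rfl⟩) u hu

/-- The one-point index type forgets the grading; degrees on the homology are checked separately.
Cocycles are closed under convolution because Δ is a chain map, and they separate homology classes
because a cycle killed by all of them is a boundary. -/
lemma IsFilteredDGCoalgebra.dualData_homology (hC : C.IsFilteredDGCoalgebra Δ ε) :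
    DualData Δ ε C.cocycles C.homologyRep where
  separates := by
    intro x hx
    obtain ⟨z, rfl⟩ := C.toHomology_surjective x
    rw [toHomology_eq_zero]
    refine (Subspace.forall_mem_dualAnnihilator_apply_eq_zero_iff _ _).1 fun α hα => ?_
    rw [← C.apply_homologyRep ((mem_cocycles (i := PUnit.unit)).1 hα) ⟨⟩]
    exact hx _ ⟨⟨⟩, α, hα, rfl⟩
  one_mem := mem_cocycles.2 hC.2.2.1
  mul_mem {i j α β} hα hβ := by
    have h1 : α ∘ₗ C.d = 0 := LinearMap.ext (mem_cocycles.1 hα)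
    have h2 : β ∘ₗ C.d = 0 := LinearMap.ext (mem_cocycles.1 hβ)
    refine mem_cocycles.2 fun x => ?_
    rw [LinearMap.comp_apply, hC.2.1, form_tensorD, h1, h2]
    simp

/-- Functionals on the homology are represented by functionals on `M`. -/
lemma exists_cocycle (a : C.Homology →ₗ[k] k) (F : Submodule k M)
    (ha : ∀ x ∈ C.homologyImage F, a x = 0) :
    ∃ α : M →ₗ[k] k, (∀ x ∈ F, α x = 0) ∧ (∀ x, α (C.d x) = 0) ∧
      ∀ z : LinearMap.ker C.d, α z = a (C.toHomology z) := by
  -- The pullback of `a` to the cycles is extended by zero on `F`. The extension is a cocycle for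
  -- free, because boundaries are cycles with zero class.
  obtain ⟨α, h1, h2⟩ := exists_extension (LinearMap.ker C.d) F (a ∘ₗ C.toHomology)
    fun x hx => ha _ (C.mem_homologyImage.2 ⟨x, hx, rfl⟩)
  refine ⟨α, h1, fun x => ?_, h2⟩
  have h3 : C.d x ∈ LinearMap.ker C.d := C.d_d x
  refine (h2 ⟨_, h3⟩).trans ?_
  rw [LinearMap.comp_apply, (C.toHomology_eq_zero _).2 ⟨x, rfl⟩, map_zero]

/-- The homology of a filtered differential graded coalgebra is a filtered graded coalgebra. -/
lemma IsFilteredDGCoalgebra.exists_homologyCoalgebra (hC : C.IsFilteredDGCoalgebra Δ ε) :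
    ∃ S : GradedCoalgebra k C.Homology C.homologyDeg, C.IsHomologyCoalgebra Δ ε S ∧
      ∀ (a b : C.Homology →ₗ[k] k) (α β : M →ₗ[k] k), (∀ x, α (C.d x) = 0) →
        (∀ x, β (C.d x) = 0) → (∀ z : LinearMap.ker C.d, α z = a (C.toHomology z)) →
        (∀ z : LinearMap.ker C.d, β z = b (C.toHomology z)) →
        ∀ z, form a b (S.comul (C.toHomology z)) = form α β (Δ z) := by
  have h := hC.dualData_homology
  -- Δ is dual to convolution on all functionals, so the passage from a page to the next applies
  -- verbatim to the passage from `M` to its homology.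
  have hΔ : IsDualComul Δ (fun _ : PUnit.{1} => (⊤ : Submodule k (M →ₗ[k] k)))
      (fun _ => LinearMap.id) Δ := fun _ _ _ _ _ _ x => rfl
  have hcls : ∀ i, ∀ α ∈ C.cocycles i, ∀ z, α (C.homologyRep i (C.toHomology z)) = α z :=
    fun i α hα z => C.apply_homologyRep (mem_cocycles.1 hα) i z
  have hd : ∀ i, ∀ α ∈ C.cocycles i, ∀ x, α (C.d x) = 0 := fun i α hα => mem_cocycles.1 hα
  have hex : ∀ z : LinearMap.ker C.d, ∃ w : LinearMap.ker C.d ⊗[k] LinearMap.ker C.d,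
      Δ z - TensorProduct.map (LinearMap.ker C.d).subtype (LinearMap.ker C.d).subtype w ∈
        LinearMap.range (tensorD C.sign C.d) := fun z =>
    exists_ker_tensor _ (by rw [← hC.2.1, z.2, map_zero])
  obtain ⟨δ, hδ⟩ := exists_isDualComul_homology (inc := (LinearMap.ker C.d).subtype) hΔ h
    (fun _ => le_top) hcls hd C.toHomology_surjective hex
  -- Pairings on the homology may be computed with arbitrary cocycles inducing `a` and `b`, which
  -- leaves room to impose filtration or degree conditions.
  have hform : ∀ (a b : C.Homology →ₗ[k] k) (α β : M →ₗ[k] k), (∀ x, α (C.d x) = 0) →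
      (∀ x, β (C.d x) = 0) → (∀ z : LinearMap.ker C.d, α z = a (C.toHomology z)) →
      (∀ z : LinearMap.ker C.d, β z = b (C.toHomology z)) →
      ∀ z, form a b (δ (C.toHomology z)) = form α β (Δ z) := by
    intro a b α β hα hβ ha hb z
    have ea : a = α ∘ₗ C.homologyRep ⟨⟩ := by
      refine LinearMap.ext fun x => ?_
      obtain ⟨z, rfl⟩ := C.toHomology_surjective x
      rw [LinearMap.comp_apply, C.apply_homologyRep hα, ha]
    have eb : b = β ∘ₗ C.homologyRep ⟨⟩ := by
      refine LinearMap.ext fun x => ?_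
      obtain ⟨z, rfl⟩ := C.toHomology_surjective x
      rw [LinearMap.comp_apply, C.apply_homologyRep hβ, hb]
    have hα' : α ∈ C.cocycles ⟨⟩ := mem_cocycles.2 hα
    have hβ' : β ∈ C.cocycles ⟨⟩ := mem_cocycles.2 hβ
    rw [ea, eb, hδ _ _ α hα' β hβ']
    exact C.apply_homologyRep (mem_cocycles.1 (h.mul_mem hα' hβ')) _ z
  have hcomul : ∀ n, ∀ x ∈ C.homologyDeg n, δ x ∈ tensorFamily C.homologyDeg n := by
    intro n x hx
    obtain ⟨z, hz, rfl⟩ := C.mem_homologyImage.1 hx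
    refine mem_tensorFamily_of_forms C.isInternal_homologyDeg fun i j hij a b => ?_
    obtain ⟨α, -, hα, ha⟩ := exists_cocycle a ⊥ (by
      intro x hx
      obtain ⟨z, hz, rfl⟩ := C.mem_homologyImage.1 hx
      rw [(C.toHomology_eq_zero z).2 (by rw [(Submodule.mem_bot k).1 hz]; exact zero_mem _),
        map_zero])
    obtain ⟨β, -, hβ, hb⟩ := exists_cocycle b ⊥ (by
      intro x hx
      obtain ⟨z, hz, rfl⟩ := C.mem_homologyImage.1 hx
      rw [(C.toHomology_eq_zero z).2 (by rw [(Submodule.mem_bot k).1 hz]; exact zero_mem _),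
        map_zero])
    have hproj : ∀ (a : C.Homology →ₗ[k] k) (α : M →ₗ[k] k), (∀ x, α (C.d x) = 0) →
        (∀ z : LinearMap.ker C.d, α z = a (C.toHomology z)) → ∀ i : ℤ,
        (∀ x, (α ∘ₗ gradedProj C.isInternal i) (C.d x) = 0) ∧
        ∀ z : LinearMap.ker C.d, (α ∘ₗ gradedProj C.isInternal i) z =
          (a ∘ₗ gradedProj C.isInternal_homologyDeg i) (C.toHomology z) := by
      intro a α hα ha i
      refine ⟨fun x => ?_, fun z => ?_⟩
      · have := C.d_gradedProj (i + 1) x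
        rw [add_sub_cancel_right] at this
        rw [LinearMap.comp_apply, ← this, hα]
      · rw [LinearMap.comp_apply, LinearMap.comp_apply, gradedProj_homology,
          homologyProj_toHomology]
        exact ha ⟨_, _⟩
    obtain ⟨hα1, hα2⟩ := hproj a α hα ha i
    obtain ⟨hβ1, hβ2⟩ := hproj b β hβ hb j
    rw [hform _ _ _ _ hα1 hβ1 hα2 hβ2]
    exact form_gradedProj_of_mem_tensorFamily C.isInternal hij α β (hC.comul_deg n _ hz)
  obtain ⟨S, hS, hS'⟩ := id hC.1
  subst hS hS'
  have hcounit : ∀ z, S.counit (C.homologyRep 0 (C.toHomology z)) = S.counit z :=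
    C.apply_homologyRep hC.2.2.1 0
  refine ⟨{ toCoalgebra := h.coalgebra S.toCoalgebra hδ
            comul_mem := hcomul
            counit_eq_zero := ?_ }, ⟨?_, hcounit⟩, hform⟩
  · intro n hn x hx
    obtain ⟨z, hz, rfl⟩ := C.mem_homologyImage.1 hx
    exact (hcounit z).trans (hC.counit_deg n hn _ hz)
  · exact hΔ.inducesOnHomology h (fun _ => le_top) hcls hd hex hδ

end Homology

end FilteredDGModule

end SerreSS

end

/-! ### Transport of comultiplications, and convergence -/

noncomputable section

namespace SerreSS

lemma exists_linearEquiv_of_ker_eq {k : Type v} [Field k] {K V W : Type*} [AddCommGroup K]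
    [Module k K] [AddCommGroup V] [Module k V] [AddCommGroup W] [Module k W] (f : K →ₗ[k] V)
    (g : K →ₗ[k] W) (hf : Function.Surjective f) (hg : Function.Surjective g)
    (h : ∀ x, f x = 0 ↔ g x = 0) : ∃ e : V ≃ₗ[k] W, ∀ x, e (f x) = g x := by
  have hker : LinearMap.ker f = LinearMap.ker g := Submodule.ext h
  refine ⟨(f.quotKerEquivOfSurjective hf).symm.trans ((Submodule.quotEquivOfEq _ _ hker).trans
    (g.quotKerEquivOfSurjective hg)), fun x => ?_⟩
  have : (f.quotKerEquivOfSurjective hf).symm (f x) = Submodule.Quotient.mk x :=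
    (LinearEquiv.symm_apply_eq _).2 rfl
  rw [LinearEquiv.trans_apply, this]
  rfl

/-- Functionals on the two sides are matched along Θ, so conjugating δ by Θ and Ψ preserves all
pairings. Only a one-sided inverse is needed. -/
lemma IsDualComul.transport {k : Type v} [Field k] {M M' W W' : Type*} [AddCommGroup M]
    [Module k M] [AddCommGroup M'] [Module k M'] [AddCommGroup W] [Module k W] [AddCommGroup W']
    [Module k W'] {ι : Type*} [AddMonoid ι] {Δ : M →ₗ[k] M ⊗[k] M} {Δ' : M' →ₗ[k] M' ⊗[k] M'}
    {U : ι → Submodule k (M →ₗ[k] k)} {τ : ι → W →ₗ[k] M} {U' : ι → Submodule k (M' →ₗ[k] k)}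
    {τ' : ι → W' →ₗ[k] M'} {δ : W' →ₗ[k] W' ⊗[k] W'} (hδ : IsDualComul Δ' U' τ' δ)
    (Θ : W →ₗ[k] W') (Ψ : W' →ₗ[k] W) (hΘΨ : Θ ∘ₗ Ψ = LinearMap.id)
    (h : ∀ i j, ∀ α ∈ U i, ∀ β ∈ U j, ∃ a ∈ U' i, ∃ b ∈ U' j,
      (∀ x, a (τ' i (Θ x)) = α (τ i x)) ∧ (∀ x, b (τ' j (Θ x)) = β (τ j x)) ∧
      ∀ x, form a b (Δ' (τ' (i + j) (Θ x))) = form α β (Δ (τ (i + j) x))) :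
    IsDualComul Δ U τ (TensorProduct.map Ψ Ψ ∘ₗ δ ∘ₗ Θ) := by
  intro i j α hα β hβ x
  obtain ⟨a, ha, b, hb, h1, h2, h3⟩ := h i j α hα β hβ
  have hΘΨ' : ∀ x, Θ (Ψ x) = x := LinearMap.congr_fun hΘΨ
  have e1 : (α ∘ₗ τ i) ∘ₗ Ψ = a ∘ₗ τ' i := LinearMap.ext fun x => by
    refine (h1 (Ψ x)).symm.trans ?_
    rw [hΘΨ' x, LinearMap.comp_apply]
  have e2 : (β ∘ₗ τ j) ∘ₗ Ψ = b ∘ₗ τ' j := LinearMap.ext fun x => by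
    refine (h2 (Ψ x)).symm.trans ?_
    rw [hΘΨ' x, LinearMap.comp_apply]
  rw [LinearMap.comp_apply, LinearMap.comp_apply, form_map, e1, e2, hδ i j a ha b hb, h3]

namespace FilteredDGModule

/-! ### Convergence -/

section Convergence

variable {k : Type v} [Field k] {M : Type w} [AddCommGroup M] [Module k M]
  {C : FilteredDGModule k M}

lemma fil_eq_bot (hF : IsFirstQuadrantFiltration C.deg C.fil) {p : ℤ} (hp : p < 0) :
    C.fil p = ⊥ := by
  rw [C.fil_homogeneous p, eq_bot_iff]
  exact iSup_le fun n => ((hF.2 n p).1 hp).le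

lemma homologyFil_eq_bot (hF : IsFirstQuadrantFiltration C.deg C.fil) {p : ℤ} (hp : p < 0) :
    C.homologyFil p = ⊥ := by
  rw [eq_bot_iff]
  intro x hx
  obtain ⟨z, hz, rfl⟩ := C.mem_homologyImage.1 hx
  rw [fil_eq_bot hF hp, Submodule.mem_bot] at hz
  rw [Submodule.mem_bot, toHomology_eq_zero, hz]
  exact zero_mem _

lemma isFirstQuadrantFiltration_homology (hF : IsFirstQuadrantFiltration C.deg C.fil) :
    IsFirstQuadrantFiltration C.homologyDeg C.homologyFil := by
  refine ⟨C.homologyFil_mono, fun n p => ⟨fun hp => ?_, fun hp x hx => ?_⟩⟩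
  · rw [homologyFil_eq_bot hF hp, bot_inf_eq]
  · obtain ⟨z, hz, rfl⟩ := C.mem_homologyImage.1 hx
    exact C.mem_homologyImage.2 ⟨z, (hF.2 n p).2 hp hz, rfl⟩

lemma exists_mem_of_isFirstQuadrantFiltration {H : Type*} [AddCommGroup H] [Module k H]
    {deg fil : ℤ → Submodule k H} (hF : IsFirstQuadrantFiltration deg fil)
    (hdeg : DirectSum.IsInternal deg) (x : H) : ∃ n : ℕ, x ∈ fil n := by
  refine grading_induction hdeg x (fun i x hx => ⟨i.toNat, ?_⟩) ⟨0, zero_mem _⟩ ?_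
  · exact (hF.2 i i.toNat).2 (by lia) hx
  · rintro x y ⟨n, hn⟩ ⟨m, hm⟩
    exact ⟨max n m, add_mem (hF.1 (by simp) hn) (hF.1 (by simp) hm)⟩

variable {Δ : M →ₗ[k] M ⊗[k] M} {ε : M →ₗ[k] k}
  {S : GradedCoalgebra k C.Homology C.homologyDeg}

/-- The filtration of H ⊗ H is tested on functionals vanishing on F^{i-1}H and F^{j-1}H. These lift
to cocycles vanishing on F^{i-1} and F^{j-1}, and the test becomes the filtration property of Δ. -/
lemma isFiltered_homology (hC : C.IsFilteredDGCoalgebra Δ ε)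
    (hF : IsFirstQuadrantFiltration C.deg C.fil)
    (hS : ∀ (a b : C.Homology →ₗ[k] k) (α β : M →ₗ[k] k), (∀ x, α (C.d x) = 0) →
      (∀ x, β (C.d x) = 0) → (∀ z : LinearMap.ker C.d, α z = a (C.toHomology z)) →
      (∀ z : LinearMap.ker C.d, β z = b (C.toHomology z)) →
      ∀ z, form a b (S.comul (C.toHomology z)) = form α β (Δ z)) :
    S.IsFiltered C.homologyFil := by
  refine ⟨fun p x hx => ?_, fun p hp x hx => ?_⟩
  · refine mem_tensorFamily_fil_of_forms C.homologyFil_mono (homologyFil_eq_bot hF (by lia))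
      (exists_mem_of_isFirstQuadrantFiltration (isFirstQuadrantFiltration_homology hF)
        C.isInternal_homologyDeg) _ fun i j hij a b ha hb => ?_
    obtain ⟨z, hz, rfl⟩ := C.mem_homologyImage.1 hx
    obtain ⟨α, h1, h2, h3⟩ := exists_cocycle a _ ha
    obtain ⟨β, h4, h5, h6⟩ := exists_cocycle b _ hb
    rw [hS a b α β h2 h5 h3 h6]
    exact form_eq_zero_of_fil C.fil_mono h1 h4 (by lia) (hC.2.2.2 p _ hz)
  · rw [homologyFil_eq_bot hF hp, Submodule.mem_bot] at hx
    rw [hx, map_zero]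

open HSpectralSequence

/-- For p < 0 the stage F^p is zero. For q < 0 the degree p + q is at most p - 1, so all of it
already lies in F^{p-1}. -/
lemma isFirstQuadrant_spectralSequence (hF : IsFirstQuadrantFiltration C.deg C.fil) :
    IsFirstQuadrant C.spectralSequence := by
  intro r pq h
  have : Subsingleton (X C.spectralSequence r pq) := by
    refine ⟨fun x y => ?_⟩
    have key : ∀ x : X C.spectralSequence r pq, x = 0 := by
      intro x
      obtain ⟨z, rfl⟩ := C.pageCls_surjective r pq x
      rw [pageCls_eq_zero]
      have hz := mem_Z.1 z.2
      refine Submodule.mem_sup_right ⟨?_, hz.2.1⟩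
      by_cases hp : pq.1 < 0
      · have h0 := hz.1
        rw [fil_eq_bot hF hp, Submodule.mem_bot] at h0
        rw [h0]
        exact zero_mem _
      · exact (hF.2 _ _).2 (by lia) hz.2.1
    rw [key x, key y]
  exact ModuleCat.isZero_of_subsingleton _

/-- This uses r ≥ p + 1, which makes F^{p-r} zero. -/
lemma mem_Z_of_stableFrom_le (hF : IsFirstQuadrantFiltration C.deg C.fil) {r : ℕ} {pq : ℤ × ℤ}
    (h : stableFrom pq ≤ r) {x : M} :
    x ∈ C.Z r pq ↔ x ∈ filPiece C.deg C.fil pq ∧ C.d x = 0 := by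
  simp only [stableFrom, Int.toNat_le, max_le_iff] at h
  rw [mem_Z, fil_eq_bot (C := C) hF (p := pq.1 - r) (by lia), Submodule.mem_bot, ← and_assoc]
  rfl

/-- This uses r ≥ q + 2: then F^{p+r-1} contains everything of degree p + q + 1, the only degree
whose boundaries a functional concentrated in degree p + q can see. The resulting condition no
longer involves r. -/
lemma apply_pageN_eq_zero_iff (hF : IsFirstQuadrantFiltration C.deg C.fil) {r : ℕ}
    {pq : ℤ × ℤ} (h : stableFrom pq ≤ r) {α : M →ₗ[k] k} :
    (∀ x ∈ C.pageN r pq, α x = 0) ↔ (∀ x ∈ C.fil (pq.1 - 1), α x = 0) ∧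
      (∀ x, α (C.d x) = 0) ∧ ∀ n, n ≠ pq.1 + pq.2 → ∀ x ∈ C.deg n, α x = 0 := by
  simp only [stableFrom, Int.toNat_le, max_le_iff] at h
  refine (C.pageN_le_iff r pq (LinearMap.ker α)).trans ?_
  refine ⟨fun hα => ⟨hα.1, fun x => ?_, hα.2.2⟩, fun hα => ⟨hα.1, fun x _ => hα.2.1 x, hα.2.2⟩⟩
  refine grading_induction C.isInternal x (fun n x hx => ?_) (by simp)
    fun x y hx hy => by rw [map_add, map_add, hx, hy, add_zero]
  by_cases hn : n - 1 = pq.1 + pq.2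
  · exact hα.2.1 x ((hF.2 _ _).2 (by lia) hx)
  · exact hα.2.2 _ hn _ (C.d_deg n x hx)

lemma mem_cochains_of_stableFrom_le (hF : IsFirstQuadrantFiltration C.deg C.fil) {r : ℕ}
    {pq : ℤ × ℤ} (h : stableFrom pq ≤ r) {α : M →ₗ[k] k} :
    α ∈ (C.pageData r).cochains pq ↔ (∀ x ∈ C.fil (pq.1 - 1), α x = 0) ∧
      (∀ x, α (C.d x) = 0) ∧ ∀ n, n ≠ pq.1 + pq.2 → ∀ x ∈ C.deg n, α x = 0 :=
  (C.pageData r).mem_cochains.trans (apply_pageN_eq_zero_iff hF h)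

lemma step_pageCls (hE : IsFirstQuadrant C.spectralSequence) (r : ℕ) (pq : ℤ × ℤ)
    (h : stableFrom pq ≤ r) (z : C.Z ((r + 1 : ℕ) : ℤ) pq) :
    hE.step r pq h (C.pageCls r pq (C.inclZ r pq z)) = C.pageCls (r + 1) pq z := by
  refine C.toNext_apply r pq _ z ?_
  have := (C.spectralSequence.page (r : ℤ)).liftCycles_i (𝟙 _) _ rfl
    (by rw [hE.d_eq_zero r pq _ h, Limits.comp_zero])
  exact LinearMap.congr_fun (congrArg ModuleCat.Hom.hom this) (C.pageCls r pq (C.inclZ r pq z))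

lemma stab_pageCls
    (hE : IsFirstQuadrant C.spectralSequence) (pq : ℤ × ℤ) (r : ℕ) (h : stableFrom pq ≤ r)
    (z : C.Z (stableFrom pq) pq) (z' : C.Z r pq) (hz : (z' : M) = z) :
    hE.stab pq r h (C.pageCls (stableFrom pq) pq z) = C.pageCls r pq z' := by
  induction r, h using Nat.le_induction with
  | base =>
    obtain rfl : z' = z := Subtype.ext hz
    rw [IsFirstQuadrant.stab, Nat.leRec_self]
    rfl
  | succ r h ih =>
    rw [← C.step_pageCls hE r pq h z', ← ih (C.inclZ r pq z') hz, IsFirstQuadrant.stab,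
      Nat.leRec_succ _ _ h]
    rfl

lemma stabTotal_lof (hF : IsFirstQuadrantFiltration C.deg C.fil)
    (hE : IsFirstQuadrant C.spectralSequence) (pq : ℤ × ℤ) (r : ℕ) (h : stableFrom pq ≤ r)
    (z : C.Z (stableFrom pq) pq) :
    ∃ z' : C.Z r pq, (z' : M) = z ∧
      hE.stabTotal r (DirectSum.lof k _ (Infinity C.spectralSequence) pq
        (C.pageCls (stableFrom pq) pq z)) =
        DirectSum.lof k _ (X C.spectralSequence r) pq (C.pageCls r pq z') := by
  refine ⟨⟨z, ?_⟩, rfl, ?_⟩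
  · rw [mem_Z_of_stableFrom_le hF h, ← mem_Z_of_stableFrom_le hF le_rfl]
    exact z.2
  · rw [IsFirstQuadrant.stabTotal, DirectSum.lmap_lof, dif_pos h]
    rw [stab_pageCls hE pq r h z ⟨z, _⟩ rfl]

variable (C) in
/-- The presentation of `E^∞` by subquotients. -/
def infinityData : PageData k M (Infinity C.spectralSequence) where
  Z pq := C.Z (stableFrom pq) pq
  N pq := C.pageN (stableFrom pq) pq
  cls pq := C.pageCls (stableFrom pq) pq
  surj pq := C.pageCls_surjective (stableFrom pq) pq
  cls_eq_zero pq z := (C.pageCls_eq_zero _ pq z).trans (C.mem_denom_iff _ pq z.2.1)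

lemma mem_cochains_infinityData (hF : IsFirstQuadrantFiltration C.deg C.fil) {pq : ℤ × ℤ}
    {α : M →ₗ[k] k} : α ∈ C.infinityData.cochains pq ↔ (∀ x ∈ C.fil (pq.1 - 1), α x = 0) ∧
      (∀ x, α (C.d x) = 0) ∧ ∀ n, n ≠ pq.1 + pq.2 → ∀ x ∈ C.deg n, α x = 0 :=
  C.infinityData.mem_cochains.trans (apply_pageN_eq_zero_iff hF (le_refl (stableFrom pq)))

/-- Each bidegree of E^∞ comes from its own page, so the result for a single page does not apply.
The description of the cochains as cocycles is uniform, however, and closure under convolution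
follows as before. -/
lemma IsFilteredDGCoalgebra.dualData_infinity (hC : C.IsFilteredDGCoalgebra Δ ε)
    (hF : IsFirstQuadrantFiltration C.deg C.fil) :
    DualData Δ ε C.infinityData.cochains C.infinityData.rep where
  separates := C.infinityData.separates
  one_mem := by
    rw [mem_cochains_infinityData hF]
    refine ⟨fun x hx => ?_, hC.2.2.1, fun n hn x hx => hC.counit_deg n hn x hx⟩
    rw [fil_eq_bot hF (by simp), Submodule.mem_bot] at hx
    rw [hx, map_zero]
  mul_mem {i j α β} hα hβ := by
    rw [mem_cochains_infinityData hF] at hα hβ ⊢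
    refine ⟨fun x hx => ?_, fun x => ?_, fun n hn x hx => ?_⟩
    · exact form_eq_zero_of_fil C.fil_mono hα.1 hβ.1 (by simp) (hC.2.2.2 _ x hx)
    · have h1 : α ∘ₗ C.d = 0 := LinearMap.ext hα.2.1
      have h2 : β ∘ₗ C.d = 0 := LinearMap.ext hβ.2.1
      rw [LinearMap.comp_apply, hC.2.1, form_tensorD, h1, h2]
      simp
    · refine form_eq_zero_of_deg hα.2.2 hβ.2.2 ?_ (hC.comul_deg n x hx)
      simp only [Prod.fst_add, Prod.snd_add] at hn
      lia

lemma apply_rep_stabTotal (hF : IsFirstQuadrantFiltration C.deg C.fil)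
    (hE : IsFirstQuadrant C.spectralSequence) {i : ℤ × ℤ} {r : ℕ} (h : stableFrom i ≤ r)
    {α : M →ₗ[k] k} (hα : α ∈ (C.pageData r).cochains i)
    (x : ⨁ pq, Infinity C.spectralSequence pq) :
    α ((C.pageData r).rep i (hE.stabTotal r x)) = α (C.infinityData.rep i x) := by
  refine lof_induction (k := k) x (fun l v => ?_)
    (fun x y hx hy => by simp only [map_add, hx, hy]) (by simp)
  by_cases hl : l = i
  · subst hl
    obtain ⟨z, rfl⟩ := C.pageCls_surjective (stableFrom l) l v
    obtain ⟨z', hz, e⟩ := stabTotal_lof hF hE l r h z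
    rw [e, C.apply_rep_pageCls hα, hz]
    refine (C.infinityData.apply_rep_lof ?_ z).symm
    rwa [mem_cochains_infinityData hF, ← mem_cochains_of_stableFrom_le hF h]
  · rw [IsFirstQuadrant.stabTotal, DirectSum.lmap_lof, PageData.rep_lof_of_ne _ hl,
      PageData.rep_lof_of_ne _ hl]

lemma rep_comp_stabTotal_of_mem_component (hE : IsFirstQuadrant C.spectralSequence)
    {i l : ℤ × ℤ} (h : l ≠ i) (r : ℕ) {x : ⨁ pq, Infinity C.spectralSequence pq}
    (hx : x ∈ component (k := k) (V := Infinity C.spectralSequence) l) :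
    (C.pageData r).rep i (hE.stabTotal r x) = 0 := by
  obtain ⟨v, rfl⟩ := hx
  rw [IsFirstQuadrant.stabTotal, DirectSum.lmap_lof, PageData.rep_lof_of_ne _ h]

/-- Restricts pairings to bidegrees in the first quadrant, where a page stable in bidegree i + j is
stable in bidegrees i and j too. -/
lemma pageData_rep_eq_zero (hE : IsFirstQuadrant C.spectralSequence) {i : ℤ × ℤ}
    (hi : i.1 < 0 ∨ i.2 < 0) (r : ℕ) : (C.pageData r).rep i = 0 := by
  refine DirectSum.linearMap_ext k fun l => LinearMap.ext fun v => ?_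
  by_cases h : l = i
  · subst h
    have : Subsingleton (X C.spectralSequence r l) :=
      ModuleCat.subsingleton_of_isZero (hE r l hi)
    rw [Subsingleton.elim v 0, map_zero, map_zero]
  · exact PageData.rep_lof_of_ne _ h v

/-- The coalgebra `E^∞` of a spectral sequence of coalgebras is dual to the cochains on `M`. -/
lemma isInfinityCoalgebra_of_isDualComul (hC : C.IsFilteredDGCoalgebra Δ ε)
    (hF : IsFirstQuadrantFiltration C.deg C.fil) (hE : IsFirstQuadrant C.spectralSequence)
    (A : CoalgebraStructure C.spectralSequence)
    (hA : ∀ r, IsDualComul Δ (C.pageData r).cochains (C.pageData r).rep (A.coalg r).comul ∧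
      ∀ x, (A.coalg r).counit x = ε ((C.pageData r).rep 0 x))
    (I : GradedCoalgebra k (⨁ pq, Infinity C.spectralSequence pq)
      (component (V := Infinity C.spectralSequence)))
    (hI : IsDualComul Δ C.infinityData.cochains C.infinityData.rep I.comul)
    (hI' : ∀ x, I.counit x = ε (C.infinityData.rep 0 x)) :
    A.IsInfinityCoalgebra hE I := by
  have h0 : C.fil (-1) = ⊥ := fil_eq_bot hF (by lia)
  intro l r hl x hx
  refine ⟨(hC.dualData h0 r).ext₂ fun i j α hα β hβ => ?_, ?_⟩
  · by_cases hi : i.1 < 0 ∨ i.2 < 0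
    · rw [pageData_rep_eq_zero hE hi, LinearMap.comp_zero, form_zero_left]
      rfl
    by_cases hj : j.1 < 0 ∨ j.2 < 0
    · rw [pageData_rep_eq_zero hE hj, LinearMap.comp_zero, form_zero_right]
      rfl
    have hγ := (hC.dualData h0 r).mul_mem hα hβ
    rw [form_map, (hA r).1 i j α hα β hβ]
    by_cases hij : i + j = l
    · have hsi : stableFrom i ≤ r := by
        subst hij
        simp only [stableFrom, Int.toNat_le, Prod.fst_add, Prod.snd_add] at hl ⊢
        lia
      have hsj : stableFrom j ≤ r := by
        subst hij
        simp only [stableFrom, Int.toNat_le, Prod.fst_add, Prod.snd_add] at hl ⊢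
        lia
      rw [← hij] at hl
      have e1 : (α ∘ₗ (C.pageData r).rep i) ∘ₗ hE.stabTotal r = α ∘ₗ C.infinityData.rep i :=
        LinearMap.ext fun x => apply_rep_stabTotal hF hE hsi hα x
      have e2 : (β ∘ₗ (C.pageData r).rep j) ∘ₗ hE.stabTotal r = β ∘ₗ C.infinityData.rep j :=
        LinearMap.ext fun x => apply_rep_stabTotal hF hE hsj hβ x
      have e3 := apply_rep_stabTotal hF hE hl hγ x
      simp only [LinearMap.comp_apply] at e3
      rw [e1, e2, hI i j α, e3]
      · rwa [mem_cochains_infinityData hF, ← mem_cochains_of_stableFrom_le hF hsi]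
      · rwa [mem_cochains_infinityData hF, ← mem_cochains_of_stableFrom_le hF hsj]
    · rw [rep_comp_stabTotal_of_mem_component hE (Ne.symm hij) r hx, map_zero, map_zero]
      refine (form_eq_zero_of_mem_tensorFamily (fun i' j' h x hx y hy => ?_)
        (I.comul_mem l x hx)).symm
      by_cases hi' : i' = i
      · have hj' : j' ≠ j := by
          rintro rfl
          exact hij (hi' ▸ h)
        rw [LinearMap.comp_apply, LinearMap.comp_apply, LinearMap.comp_apply, LinearMap.comp_apply,
          rep_comp_stabTotal_of_mem_component hE hj' r hy, map_zero, mul_zero]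
      · rw [LinearMap.comp_apply, LinearMap.comp_apply,
          rep_comp_stabTotal_of_mem_component hE hi' r hx, map_zero, zero_mul]
  · rw [(hA r).2]
    by_cases hl0 : l = 0
    · subst hl0
      rw [hI', apply_rep_stabTotal hF hE hl (hC.dualData h0 r).one_mem]
    · rw [rep_comp_stabTotal_of_mem_component hE hl0 r hx, map_zero, I.counit_eq_zero l hl0 x hx]

variable (C) in
/-- The data of the associated bigraded module of the homology. -/
abbrev homologyGrData : PageData k C.Homology (Gr C.homologyDeg C.homologyFil) :=
  grPageData C.homologyDeg C.homologyFil C.isInternal_homologyDeg C.gradedProj_mem_homologyFil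

/-- The isomorphisms `E^∞_{p,q} ≅ F^p H_{p+q} / F^{p-1} H_{p+q}`. -/
lemma exists_infinityEquiv (hF : IsFirstQuadrantFiltration C.deg C.fil) (pq : ℤ × ℤ) :
    ∃ θ : Infinity C.spectralSequence pq ≃ₗ[k] Gr C.homologyDeg C.homologyFil pq,
      ∀ z : C.Z (stableFrom pq) pq, ∃ (z' : LinearMap.ker C.d)
        (h : C.toHomology z' ∈ filPiece C.homologyDeg C.homologyFil pq), (z' : M) = z ∧
        θ (C.pageCls (stableFrom pq) pq z) = toGr C.homologyDeg C.homologyFil pq ⟨_, h⟩ := by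
  have hZ : ∀ x, x ∈ C.Z (stableFrom pq) pq ↔ x ∈ filPiece C.deg C.fil pq ∧ C.d x = 0 :=
    fun x => mem_Z_of_stableFrom_le hF le_rfl
  let ι : C.Z (stableFrom pq) pq →ₗ[k] LinearMap.ker C.d :=
    Submodule.inclusion fun x hx => ((hZ x).1 hx).2
  have hι : ∀ z, (C.toHomology ∘ₗ ι) z ∈ filPiece C.homologyDeg C.homologyFil pq := fun z =>
    ⟨C.mem_homologyImage.2 ⟨ι z, ((hZ z).1 z.2).1.1, rfl⟩,
      C.mem_homologyImage.2 ⟨ι z, ((hZ z).1 z.2).1.2, rfl⟩⟩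
  suffices h : ∃ e : Infinity C.spectralSequence pq ≃ₗ[k] Gr C.homologyDeg C.homologyFil pq,
      ∀ z, e (C.pageCls (stableFrom pq) pq z) = (toGr C.homologyDeg C.homologyFil pq ∘ₗ
        LinearMap.codRestrict _ (C.toHomology ∘ₗ ι) hι) z by
    obtain ⟨e, he⟩ := h
    exact ⟨e, fun z => ⟨ι z, hι z, rfl, he z⟩⟩
  -- Both modules are quotients of the cycles in F^p_{p+q}; it remains to compare kernels.
  refine exists_linearEquiv_of_ker_eq _ _ (C.pageCls_surjective _ _) ?_ ?_
  · intro x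
    obtain ⟨⟨x, hx1, hx2⟩, rfl⟩ := Submodule.mkQ_surjective _ x
    obtain ⟨z, hz, rfl⟩ := C.mem_homologyImage.1 hx1
    refine ⟨⟨gradedProj C.isInternal (pq.1 + pq.2) z, (hZ _).2
      ⟨⟨C.gradedProj_mem_fil _ _ z hz, gradedProj_mem _ _ _⟩, C.gradedProj_mem_ker _ z.2⟩⟩, ?_⟩
    refine congrArg (toGr C.homologyDeg C.homologyFil pq) (Subtype.ext ?_)
    exact (C.homologyProj_toHomology _ z).symm.trans (C.homologyProj_of_mem hx2)
  · intro z
    rw [pageCls_eq_zero, LinearMap.comp_apply]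
    refine Iff.trans ?_ (Submodule.Quotient.mk_eq_zero _).symm
    change _ ↔ C.toHomology (ι z) ∈ C.homologyFil (pq.1 - 1) ⊓ C.homologyDeg (pq.1 + pq.2)
    have hz := (hZ z).1 z.2
    constructor
    · intro h
      refine ⟨?_, (hι z).2⟩
      obtain ⟨y, -, -, -, f, hf, -, e⟩ := mem_denom.1 h
      have hdf : C.d f = 0 := by
        have := congrArg C.d e
        rwa [map_add, C.d_d, zero_add, hz.2] at this
      refine C.mem_homologyImage.2 ⟨⟨f, hdf⟩, hf, ?_⟩
      rw [← sub_eq_zero, ← map_sub, toHomology_eq_zero]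
      refine ⟨-y, ?_⟩
      change _ = f - z
      rw [← e, map_neg]
      abel
    · rintro ⟨h, -⟩
      obtain ⟨f, hf, e⟩ := C.mem_homologyImage.1 h
      rw [← sub_eq_zero, ← map_sub, toHomology_eq_zero] at e
      obtain ⟨y, hy⟩ := e
      have hy' : C.d y = f - z := hy
      rw [C.mem_denom_iff _ _ hz.1]
      obtain ⟨h1, h2, -⟩ := (C.pageN_le_iff (stableFrom pq) pq _).1 le_rfl
      -- A class in F^{p-1}H gives z = f - ∂y, and taking degree p + q parts makes `y` homogeneous
      -- of degree p + q + 1. Such elements lie in F^{p+r-1}, again because r ≥ q + 2.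
      have e1 : (z : M) = gradedProj C.isInternal (pq.1 + pq.2) f -
          C.d (gradedProj C.isInternal (pq.1 + pq.2 + 1) y) := by
        have := C.d_gradedProj (pq.1 + pq.2 + 1) y
        rw [add_sub_cancel_right] at this
        rw [this, hy', map_sub, gradedProj_of_mem _ hz.1.2, sub_sub_cancel]
      rw [e1]
      refine sub_mem (h1 _ (C.gradedProj_mem_fil _ _ _ hf)) (h2 _ ?_)
      refine (hF.2 _ _).2 ?_ (gradedProj_mem C.isInternal _ y)
      have := Int.self_le_toNat (max (pq.1 + 1) (pq.2 + 2))
      rw [stableFrom]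
      lia

/-- The spectral sequence of a filtered differential graded coalgebra converges to its homology
coalgebra. -/
theorem IsFilteredDGCoalgebra.exists_convergesTo (hC : C.IsFilteredDGCoalgebra Δ ε)
    (hF : IsFirstQuadrantFiltration C.deg C.fil) :
    ∃ (A : CoalgebraStructure C.spectralSequence)
      (S : GradedCoalgebra k C.Homology C.homologyDeg),
      C.IsInducedCoalgebraStructure Δ ε A ∧ C.IsHomologyCoalgebra Δ ε S ∧
      A.ConvergesTo C.homologyFil S := by
  obtain ⟨A, hA, hA'⟩ := hC.exists_coalgebraStructure (fil_eq_bot hF (by lia))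
  obtain ⟨S, hS, hS'⟩ := hC.exists_homologyCoalgebra
  have hSF := isFiltered_homology hC hF hS'
  have hE := isFirstQuadrant_spectralSequence hF
  obtain ⟨G, hG, hG1, hG2⟩ := S.exists_isGrCoalgebra hSF C.homologyFil_mono
    C.isInternal_homologyDeg C.gradedProj_mem_homologyFil
  choose θ hθ using exists_infinityEquiv hF
  let Θ : (⨁ pq, Infinity C.spectralSequence pq) →ₗ[k] ⨁ pq, Gr C.homologyDeg C.homologyFil pq :=
    DirectSum.lmap fun pq => (θ pq).toLinearMap
  let Ψ : (⨁ pq, Gr C.homologyDeg C.homologyFil pq) →ₗ[k] ⨁ pq, Infinity C.spectralSequence pq :=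
    DirectSum.lmap fun pq => (θ pq).symm.toLinearMap
  have hΘΨ : Θ ∘ₗ Ψ = LinearMap.id := by
    refine DirectSum.linearMap_ext k fun pq => LinearMap.ext fun x => ?_
    simp only [Θ, Ψ, LinearMap.comp_apply, DirectSum.lmap_lof]
    simp
  -- A cochain of E^∞ and the functional it induces on the homology take the same values on classes
  -- matched by Θ.
  have hrep : ∀ (i : ℤ × ℤ) (α : M →ₗ[k] k), α ∈ C.infinityData.cochains i →
      ∀ a : C.Homology →ₗ[k] k, (∀ z : LinearMap.ker C.d, α z = a (C.toHomology z)) →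
      a ∈ C.homologyGrData.cochains i ∧
      ∀ x, a (C.homologyGrData.rep i (Θ x)) = α (C.infinityData.rep i x) := by
    intro i α hα a ha
    have hα' := (mem_cochains_infinityData hF).1 hα
    have ha' : a ∈ C.homologyGrData.cochains i := by
      rw [mem_cochains_grPageData]
      refine ⟨fun x hx => ?_, fun n hn x hx => ?_⟩
      · obtain ⟨z, hz, rfl⟩ := C.mem_homologyImage.1 hx
        exact (ha z).symm.trans (hα'.1 _ hz)
      · obtain ⟨z, hz, rfl⟩ := C.mem_homologyImage.1 hx
        exact (ha z).symm.trans (hα'.2.2 n hn _ hz)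
    refine ⟨ha', fun x => ?_⟩
    refine lof_induction (k := k) x (fun l v => ?_)
      (fun x y hx hy => by simp only [map_add, hx, hy]) (by simp)
    simp only [Θ, DirectSum.lmap_lof]
    by_cases hl : l = i
    · subst hl
      obtain ⟨z, rfl⟩ := C.pageCls_surjective (stableFrom l) l v
      obtain ⟨z', h, hz, e⟩ := hθ l z
      rw [LinearEquiv.coe_coe, e]
      refine (C.homologyGrData.apply_rep_lof ha' ⟨_, h⟩).trans ?_
      refine Eq.trans ?_ (C.infinityData.apply_rep_lof hα z).symm
      rw [← hz, ha]
    · rw [PageData.rep_lof_of_ne _ hl, PageData.rep_lof_of_ne _ hl, map_zero, map_zero]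
  have hdesc : ∀ (i : ℤ × ℤ) (α : M →ₗ[k] k), α ∈ C.infinityData.cochains i →
      ∃ a : C.Homology →ₗ[k] k, ∀ z : LinearMap.ker C.d, α z = a (C.toHomology z) :=
    fun i α hα => ⟨α ∘ₗ C.homologyRep ⟨⟩, fun z =>
      (C.apply_homologyRep ((mem_cochains_infinityData hF).1 hα).2.1 _ z).symm⟩
  -- The comultiplication of E^∞ is transported from Gr(H), so Θ is a coalgebra map by construction;
  -- its duality with cochains on `M` then identifies it with the one of the stable pages.
  have hI : IsDualComul Δ C.infinityData.cochains C.infinityData.rep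
      (TensorProduct.map Ψ Ψ ∘ₗ G.comul ∘ₗ Θ) := by
    refine hG1.transport Θ Ψ hΘΨ fun i j α hα β hβ => ?_
    obtain ⟨a, ha⟩ := hdesc i α hα
    obtain ⟨b, hb⟩ := hdesc j β hβ
    obtain ⟨ha1, ha2⟩ := hrep i α hα a ha
    obtain ⟨hb1, hb2⟩ := hrep j β hβ b hb
    refine ⟨a, ha1, b, hb1, ha2, hb2, ?_⟩
    refine (hrep (i + j) _ ((hC.dualData_infinity hF).mul_mem hα hβ) (form a b ∘ₗ S.comul)
      fun z => ?_).2
    exact (hS' a b α β ((mem_cochains_infinityData hF).1 hα).2.1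
      ((mem_cochains_infinityData hF).1 hβ).2.1 ha hb z).symm
  have hcounit : ∀ x, G.counit (Θ x) = ε (C.infinityData.rep 0 x) := fun x =>
    (hG2 _).trans ((hrep 0 ε (hC.dualData_infinity hF).one_mem S.counit
      fun z => (hS.2 z).symm).2 x)
  obtain ⟨T, hT, hT'⟩ := id hC.1
  subst hT hT'
  let I := PageData.gradedCoalgebra T.toCoalgebra (hC.dualData_infinity hF) hI
  refine ⟨A, S, hA, hS, isFirstQuadrantFiltration_homology hF, hSF, hE, I, G, θ,
    isInfinityCoalgebra_of_isDualComul hC hF hE A hA' I hI fun x => rfl, hG, fun x => ?_,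
    hcounit⟩
  change G.comul (Θ x) = TensorProduct.map Θ Θ (TensorProduct.map Ψ Ψ (G.comul (Θ x)))
  rw [← LinearMap.comp_apply (TensorProduct.map Θ Θ), ← TensorProduct.map_comp, hΘΨ,
    TensorProduct.map_id, LinearMap.id_apply]

end Convergence

end FilteredDGModule

end SerreSS

end

noncomputable section

namespace SerreSS

/-! ### The coalgebra of simplicial chains -/

section Chains

open Finset.HasAntidiagonal (antidiagonal)

variable {k : Type v} [Field k] {S T : SSet.{u}}

/-- The function `g` restricts to an order-preserving map `{0, …, m} → {0, …, n}`. -/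
def IsSimplicial (n m : ℕ) (g : ℕ → ℕ) : Prop :=
  (∀ j, j ≤ m → g j ≤ n) ∧ ∀ i j, i ≤ j → j ≤ m → g i ≤ g j

/-- The map `[m] → [n]` given by a function on the natural numbers. -/
def simplicialHom {n m : ℕ} {g : ℕ → ℕ} (h : IsSimplicial n m g) :
    SimplexCategory.mk m ⟶ SimplexCategory.mk n :=
  SimplexCategory.mkHom ⟨fun j => ⟨g j, Nat.lt_succ_of_le (h.1 j (Nat.le_of_lt_succ j.2))⟩,
    fun i j hij => h.2 i j hij (Nat.le_of_lt_succ j.2)⟩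

open Classical in
/-- The `m`-simplex `b ∘ g`, where `g : [m] → [n]`. -/
def pullback (b : Simplex S) (m : ℕ) (g : ℕ → ℕ) : Simplex S :=
  -- The value `b` for functions that do not define a map [m] → [n] is arbitrary.
  if h : IsSimplicial b.1 m g then ⟨m, S.map (simplicialHom h).op b.2⟩ else b

lemma pullback_eq {b : Simplex S} {m : ℕ} {g : ℕ → ℕ} (h : IsSimplicial b.1 m g) :
    pullback b m g = ⟨m, S.map (simplicialHom h).op b.2⟩ := dif_pos h

/-- Recording faces by functions on ℕ turns simplicial identities into arithmetic, with no casts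
between ordinals; this is the translation from morphisms. -/
lemma pullback_eq_of_hom {b : Simplex S} {m : ℕ} {g : ℕ → ℕ}
    (φ : SimplexCategory.mk m ⟶ SimplexCategory.mk b.1)
    (h : ∀ j : Fin (m + 1), g j = (φ.toOrderHom j : ℕ)) :
    pullback b m g = ⟨m, S.map φ.op b.2⟩ := by
  have hg : IsSimplicial b.1 m g := by
    refine ⟨fun j hj => ?_, fun i j hij hj => ?_⟩
    · rw [h ⟨j, by lia⟩]
      exact Nat.le_of_lt_succ (φ.toOrderHom _).2
    · rw [h ⟨j, by lia⟩, h ⟨i, by lia⟩]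
      exact φ.toOrderHom.monotone (show (⟨i, _⟩ : Fin (m + 1)) ≤ ⟨j, _⟩ from hij)
  have e : simplicialHom hg = φ := by
    refine SimplexCategory.Hom.ext _ _ (OrderHom.ext _ _ (funext fun j => Fin.ext (h j)))
  rw [pullback_eq hg, e]

lemma pullback_congr {b : Simplex S} {m : ℕ} {g g' : ℕ → ℕ} (h : ∀ j, j ≤ m → g j = g' j) :
    pullback b m g = pullback b m g' := by
  by_cases hg : IsSimplicial b.1 m g
  · rw [pullback_eq hg, pullback_eq_of_hom (simplicialHom hg)]
    exact fun j => (h j (Nat.le_of_lt_succ j.2)).symm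
  · have hg' : ¬ IsSimplicial b.1 m g' := by
      refine fun hg' => hg ⟨fun j hj => ?_, fun i j hij hj => ?_⟩
      · rw [h j hj]
        exact hg'.1 j hj
      · rw [h j hj, h i (hij.trans hj)]
        exact hg'.2 i j hij hj
    rw [pullback, pullback, dif_neg hg, dif_neg hg']

lemma pullback_fst {b : Simplex S} {m : ℕ} {g : ℕ → ℕ} (h : IsSimplicial b.1 m g) :
    (pullback b m g).1 = m := by
  rw [pullback_eq h]

lemma pullback_pullback {b : Simplex S} {m m' : ℕ} {g g' : ℕ → ℕ} (h : IsSimplicial b.1 m g)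
    (h' : IsSimplicial m m' g') : pullback (pullback b m g) m' g' = pullback b m' (g ∘ g') := by
  rw [pullback_eq h, pullback_eq (b := ⟨m, S.map (simplicialHom h).op b.2⟩) h',
    pullback_eq_of_hom (b := b) (simplicialHom h' ≫ simplicialHom h) fun j => rfl,
    op_comp, Functor.map_comp]
  rfl

lemma pullback_id (b : Simplex S) : pullback b b.1 id = b := by
  rw [pullback_eq_of_hom (𝟙 _) fun j => rfl, op_id, S.map_id]
  rfl

variable (k) in
/-- The simplex `b ∘ g` as a chain. -/
def pullbackChain (b : Simplex S) (m : ℕ) (g : ℕ → ℕ) : Chains k S :=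
  Finsupp.single (pullback b m g) 1

lemma pullbackChain_congr {b : Simplex S} {m : ℕ} {g g' : ℕ → ℕ} (h : ∀ j, j ≤ m → g j = g' j) :
    pullbackChain k b m g = pullbackChain k b m g' := by
  rw [pullbackChain, pullbackChain, pullback_congr h]

lemma pullbackChain_id (b : Simplex S) : pullbackChain k b b.1 id = Finsupp.single b 1 := by
  rw [pullbackChain, pullback_id]

lemma diagonal_single (b : Simplex S) :
    diagonal k S (Finsupp.single b 1) = ∑ pq ∈ antidiagonal b.1,
      pullbackChain k b pq.1 id ⊗ₜ[k] pullbackChain k b pq.2 (pq.1 + ·) := by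
  rw [diagonal, Finsupp.linearCombination_single, one_smul,
    Finset.Nat.sum_antidiagonal_eq_sum_range_succ_mk, Finset.sum_range]
  refine Finset.sum_congr rfl fun i _ => ?_
  have h1 : pullback b (i : ℕ) id = ⟨i, S.map (front b.1 i).op b.2⟩ :=
    pullback_eq_of_hom _ fun j => rfl
  have h2 : pullback b (b.1 - i) ((i : ℕ) + ·) = ⟨b.1 - i, S.map (back b.1 i).op b.2⟩ :=
    pullback_eq_of_hom _ fun j => rfl
  rw [← h1, ← h2]
  rfl

lemma diagonal_pullbackChain {b : Simplex S} {m : ℕ} {g : ℕ → ℕ} (h : IsSimplicial b.1 m g) :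
    diagonal k S (pullbackChain k b m g) = ∑ pq ∈ antidiagonal m,
      pullbackChain k b pq.1 g ⊗ₜ[k] pullbackChain k b pq.2 fun j => g (pq.1 + j) := by
  rw [pullbackChain, diagonal_single, pullback_fst h]
  refine Finset.sum_congr rfl fun pq hpq => ?_
  rw [Finset.HasAntidiagonal.mem_antidiagonal] at hpq
  have h1 : IsSimplicial m pq.1 id := ⟨fun j hj => by simp only [id]; lia, fun i j hij _ => hij⟩
  have h2 : IsSimplicial m pq.2 (pq.1 + ·) :=
    ⟨fun j hj => by lia, fun i j hij _ => Nat.add_le_add_left hij _⟩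
  rw [pullbackChain, pullbackChain, pullback_pullback h h1, pullback_pullback h h2]
  rfl

/-- The `i`-th coface map. -/
def coface (i j : ℕ) : ℕ := if j < i then j else j + 1

lemma isSimplicial_coface (n i : ℕ) : IsSimplicial (n + 1) n (coface i) := by
  refine ⟨fun j hj => ?_, fun a b hab hb => ?_⟩ <;> simp only [coface] <;> split_ifs <;> lia

lemma chainsD_single_succ {b : Simplex S} {n : ℕ} (h : b.1 = n + 1) :
    chainsD k S (Finsupp.single b 1) = ∑ i ∈ Finset.range (n + 2),
      (-1 : k) ^ i • pullbackChain k b n (coface i) := by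
  obtain ⟨m, b⟩ := b
  obtain rfl : m = n + 1 := h
  rw [chainsD_single, Finset.sum_range]
  refine Finset.sum_congr rfl fun i _ => ?_
  rw [pullbackChain, pullback_eq_of_hom (b := ⟨n + 1, b⟩) (SimplexCategory.δ i),
    Finsupp.smul_single, smul_eq_mul, mul_one, one_mul]
  · rfl
  · intro j
    change _ = (i.succAbove j : ℕ)
    simp only [coface, Fin.succAbove, Fin.lt_def, Fin.val_castSucc]
    split_ifs <;> rfl

lemma chainsD_pullbackChain {b : Simplex S} {m : ℕ} {g : ℕ → ℕ} (h : IsSimplicial b.1 (m + 1) g) :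
    chainsD k S (pullbackChain k b (m + 1) g) = ∑ i ∈ Finset.range (m + 2),
      (-1 : k) ^ i • pullbackChain k b m fun j => g (coface i j) := by
  rw [pullbackChain, chainsD_single_succ (pullback_fst h)]
  refine Finset.sum_congr rfl fun i _ => ?_
  rw [pullbackChain, pullback_pullback h (isSimplicial_coface m i)]
  rfl

lemma chainsD_pullbackChain_zero {b : Simplex S} {g : ℕ → ℕ} (h : IsSimplicial b.1 0 g) :
    chainsD k S (pullbackChain k b 0 g) = 0 := by
  rw [pullbackChain, pullback_eq h, chainsD_single_zero]

lemma augmentation_pullbackChain {b : Simplex S} {m : ℕ} {g : ℕ → ℕ} (h : IsSimplicial b.1 m g) :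
    augmentation k S (pullbackChain k b m g) = if m = 0 then 1 else 0 := by
  rw [pullbackChain, augmentation, Finsupp.linearCombination_single, pullback_fst h, one_smul]

lemma isSimplicial_id {n m : ℕ} (h : m ≤ n) : IsSimplicial n m id :=
  ⟨fun _ hj => hj.trans h, fun _ _ hij _ => hij⟩

lemma isSimplicial_add {n p q : ℕ} (h : p + q ≤ n) : IsSimplicial n q (p + ·) :=
  ⟨fun j hj => by simp only; lia, fun _ _ hij _ => Nat.add_le_add_left hij _⟩

lemma chains_linearMap_ext {W : Type*} [AddCommMonoid W] [Module k W] {f g : Chains k S →ₗ[k] W}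
    (h : ∀ b, f (Finsupp.single b 1) = g (Finsupp.single b 1)) : f = g :=
  Finsupp.lhom_ext' fun b => LinearMap.ext_ring (h b)

lemma mem_of_single {W : Type*} [AddCommMonoid W] [Module k W] {N : Submodule k W}
    {s : Set (Simplex S)} (g : Chains k S →ₗ[k] W) (h : ∀ a ∈ s, g (Finsupp.single a 1) ∈ N) :
    ∀ x ∈ Finsupp.supported k k s, g x ∈ N := by
  intro x hx
  rw [Finsupp.supported_eq_span_single] at hx
  have : Submodule.span k ((fun i => Finsupp.single i (1 : k)) '' s) ≤ N.comap g := by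
    rw [Submodule.span_le]
    rintro _ ⟨a, ha, rfl⟩
    exact h a ha
  exact this hx

lemma sum_antidiagonal_assoc {W : Type*} [AddCommMonoid W] (n : ℕ) (F : ℕ → ℕ → ℕ → W) :
    ∑ x ∈ antidiagonal n, ∑ y ∈ antidiagonal x.1, F y.1 y.2 x.2 =
      ∑ x ∈ antidiagonal n, ∑ y ∈ antidiagonal x.2, F x.1 y.1 y.2 := by
  rw [Finset.sum_sigma', Finset.sum_sigma']
  refine Finset.sum_nbij' (fun s => ⟨(s.2.1, s.2.2 + s.1.2), (s.2.2, s.1.2)⟩)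
    (fun s => ⟨(s.1.1 + s.2.1, s.2.2), (s.1.1, s.2.1)⟩) ?_ ?_ ?_ ?_ ?_
  all_goals
    rintro ⟨⟨a, b⟩, ⟨c, d⟩⟩ h
    simp only [Finset.mem_sigma, Finset.HasAntidiagonal.mem_antidiagonal] at h
    obtain ⟨h1, h2⟩ := h
    subst h1 h2
    simp [add_assoc]

variable (k S) in
/-- The coalgebra structure of the chains given by the Alexander--Whitney diagonal. -/
abbrev chainsCoalgebra : Coalgebra k (Chains k S) where
  comul := diagonal k S
  counit := augmentation k S
  coassoc := by
    refine chains_linearMap_ext fun b => ?_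
    simp only [LinearMap.comp_apply, LinearEquiv.coe_coe]
    rw [diagonal_single, map_sum, map_sum, map_sum]
    have h1 : ∀ x ∈ antidiagonal b.1, TensorProduct.assoc k _ _ _
        ((diagonal k S).rTensor _ (pullbackChain k b x.1 id ⊗ₜ[k] pullbackChain k b x.2 (x.1 + ·)))
        = ∑ y ∈ antidiagonal x.1, pullbackChain k b y.1 id ⊗ₜ[k]
          (pullbackChain k b y.2 (y.1 + ·) ⊗ₜ[k] pullbackChain k b x.2 (y.1 + y.2 + ·)) := by
      intro x hx
      rw [Finset.HasAntidiagonal.mem_antidiagonal] at hx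
      rw [LinearMap.rTensor_tmul, diagonal_pullbackChain (isSimplicial_id (by lia)),
        TensorProduct.sum_tmul, map_sum]
      refine Finset.sum_congr rfl fun y hy => ?_
      rw [Finset.HasAntidiagonal.mem_antidiagonal] at hy
      rw [TensorProduct.assoc_tmul, hy]
      rfl
    have h2 : ∀ x ∈ antidiagonal b.1,
        (diagonal k S).lTensor _ (pullbackChain k b x.1 id ⊗ₜ[k] pullbackChain k b x.2 (x.1 + ·))
        = ∑ y ∈ antidiagonal x.2, pullbackChain k b x.1 id ⊗ₜ[k]
          (pullbackChain k b y.1 (x.1 + ·) ⊗ₜ[k] pullbackChain k b y.2 (x.1 + y.1 + ·)) := by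
      intro x hx
      rw [Finset.HasAntidiagonal.mem_antidiagonal] at hx
      rw [LinearMap.lTensor_tmul, diagonal_pullbackChain (isSimplicial_add (by lia)),
        TensorProduct.tmul_sum]
      refine Finset.sum_congr rfl fun y hy => ?_
      simp only [add_assoc]
    rw [Finset.sum_congr rfl h1, Finset.sum_congr rfl h2]
    -- Either way of cutting twice produces the three faces with cut points p and p + q.
    exact sum_antidiagonal_assoc b.1 fun p q r => pullbackChain k b p id ⊗ₜ[k]
      (pullbackChain k b q (p + ·) ⊗ₜ[k] pullbackChain k b r (p + q + ·))
  rTensor_counit_comp_comul := by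
    refine chains_linearMap_ext fun b => ?_
    rw [LinearMap.comp_apply, diagonal_single, map_sum, Finset.sum_eq_single (0, b.1)]
    · rw [LinearMap.rTensor_tmul, augmentation_pullbackChain (isSimplicial_id (Nat.zero_le _)),
        if_pos rfl, TensorProduct.mk_apply, ← pullbackChain_id]
      simp only [zero_add]
      rfl
    · intro x hx hne
      rw [Finset.HasAntidiagonal.mem_antidiagonal] at hx
      rw [LinearMap.rTensor_tmul, augmentation_pullbackChain (isSimplicial_id (by lia)), if_neg,
        TensorProduct.zero_tmul]
      rintro h
      exact hne (Prod.ext h (by lia))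
    · simp
  lTensor_counit_comp_comul := by
    refine chains_linearMap_ext fun b => ?_
    rw [LinearMap.comp_apply, diagonal_single, map_sum, Finset.sum_eq_single (b.1, 0)]
    · rw [LinearMap.lTensor_tmul, augmentation_pullbackChain (isSimplicial_add (by lia)),
        if_pos rfl, pullbackChain_id]
      rfl
    · intro x hx hne
      rw [Finset.HasAntidiagonal.mem_antidiagonal] at hx
      rw [LinearMap.lTensor_tmul, augmentation_pullbackChain (isSimplicial_add (by lia)), if_neg,
        TensorProduct.tmul_zero]
      rintro h
      exact hne (Prod.ext (by lia) h)
    · simp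

lemma pullbackChain_mem_deg {b : Simplex S} {m : ℕ} {g : ℕ → ℕ} (h : IsSimplicial b.1 m g) :
    pullbackChain k b m g ∈ chainsDeg k S m :=
  Finsupp.single_mem_supported k _ (by
    change ((pullback b m g).1 : ℤ) = m
    rw [pullback_fst h])

variable (k S) in
/-- The graded coalgebra of the chains of a simplicial set. -/
def chainsGradedCoalgebra : GradedCoalgebra k (Chains k S) (chainsDeg k S) where
  toCoalgebra := chainsCoalgebra k S
  comul_mem n := by
    refine mem_of_single _ fun b hb => ?_
    change diagonal k S _ ∈ _
    rw [diagonal_single]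
    refine sum_mem fun x hx => ?_
    rw [Finset.HasAntidiagonal.mem_antidiagonal] at hx
    have hn : n = x.1 + x.2 := by
      rw [← show (b.1 : ℤ) = n from hb, ← hx, Nat.cast_add]
    rw [hn]
    exact tmul_mem_tensorFamily (pullbackChain_mem_deg (isSimplicial_id (by lia)))
      (pullbackChain_mem_deg (isSimplicial_add (by lia)))
  counit_eq_zero n hn := by
    refine fun x hx => (Submodule.mem_bot k).1 (mem_of_single _ (fun b hb => ?_) x hx)
    change augmentation k S _ ∈ _
    rw [← pullbackChain_id, augmentation_pullbackChain (isSimplicial_id le_rfl), if_neg]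
    · exact zero_mem _
    · intro h
      refine hn ?_
      rw [← show (b.1 : ℤ) = n from hb, h, Nat.cast_zero]

end Chains

end SerreSS

end

noncomputable section

namespace SerreSS

/-! ### The Serre filtration and the diagonal -/

section Serre

open Finset.HasAntidiagonal (antidiagonal)

variable {k : Type v} [Field k] {S T : SSet.{u}}

lemma coface_of_le {p i j : ℕ} (h : i ≤ p) : coface i (p + j) = p + 1 + j := by
  simp only [coface]
  split_ifs <;> lia

lemma coface_of_lt {i j : ℕ} (h : j < i) : coface i j = j := if_pos h

lemma coface_add (p i j : ℕ) : coface (p + i) (p + j) = p + coface i j := by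
  simp only [coface]
  split_ifs <;> lia

/-- The terms of the co-Leibniz rule for the Alexander--Whitney diagonal. -/
lemma sum_coface_pullbackChain (b : Simplex S) (p q : ℕ) :
    ∑ i ∈ Finset.range (p + q + 2), (-1 : k) ^ i • (pullbackChain k b p (coface i) ⊗ₜ[k]
      pullbackChain k b q fun j => coface i (p + j)) =
    ∑ i ∈ Finset.range (p + 2), (-1 : k) ^ i • (pullbackChain k b p (coface i) ⊗ₜ[k]
      pullbackChain k b q (p + 1 + ·)) +
    (-1 : k) ^ p • ∑ i ∈ Finset.range (q + 2), (-1 : k) ^ i • (pullbackChain k b p id ⊗ₜ[k]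
      pullbackChain k b q fun j => p + coface i j) := by
  -- Omitting vertex i ≤ p affects the front factor, later vertices the back factor. On the right
  -- there are two extra terms, the last face of the front and the first face of the back. They are
  -- the same tensor with opposite signs and cancel.
  rw [show p + q + 2 = p + 1 + (q + 1) by lia, Finset.sum_range_add _ (p + 1),
    Finset.sum_range_succ _ (p + 1), Finset.sum_range_succ' _ (q + 1), smul_add, Finset.smul_sum]
  have h1 : ∀ i ∈ Finset.range (p + 1), (-1 : k) ^ i • (pullbackChain k b p (coface i) ⊗ₜ[k]
      pullbackChain k b q fun j => coface i (p + j)) = (-1 : k) ^ i •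
        (pullbackChain k b p (coface i) ⊗ₜ[k] pullbackChain k b q (p + 1 + ·)) := by
    intro i hi
    rw [Finset.mem_range] at hi
    simp only [coface_of_le (Nat.le_of_lt_succ hi)]
  have h2 : ∀ i ∈ Finset.range (q + 1), (-1 : k) ^ (p + 1 + i) •
      (pullbackChain k b p (coface (p + 1 + i)) ⊗ₜ[k]
        pullbackChain k b q fun j => coface (p + 1 + i) (p + j)) =
      (-1 : k) ^ p • (-1 : k) ^ (i + 1) • (pullbackChain k b p id ⊗ₜ[k]
        pullbackChain k b q fun j => p + coface (i + 1) j) := by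
    intro i _
    rw [smul_smul, ← pow_add, show p + 1 + i = p + (i + 1) by lia]
    simp only [coface_add]
    rw [pullbackChain_congr (g := coface (p + (i + 1))) (g' := id)]
    exact fun j hj => coface_of_lt (by lia)
  have h3 : pullbackChain k b p (coface (p + 1)) = pullbackChain k b p id :=
    pullbackChain_congr fun j hj => coface_of_lt (by lia)
  have h4 : (fun j => p + coface 0 j) = (p + 1 + ·) := funext fun j => by
    simp only [coface, Nat.not_lt_zero, if_false]
    lia
  rw [Finset.sum_congr rfl h1, Finset.sum_congr rfl h2, h3, h4, pow_succ, pow_zero, one_smul,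
    mul_neg_one, add_add_add_comm, ← add_smul, neg_add_cancel, zero_smul, add_zero]

lemma sign_pullbackChain (f : S ⟶ T) {b : Simplex S} {m : ℕ} {g : ℕ → ℕ}
    (h : IsSimplicial b.1 m g) :
    (serreComplex k f).sign (pullbackChain k b m g) = (-1 : k) ^ m • pullbackChain k b m g := by
  rw [(serreComplex k f).sign_apply (pullbackChain_mem_deg h), ← Int.cast_smul_eq_zsmul k]
  congr 1
  rw [Int.negOnePow_def]
  simp

/-- The Alexander--Whitney diagonal is a chain map. -/
lemma diagonal_chainsD (f : S ⟶ T) (x : Chains k S) :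
    diagonal k S (chainsD k S x) =
      tensorD (serreComplex k f).sign (chainsD k S) (diagonal k S x) := by
  revert x
  refine LinearMap.congr_fun (f := diagonal k S ∘ₗ chainsD k S) (g := tensorD
    (serreComplex k f).sign (chainsD k S) ∘ₗ diagonal k S) (chains_linearMap_ext fun b => ?_)
  rw [LinearMap.comp_apply, LinearMap.comp_apply, diagonal_single, tensorD, LinearMap.add_apply,
    map_sum, map_sum]
  simp only [TensorProduct.map_tmul, LinearMap.id_apply]
  obtain hb | ⟨n, hb⟩ : b.1 = 0 ∨ ∃ n, b.1 = n + 1 := by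
    cases b.1 <;> simp
  · have h0 : chainsD k S (Finsupp.single b 1) = 0 := by
      obtain ⟨m, b⟩ := b
      obtain rfl : m = 0 := hb
      exact chainsD_single_zero k S b 1
    rw [h0, map_zero, hb, Finset.Nat.antidiagonal_zero, Finset.sum_singleton, Finset.sum_singleton,
      chainsD_pullbackChain_zero (isSimplicial_id (Nat.zero_le _)),
      chainsD_pullbackChain_zero (isSimplicial_add (by lia)), TensorProduct.zero_tmul,
      TensorProduct.tmul_zero, add_zero]
  -- In each of the two sums the term whose differentiated factor has dimension 0 is split off; the
  -- remaining terms are indexed by the decompositions of `n`.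
  · rw [chainsD_single_succ hb, hb, Finset.Nat.sum_antidiagonal_succ,
      Finset.Nat.sum_antidiagonal_succ']
    simp only
    rw [chainsD_pullbackChain_zero (isSimplicial_id (Nat.zero_le _)),
      chainsD_pullbackChain_zero (isSimplicial_add (by lia)), TensorProduct.zero_tmul,
      TensorProduct.tmul_zero, zero_add, zero_add, map_sum, ← Finset.sum_add_distrib]
    have h1 : ∀ i ∈ Finset.range (n + 2), diagonal k S ((-1 : k) ^ i •
        pullbackChain k b n (coface i)) = ∑ x ∈ antidiagonal n, (-1 : k) ^ i •
          (pullbackChain k b x.1 (coface i) ⊗ₜ[k]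
            pullbackChain k b x.2 fun j => coface i (x.1 + j)) := by
      intro i _
      rw [map_smul, diagonal_pullbackChain (hb ▸ isSimplicial_coface n i), Finset.smul_sum]
    rw [Finset.sum_congr rfl h1, Finset.sum_comm]
    refine Finset.sum_congr rfl fun x hx => ?_
    rw [Finset.HasAntidiagonal.mem_antidiagonal] at hx
    subst hx
    rw [sum_coface_pullbackChain, chainsD_pullbackChain (isSimplicial_id (by lia)),
      chainsD_pullbackChain (isSimplicial_add (by lia)),
      sign_pullbackChain f (isSimplicial_id (by lia)), TensorProduct.sum_tmul,
      TensorProduct.tmul_sum, Finset.smul_sum]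
    refine congrArg₂ _ (Finset.sum_congr rfl fun i _ => ?_) (Finset.sum_congr rfl fun i _ => ?_)
    · rw [TensorProduct.smul_tmul']
      rfl
    · rw [TensorProduct.tmul_smul, ← TensorProduct.smul_tmul', smul_comm]

lemma augmentation_chainsD (x : Chains k S) : augmentation k S (chainsD k S x) = 0 := by
  revert x
  refine LinearMap.congr_fun (f := augmentation k S ∘ₗ chainsD k S) (g := 0)
    (chains_linearMap_ext fun b => ?_)
  rw [LinearMap.comp_apply, LinearMap.zero_apply]
  obtain hb | ⟨n, hb⟩ : b.1 = 0 ∨ ∃ n, b.1 = n + 1 := by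
    cases b.1 <;> simp
  · obtain ⟨m, b⟩ := b
    obtain rfl : m = 0 := hb
    rw [chainsD_single_zero, map_zero]
  · rw [chainsD_single_succ hb, map_sum]
    have h1 : ∀ i ∈ Finset.range (n + 2), augmentation k S ((-1 : k) ^ i •
        pullbackChain k b n (coface i)) = (-1 : k) ^ i * if n = 0 then 1 else 0 := by
      intro i _
      rw [map_smul, augmentation_pullbackChain (hb ▸ isSimplicial_coface n i), smul_eq_mul]
    rw [Finset.sum_congr rfl h1]
    by_cases hn : n = 0
    · subst hn
      simp [Finset.sum_range_succ]
    · simp [hn]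

/-- A simplex whose image factors through the vertices `lo, …, hi` of a simplex has filtration
`hi - lo`. -/
lemma mem_serreSimplices_of_hom (f : S ⟶ T) (b : Simplex S) {m : ℕ}
    (g : SimplexCategory.mk b.1 ⟶ SimplexCategory.mk m) (t : Simplices T m)
    (h : f.app _ b.2 = T.map g.op t) {lo hi : ℕ}
    (hg : ∀ j, lo ≤ (g.toOrderHom j : ℕ) ∧ (g.toOrderHom j : ℕ) ≤ hi) :
    b ∈ serreSimplices f (hi - lo) := by
  have hlo : lo ≤ hi := (hg 0).1.trans (hg 0).2
  have hsurj : Function.Surjective (Limits.factorThruImage g).toOrderHom :=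
    SimplexCategory.epi_iff_surjective.1 inferInstance
  have hinj : Function.Injective (Limits.image.ι g).toOrderHom :=
    SimplexCategory.mono_iff_injective.1 inferInstance
  have hι : ∀ i, lo ≤ ((Limits.image.ι g).toOrderHom i : ℕ) ∧
      ((Limits.image.ι g).toOrderHom i : ℕ) ≤ hi := by
    intro i
    obtain ⟨j, rfl⟩ := hsurj i
    have e : (Limits.image.ι g).toOrderHom ((Limits.factorThruImage g).toOrderHom j) =
        g.toOrderHom j := by
      conv_rhs => rw [← Limits.image.fac g]
      rfl
    rw [e]
    exact hg j
  refine ⟨(Limits.image g).len, ?_, Limits.factorThruImage g, T.map (Limits.image.ι g).op t,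
    hsurj, ?_⟩
  -- The vertices of the image inject into the hi - lo + 1 integers from `lo` to `hi`, which bounds
  -- its dimension.
  · have := Fintype.card_le_of_injective
      (fun i : Fin ((Limits.image g).len + 1) => (⟨(Limits.image.ι g).toOrderHom i,
        Finset.mem_Icc.2 (hι i)⟩ : Finset.Icc lo hi))
      fun i j hij => hinj (Fin.ext (congrArg (fun x : Finset.Icc lo hi => (x : ℕ)) hij))
    rw [Fintype.card_fin, Fintype.card_coe, Nat.card_Icc] at this
    lia
  · rw [h]
    have h2 : T.map (Limits.factorThruImage g).op (T.map (Limits.image.ι g).op t) =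
        T.map (Limits.factorThruImage g ≫ Limits.image.ι g).op t := by
      rw [op_comp, Functor.map_comp]; rfl
    rw [Limits.image.fac] at h2
    exact h2.symm

lemma pullback_mem_serreSimplices (f : S ⟶ T) {b : Simplex S} {n m : ℕ} {g : ℕ → ℕ}
    (hg : IsSimplicial b.1 n g) (s : SimplexCategory.mk b.1 ⟶ SimplexCategory.mk m)
    (t : Simplices T m) (h : f.app _ b.2 = T.map s.op t) {lo hi : ℕ}
    (hs : ∀ j : Fin (b.1 + 1), g 0 ≤ j → (j : ℕ) ≤ g n →
      lo ≤ (s.toOrderHom j : ℕ) ∧ (s.toOrderHom j : ℕ) ≤ hi) :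
    pullback b n g ∈ serreSimplices f (hi - lo) := by
  rw [pullback_eq hg]
  refine mem_serreSimplices_of_hom f ⟨n, S.map (simplicialHom hg).op b.2⟩ (simplicialHom hg ≫ s)
    t ?_ fun j => ?_
  · have h1 : f.app _ (S.map (simplicialHom hg).op b.2) =
        T.map (simplicialHom hg).op (f.app _ b.2) :=
      NatTrans.naturality_apply f (simplicialHom hg).op b.2
    refine h1.trans ?_
    rw [h, op_comp, Functor.map_comp]
    rfl
  · have hj := Nat.le_of_lt_succ j.2
    exact hs ⟨g j, Nat.lt_succ_of_le (hg.1 j hj)⟩ (hg.2 0 j (Nat.zero_le _) hj)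
      (hg.2 j n hj le_rfl)

/-- The front and back faces share the vertex `x.1`. As `s` is monotone with value `v` there, the
front face lies over the vertices 0, …, v and the back face over v, …, m, so their filtrations `v`
and `m - v` have sum `m ≤ p`. -/
lemma diagonal_mem_tensorFamily (f : S ⟶ T) (p : ℤ) :
    ∀ x ∈ serreFil k f p, diagonal k S x ∈ tensorFamily (serreFil k f) p := by
  refine mem_of_single _ fun b hb => ?_
  obtain ⟨m, hm, s, t, -, h⟩ := hb
  rw [diagonal_single]
  refine sum_mem fun x hx => ?_
  rw [Finset.HasAntidiagonal.mem_antidiagonal] at hx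
  let v : ℕ := s.toOrderHom ⟨x.1, by lia⟩
  have h1 : pullbackChain k b x.1 id ∈ serreFil k f v := by
    refine Finsupp.single_mem_supported k _ ?_
    have := pullback_mem_serreSimplices f (isSimplicial_id (by lia)) s t h (n := x.1) (lo := 0)
      (hi := v) fun j _ hj => ⟨Nat.zero_le _, s.toOrderHom.monotone (show j ≤ ⟨x.1, _⟩ from hj)⟩
    rwa [Nat.cast_zero, sub_zero] at this
  have h2 : pullbackChain k b x.2 (x.1 + ·) ∈ serreFil k f (m - v) := by
    refine Finsupp.single_mem_supported k _ ?_
    exact pullback_mem_serreSimplices f (isSimplicial_add (by lia)) s t h (n := x.2) (lo := v)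
      (hi := m) fun j hj _ => ⟨s.toOrderHom.monotone (show ⟨x.1, _⟩ ≤ j from hj),
        Nat.le_of_lt_succ (s.toOrderHom j).2⟩
  -- The slack `p - m` is absorbed into the second factor.
  have h3 := serreFil_mono k f (show (m : ℤ) - v ≤ p - v by lia) h2
  have := tmul_mem_tensorFamily h1 h3
  rwa [add_sub_cancel] at this

/-- The simplicial chains form a filtered differential graded coalgebra. -/
theorem isFilteredDGCoalgebra_serreComplex (f : S ⟶ T) :
    (serreComplex k f).IsFilteredDGCoalgebra (diagonal k S) (augmentation k S) :=
  ⟨⟨chainsGradedCoalgebra k S, rfl, rfl⟩, diagonal_chainsD f, augmentation_chainsD,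
    diagonal_mem_tensorFamily f⟩

/-- An `n`-simplex has filtration at most `n`, by taking the identity for the surjection; negative
stages are empty because dimensions are natural numbers. -/
lemma isFirstQuadrantFiltration_serreFil (f : S ⟶ T) :
    IsFirstQuadrantFiltration (serreComplex k f).deg (serreComplex k f).fil := by
  refine ⟨serreFil_mono k f, fun n p => ⟨fun hp => ?_, fun hp => ?_⟩⟩
  · have : serreSimplices f p = ∅ := by
      refine Set.eq_empty_of_forall_notMem ?_
      rintro b ⟨m, hm, -⟩
      lia
    change serreFil k f p ⊓ _ = ⊥
    rw [serreFil, this, Finsupp.supported_empty, bot_inf_eq]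
  · refine Finsupp.supported_mono fun b hb => ⟨b.1, le_of_eq_of_le hb hp, 𝟙 _, f.app _ b.2,
      Function.surjective_id, ?_⟩
    rw [op_id, T.map_id]
    rfl

end Serre

end SerreSS

end

theorem mainTheorem3 {k : Type v} [Field k] {E B : Type u} [TopologicalSpace E]
    [TopologicalSpace B] (π : C(E, B)) (hπ : SerreSS.IsSerreFibration π) :
    let C := SerreSS.singularSerreComplex k π
    let Δ := SerreSS.diagonal k (SerreSS.Sing E)
    let ε := SerreSS.augmentation k (SerreSS.Sing E)
    C.IsFilteredDGCoalgebra Δ ε ∧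
    ∃ (A : (SerreSS.serreSpectralSequence k π).CoalgebraStructure)
      (S : SerreSS.GradedCoalgebra k C.Homology C.homologyDeg),
      C.IsInducedCoalgebraStructure Δ ε A ∧
      C.IsHomologyCoalgebra Δ ε S ∧
      A.ConvergesTo C.homologyFil S := by
  have hC := SerreSS.isFilteredDGCoalgebra_serreComplex (k := k) (SerreSS.singMap π)
  exact ⟨hC, hC.exists_convergesTo (SerreSS.isFirstQuadrantFiltration_serreFil _)⟩
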